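/- **Theorem.** Let $c\in\mathbb R$ with $c\neq-\tfrac34,-\tfrac12,-1$, and let $\Omega\subset\{(u,v)\in\mathbb R^2:\ u\neq0\}$ be open. Consider the primary flow of the principal hierarchy of $B_2$, $$u_t=\partial_x\left[v-2\left(c+\tfrac34\right)u^2\right],\qquad v_t=\partial_x\left[-\tfrac43\left(c+\tfrac12\right)(c+1)u^3\right],\tag{1}$$ and its second-order deformations $$u_t=\partial_x\left[v-2\left(c+\tfrac34\right)u^2+\epsilon^2\alpha_1\right],\qquad v_t=\partial_x\left[-\tfrac43\left(c+\tfrac12\right)(c+1)u^3+\epsilon^2\alpha_2\right],\tag{2}$$ where $\alpha_i=a_{i3}u_{xx}+a_{i4}v_{xx}+a_{i5}u_x^2+a_{i6}v_x^2+a_{i7}u_xv_x$ and the $a_{ij}$ are smooth functions of $(u,v)\in\Omega$. Such a deformation is called *integrable* if every symmetry $u_\tau=\partial_x f_1(u,v)$, $v_\tau=\partial_x f_2(u,v)$ of (1), with $f_1,f_2$ smooth on $\Omega$, can be extended to a flow $u_\tau=\partial_x[f_1+\epsilon\, d_1+\epsilon^2 e_1]$, $v_\tau=\partial_x[f_2+\epsilon\,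 d_2+\epsilon^2 e_2]$ which commutes with (2) up to $O(\epsilon^3)$, where $d_i$, $e_i$ are homogeneous differential polynomials of degrees $1$ and $2$ with coefficients smooth on $\Omega$. Put $$r_A=-cu^2-u^2+v,\qquad r_B=-cu^2-\tfrac12u^2+v$$ (Riemann invariants of (1)). For functions $F_1$ on $r_A(\Omega)$ and $F_2$ on $r_B(\Omega)$ put $$a_{23}[F_1,F_2]=|u|^{4c+4}F_1(r_A)+|u|^{-4c-2}F_2(r_B).\tag{3}$$ For a smooth function $a_{23}$ on $\Omega$ let $N(a_{23})$ be the deformation (2) with $$\alpha_1=a_{16}(2cuu_x+uu_x-v_x)(2cuu_x+2uu_x-v_x),\qquad \alpha_2=a_{23}u_{xx}+a_{24}v_{xx}+a_{25}u_x^2+a_{26}v_x^2+a_{27}u_xv_x,$$ where, writing $g=a_{23}$, $q=c+1$, $w=2c+1$, $s=4c+3$, $K=64c^4+192c^3+252c^2+162c+41$, $L=32c^4+96c^3+140c^2+102c+29$, $M=512c^6+2304c^5+4832c^4+5856c^3+4168c^2+1608c+259$, $$a_{16}=\frac{K}{8qws}g_{vv}+\frac{K}{16q^2w^2u}g_{uv}+\frac{K}{16q^2w^2su^2}g_{uu}-\frac{3K}{16q^2w^2su^3}g_u-\frac{256c^6+1152c^5+2096c^4+1968c^3+960c^2+198c+3}{4q^2w^2su^4}g,$$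 $$a_{24}=-\frac{u^3}{4s}g_{vv}-\frac{u^2}{8qw}g_{uv}-\frac{u}{8qws}g_{uu}+\frac{3}{8qws}g_u-\frac{4c^2+6c+3}{2qwsu}g,$$ $$a_{25}=\frac{L}{4}u^3g_{vv}+\frac{sL}{8qw}u^2g_{uv}+\frac{L}{8qw}u\,g_{uu}+\frac{qw}{s}u\,g_v-\frac{96c^4+288c^3+404c^2+282c+79}{8qw}g_u-\frac{128c^6+576c^5+1056c^4+1008c^3+492c^2+90c-5}{2qwu}g,$$ $$a_{26}=\frac{Lu}{8qw}g_{vv}+\frac{sL}{16q^2w^2}g_{uv}+\frac{L}{16q^2w^2u}g_{uu}-\frac{20c^2+30c+11}{4qwsu}g_v-\frac{(8c^2+12c+13)(12c^2+18c+7)}{16q^2w^2u^2}g_u-\frac{128c^6+576c^5+1056c^4+1008c^3+488c^2+84c-7}{4q^2w^2u^3}g,$$ $$a_{27}=-\frac{Mu^2}{8qws}g_{vv}-\frac{Mu}{16q^2w^2}g_{uv}-\frac{M}{16q^2w^2s}g_{uu}+g_v+\frac{1536c^6+6912c^5+14432c^4+17376c^3+12296c^2+4728c+761}{16q^2w^2su}g_u$$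 $$\qquad+\frac{2048c^8+12288c^7+31872c^6+46656c^5+41600c^4+22416c^3+6616c^2+744c-35}{4q^2w^2su^2}g.$$ Then: 1. Every integrable second-order deformation (2) is carried, up to $O(\epsilon^3)$, to the form $N(a_{23})$ for some smooth $a_{23}$ on $\Omega$ by a Miura transformation $\tilde u=u+\epsilon^2\partial_x(\beta_{11}u_x+\beta_{12}v_x)$, $\tilde v=v+\epsilon^2\partial_x(\beta_{21}u_x+\beta_{22}v_x)$ with $\beta_{ij}$ smooth functions of $(u,v)\in\Omega$. Near every point of $\Omega$ the function $a_{23}$ is of the form (3), with $F_1,F_2$ smooth functions of one variable; and if the level sets of $r_A$ and of $r_B$ in $\Omega$ are connected, then $a_{23}$ is of the form (3) on all of $\Omega$, with $F_1$, $F_2$ smooth on $r_A(\Omega)$, $r_B(\Omega)$. 2. $F_1$ and $F_2$ are arbitrary: for all smooth $F_1$ on $r_A(\Omega)$ and $F_2$ on $r_B(\Omega)$, the deformation $N(a_{23}[F_1,F_2])$ is integrable. 3. $F_1$ and $F_2$ are genuine parameters: if a Miura transformation $w=(u,v)+\epsilon Y_1+\epsilon^2Y_2$, with $Y_1,Y_2$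 homogeneous differential polynomials of degrees $1$ and $2$ whose coefficients are smooth on $\Omega$, carries $N(a_{23}[F_1,F_2])$ to $N(a_{23}[G_1,G_2])$ up to $O(\epsilon^3)$, where $F_1,G_1$ are smooth on $r_A(\Omega)$ and $F_2,G_2$ are smooth on $r_B(\Omega)$, then $F_1=G_1$ on $r_A(\Omega)$ and $F_2=G_2$ on $r_B(\Omega)$. -/

import Mathlib

open scoped ContDiff Topology
open Asymptotics

noncomputable section

namespace B2

/-- A field configuration `x ↦ (u x, v x)`. -/
abbrev Curve := ℝ → ℝ × ℝ

/-- A differential operator on field configurations; `X q x` is the value at `x` of the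
differential function `X` evaluated on `q`. It is also read as the evolutionary system
`q_t = X q`. -/
abbrev DiffOp := Curve → ℝ → ℝ × ℝ

/-- First variation `d/ds X(q + s h) (x)` at `s = 0`. -/
def variation (X : DiffOp) (q h : Curve) (x : ℝ) : ℝ × ℝ :=
  deriv (fun s : ℝ => X (q + s • h) x) 0

/-- The commutator of the evolutionary flows `q_t = X q` and `q_τ = Y q`. -/
def commutator (X Y : DiffOp) : DiffOp := fun q x =>
  variation X q (Y q) x - variation Y q (X q) x

/-- A homogeneous differential polynomial of degree one, `ux * u_x + vx * v_x`, whose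
coefficients are functions of `(u, v)`. -/
structure Poly1 where
  ux : ℝ × ℝ → ℝ
  vx : ℝ × ℝ → ℝ

/-- A homogeneous differential polynomial of degree two,
`uxx * u_xx + vxx * v_xx + uxux * u_x ^ 2 + vxvx * v_x ^ 2 + uxvx * u_x * v_x`, whose
coefficients are functions of `(u, v)`. -/
structure Poly2 where
  uxx : ℝ × ℝ → ℝ
  vxx : ℝ × ℝ → ℝ
  uxux : ℝ × ℝ → ℝ
  vxvx : ℝ × ℝ → ℝ
  uxvx : ℝ × ℝ → ℝ

/-- Value of a degree one differential polynomial on a configuration. -/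
def Poly1.eval (P : Poly1) (q : Curve) (x : ℝ) : ℝ :=
  P.ux (q x) * (deriv q x).1 + P.vx (q x) * (deriv q x).2

/-- Value of a degree two differential polynomial on a configuration. -/
def Poly2.eval (P : Poly2) (q : Curve) (x : ℝ) : ℝ :=
  P.uxx (q x) * (deriv (deriv q) x).1 + P.vxx (q x) * (deriv (deriv q) x).2
    + P.uxux (q x) * (deriv q x).1 ^ 2 + P.vxvx (q x) * (deriv q x).2 ^ 2
    + P.uxvx (q x) * ((deriv q x).1 * (deriv q x).2)

/-- The coefficients are smooth on `Ω`. -/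
def Poly1.SmoothOn (P : Poly1) (Ω : Set (ℝ × ℝ)) : Prop :=
  ContDiffOn ℝ ∞ P.ux Ω ∧ ContDiffOn ℝ ∞ P.vx Ω

/-- The coefficients are smooth on `Ω`. -/
def Poly2.SmoothOn (P : Poly2) (Ω : Set (ℝ × ℝ)) : Prop :=
  ContDiffOn ℝ ∞ P.uxx Ω ∧ ContDiffOn ℝ ∞ P.vxx Ω ∧ ContDiffOn ℝ ∞ P.uxux Ω ∧
    ContDiffOn ℝ ∞ P.vxvx Ω ∧ ContDiffOn ℝ ∞ P.uxvx Ω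

/-- The zero differential polynomial of degree one. -/
def Poly1.zero : Poly1 := ⟨fun _ => 0, fun _ => 0⟩

/-- A two-component differential polynomial of degree one, as an operator. -/
def op1 (P₁ P₂ : Poly1) : DiffOp := fun q x => (P₁.eval q x, P₂.eval q x)

/-- A two-component differential polynomial of degree two, as an operator. -/
def op2 (P₁ P₂ : Poly2) : DiffOp := fun q x => (P₁.eval q x, P₂.eval q x)

/-- The system of conservation laws `q_t = ∂ₓ [f(q)]`. -/
def hydroFlow (f : ℝ × ℝ → ℝ × ℝ) : DiffOp := fun q => deriv (fun x => f (q x))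

/-- The system of conservation laws
`u_t = ∂ₓ [f₁(u,v) + ε b₁ + ε² a₁]`, `v_t = ∂ₓ [f₂(u,v) + ε b₂ + ε² a₂]`, with `b₁, b₂` of degree
one and `a₁, a₂` of degree two. -/
def deformedFlow (f : ℝ × ℝ → ℝ × ℝ) (b₁ b₂ : Poly1) (a₁ a₂ : Poly2) (ε : ℝ) : DiffOp :=
  fun q => deriv (fun x => f (q x) + ε • op1 b₁ b₂ q x + ε ^ 2 • op2 a₁ a₂ q x)

/-- The fluxes of the primary flow `t_{1,0}` of the principal hierarchy of `B_2`. -/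
def primaryFlux (c : ℝ) (p : ℝ × ℝ) : ℝ × ℝ :=
  (p.2 - 2 * (c + 3 / 4) * p.1 ^ 2, -(4 / 3) * (c + 1 / 2) * (c + 1) * p.1 ^ 3)

/-- The second-order deformation of the primary flow with second-order parts `a₁, a₂`. -/
def deformedPrimary (c : ℝ) (a₁ a₂ : Poly2) (ε : ℝ) : DiffOp :=
  deformedFlow (primaryFlux c) Poly1.zero Poly1.zero a₁ a₂ ε

/-- `q_τ = ∂ₓ [f(q)]` is a symmetry, on `Ω`, of the dispersionless primary flow. The identity is
local in `x`, so it is tested on smooth configurations at the points they send to `Ω`. -/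
def IsDispersionlessSymmetry (c : ℝ) (Ω : Set (ℝ × ℝ)) (f : ℝ × ℝ → ℝ × ℝ) : Prop :=
  ContDiffOn ℝ ∞ f Ω ∧
    ∀ q : Curve, ContDiff ℝ ∞ q → ∀ x : ℝ, q x ∈ Ω →
      commutator (hydroFlow (primaryFlux c)) (hydroFlow f) q x = 0

/-- Integrability, up to order two in `ε`, of a second-order deformation of the primary flow:
every symmetry of the dispersionless limit extends to a flow that commutes with the
deformation up to `O(ε³)`. -/
def IsIntegrable (c : ℝ) (Ω : Set (ℝ × ℝ)) (a₁ a₂ : Poly2) : Prop :=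
  ∀ f : ℝ × ℝ → ℝ × ℝ, IsDispersionlessSymmetry c Ω f →
    ∃ (b₁ b₂ : Poly1) (d₁ d₂ : Poly2),
      b₁.SmoothOn Ω ∧ b₂.SmoothOn Ω ∧ d₁.SmoothOn Ω ∧ d₂.SmoothOn Ω ∧
      ∀ q : Curve, ContDiff ℝ ∞ q → ∀ x : ℝ, q x ∈ Ω →
        (fun ε : ℝ => commutator (deformedPrimary c a₁ a₂ ε) (deformedFlow f b₁ b₂ d₁ d₂ ε) q x)
          =O[𝓝 0] (fun ε : ℝ => ε ^ 3)

/-- The Miura transformation `w = q + ε Y₁[q] + ε² Y₂[q]` (leading term the identity). -/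
def miura (Y₁ Y₂ : DiffOp) (ε : ℝ) : DiffOp := fun q x => q x + ε • Y₁ q x + ε ^ 2 • Y₂ q x

/-- The Miura transformation `w = q + ε Y₁[q] + ε² Y₂[q]` carries the system `q_t = X ε q` to the
system `w_t = X' ε w` up to `O(ε³)`. -/
def Transforms (Ω : Set (ℝ × ℝ)) (Y₁ Y₂ : DiffOp) (X X' : ℝ → DiffOp) : Prop :=
  ∀ q : Curve, ContDiff ℝ ∞ q → ∀ x : ℝ, q x ∈ Ω →
    (fun ε : ℝ => variation (miura Y₁ Y₂ ε) q (X ε q) x - X' ε (miura Y₁ Y₂ ε q) x)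
      =O[𝓝 0] (fun ε : ℝ => ε ^ 3)

/-- The partial derivative in `u`. -/
def dU (g : ℝ × ℝ → ℝ) (p : ℝ × ℝ) : ℝ := fderiv ℝ g p (1, 0)

/-- The partial derivative in `v`. -/
def dV (g : ℝ × ℝ → ℝ) (p : ℝ × ℝ) : ℝ := fderiv ℝ g p (0, 1)

/-- The coefficient `a_16` as a differential expression in `g = a_23`. -/
def coef16 (c : ℝ) (g : ℝ × ℝ → ℝ) (p : ℝ × ℝ) : ℝ :=
  1 / 8 * (64 * c ^ 4 + 192 * c ^ 3 + 252 * c ^ 2 + 162 * c + 41)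
      / ((c + 1) * (2 * c + 1) * (4 * c + 3)) * dV (dV g) p
    + 1 / 16 * (64 * c ^ 4 + 192 * c ^ 3 + 252 * c ^ 2 + 162 * c + 41)
      / ((c + 1) ^ 2 * (2 * c + 1) ^ 2 * p.1) * dU (dV g) p
    + 1 / 16 * (64 * c ^ 4 + 192 * c ^ 3 + 252 * c ^ 2 + 162 * c + 41)
      / ((c + 1) ^ 2 * (2 * c + 1) ^ 2 * (4 * c + 3) * p.1 ^ 2) * dU (dU g) p
    - 3 / 16 * (64 * c ^ 4 + 192 * c ^ 3 + 252 * c ^ 2 + 162 * c + 41)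
      / ((c + 1) ^ 2 * (2 * c + 1) ^ 2 * (4 * c + 3) * p.1 ^ 3) * dU g p
    - 1 / 4 * (256 * c ^ 6 + 1152 * c ^ 5 + 2096 * c ^ 4 + 1968 * c ^ 3 + 960 * c ^ 2
        + 198 * c + 3)
      / ((c + 1) ^ 2 * (2 * c + 1) ^ 2 * (4 * c + 3) * p.1 ^ 4) * g p

/-- The coefficient `a_24` as a differential expression in `g = a_23`. -/
def coef24 (c : ℝ) (g : ℝ × ℝ → ℝ) (p : ℝ × ℝ) : ℝ :=
  -(1 / 4) * p.1 ^ 3 / (4 * c + 3) * dV (dV g) p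
    - 1 / 8 * p.1 ^ 2 / ((c + 1) * (2 * c + 1)) * dU (dV g) p
    - 1 / 8 * p.1 / ((c + 1) * (2 * c + 1) * (4 * c + 3)) * dU (dU g) p
    + 3 / 8 / ((2 * c + 1) * (4 * c + 3) * (c + 1)) * dU g p
    - 1 / 2 * (4 * c ^ 2 + 6 * c + 3) / ((c + 1) * (4 * c + 3) * (2 * c + 1) * p.1) * g p

/-- The coefficient `a_25` as a differential expression in `g = a_23`. -/
def coef25 (c : ℝ) (g : ℝ × ℝ → ℝ) (p : ℝ × ℝ) : ℝ :=
  1 / 4 * (32 * c ^ 4 + 96 * c ^ 3 + 140 * c ^ 2 + 102 * c + 29) * p.1 ^ 3 * dV (dV g) p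
    + 1 / 8 * p.1 ^ 2 * (4 * c + 3) * (32 * c ^ 4 + 96 * c ^ 3 + 140 * c ^ 2 + 102 * c + 29)
      / ((2 * c + 1) * (c + 1)) * dU (dV g) p
    + 1 / 8 * p.1 * (32 * c ^ 4 + 96 * c ^ 3 + 140 * c ^ 2 + 102 * c + 29)
      / ((c + 1) * (2 * c + 1)) * dU (dU g) p
    + p.1 * (2 * c + 1) * (c + 1) / (4 * c + 3) * dV g p
    - 1 / 8 * (96 * c ^ 4 + 288 * c ^ 3 + 404 * c ^ 2 + 282 * c + 79)
      / ((2 * c + 1) * (c + 1)) * dU g p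
    - 1 / 2 * (128 * c ^ 6 + 576 * c ^ 5 + 1056 * c ^ 4 + 1008 * c ^ 3 + 492 * c ^ 2
        + 90 * c - 5)
      / ((2 * c + 1) * (c + 1) * p.1) * g p

/-- The coefficient `a_26` as a differential expression in `g = a_23`. -/
def coef26 (c : ℝ) (g : ℝ × ℝ → ℝ) (p : ℝ × ℝ) : ℝ :=
  1 / 8 * (32 * c ^ 4 + 96 * c ^ 3 + 140 * c ^ 2 + 102 * c + 29) * p.1
      / ((c + 1) * (2 * c + 1)) * dV (dV g) p
    + 1 / 16 * (4 * c + 3) * (32 * c ^ 4 + 96 * c ^ 3 + 140 * c ^ 2 + 102 * c + 29)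
      / ((c + 1) ^ 2 * (2 * c + 1) ^ 2) * dU (dV g) p
    + 1 / 16 * (32 * c ^ 4 + 96 * c ^ 3 + 140 * c ^ 2 + 102 * c + 29)
      / (p.1 * (c + 1) ^ 2 * (2 * c + 1) ^ 2) * dU (dU g) p
    - 1 / 4 * (20 * c ^ 2 + 30 * c + 11)
      / ((2 * c + 1) * (4 * c + 3) * (c + 1) * p.1) * dV g p
    - 1 / 16 * (8 * c ^ 2 + 12 * c + 13) * (12 * c ^ 2 + 18 * c + 7)
      / ((c + 1) ^ 2 * (2 * c + 1) ^ 2 * p.1 ^ 2) * dU g p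
    - 1 / 4 * (128 * c ^ 6 + 576 * c ^ 5 + 1056 * c ^ 4 + 1008 * c ^ 3 + 488 * c ^ 2
        + 84 * c - 7)
      / (p.1 ^ 3 * (c + 1) ^ 2 * (2 * c + 1) ^ 2) * g p

/-- The coefficient `a_27` as a differential expression in `g = a_23`. -/
def coef27 (c : ℝ) (g : ℝ × ℝ → ℝ) (p : ℝ × ℝ) : ℝ :=
  -(1 / 8) * (512 * c ^ 6 + 2304 * c ^ 5 + 4832 * c ^ 4 + 5856 * c ^ 3 + 4168 * c ^ 2
        + 1608 * c + 259) * p.1 ^ 2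
      / ((2 * c + 1) * (4 * c + 3) * (c + 1)) * dV (dV g) p
    - 1 / 16 * (512 * c ^ 6 + 2304 * c ^ 5 + 4832 * c ^ 4 + 5856 * c ^ 3 + 4168 * c ^ 2
        + 1608 * c + 259) * p.1
      / ((c + 1) ^ 2 * (2 * c + 1) ^ 2) * dU (dV g) p
    - 1 / 16 * (512 * c ^ 6 + 2304 * c ^ 5 + 4832 * c ^ 4 + 5856 * c ^ 3 + 4168 * c ^ 2
        + 1608 * c + 259)
      / ((4 * c + 3) * (c + 1) ^ 2 * (2 * c + 1) ^ 2) * dU (dU g) p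
    + dV g p
    + 1 / 16 * (1536 * c ^ 6 + 6912 * c ^ 5 + 14432 * c ^ 4 + 17376 * c ^ 3 + 12296 * c ^ 2
        + 4728 * c + 761)
      / (p.1 * (c + 1) ^ 2 * (2 * c + 1) ^ 2 * (4 * c + 3)) * dU g p
    + 1 / 4 * (2048 * c ^ 8 + 12288 * c ^ 7 + 31872 * c ^ 6 + 46656 * c ^ 5 + 41600 * c ^ 4
        + 22416 * c ^ 3 + 6616 * c ^ 2 + 744 * c - 35)
      / ((2 * c + 1) ^ 2 * (c + 1) ^ 2 * (4 * c + 3) * p.1 ^ 2) * g p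

/-- First component of the normal form:
`a_16 * (2 c u u_x + u u_x - v_x) * (2 c u u_x + 2 u u_x - v_x)`, expanded. -/
def normal₁ (c : ℝ) (g : ℝ × ℝ → ℝ) : Poly2 where
  uxx := fun _ => 0
  vxx := fun _ => 0
  uxux := fun p => coef16 c g p * ((2 * c * p.1 + p.1) * (2 * c * p.1 + 2 * p.1))
  vxvx := fun p => coef16 c g p
  uxvx := fun p => -(coef16 c g p * ((2 * c * p.1 + p.1) + (2 * c * p.1 + 2 * p.1)))

/-- Second component of the normal form:
`a_23 u_xx + a_24 v_xx + a_25 u_x ^ 2 + a_26 v_x ^ 2 + a_27 u_x v_x`. -/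
def normal₂ (c : ℝ) (g : ℝ × ℝ → ℝ) : Poly2 where
  uxx := g
  vxx := coef24 c g
  uxux := coef25 c g
  vxvx := coef26 c g
  uxvx := coef27 c g

/-- The normal form of the deformed primary flow, with `a_23 = g`. -/
def normalFlow (c : ℝ) (g : ℝ × ℝ → ℝ) (ε : ℝ) : DiffOp :=
  deformedPrimary c (normal₁ c g) (normal₂ c g) ε

/-- The Riemann invariant which is the argument of `F_1`. -/
def invA (c : ℝ) (p : ℝ × ℝ) : ℝ := -c * p.1 ^ 2 - p.1 ^ 2 + p.2

/-- The Riemann invariant which is the argument of `F_2`. -/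
def invB (c : ℝ) (p : ℝ × ℝ) : ℝ := -c * p.1 ^ 2 - 1 / 2 * p.1 ^ 2 + p.2

/-- `F_1`, `F_2` are smooth functions of the values taken on `U` by the respective Riemann
invariant. -/
def AdmissiblePair (c : ℝ) (U : Set (ℝ × ℝ)) (F₁ F₂ : ℝ → ℝ) : Prop :=
  ContDiffOn ℝ ∞ F₁ (invA c '' U) ∧ ContDiffOn ℝ ∞ F₂ (invB c '' U)

/-- `|u| ^ (4 c + 4) * F_1 + |u| ^ (- 4 c - 2) * F_2`. -/
def a23 (c : ℝ) (F₁ F₂ : ℝ → ℝ) (p : ℝ × ℝ) : ℝ :=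
  |p.1| ^ (4 * c + 4) * F₁ (invA c p) + |p.1| ^ (-4 * c - 2) * F₂ (invB c p)

/-- Every level set in `U` of either Riemann invariant is connected (or empty). -/
def ConnectedLevels (c : ℝ) (U : Set (ℝ × ℝ)) : Prop :=
  ∀ t : ℝ, IsPreconnected (U ∩ {p | invA c p = t}) ∧ IsPreconnected (U ∩ {p | invB c p = t})

end B2

end

/-! Write r₁ = `invA`, r₂ = `invB`, so that r₂ − r₁ = u²/2, and let ∂₁, ∂₂ be the derivatives in
these coordinates (`D1`, `D2`). The primary flow is diagonal in them, with speeds λ₁ = −2(c+1)u and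
λ₂ = −(2c+1)u. These are distinct, so every symmetry is diagonal too, and equality of mixed
derivatives of its flux gives ∂₂μ₁ = 2(c+1)(μ₁−μ₂)/u², ∂₁μ₂ = −(2c+1)(μ₁−μ₂)/u² for its speeds
(`IsDispersionlessSymmetry.exists_isDiagonal`, `IsDiagonal.isSpeedPair`).

All flows are in conservation form, hence so is their commutator: it is ∂ₓ of a bracket of fluxes
(`commutator_flow`). A local expression that vanishes on constants and has zero total derivative is
zero (`eq_zero_of_deriv_eq_zero`). Thus integrability asks, for each symmetry f, for a degree two
flux e with {F, e} + {α, f} = 0, where F is the primary flux (`obstruction`).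

Two families of α solve this for all symmetries at once, e being the same formula with μ in place of
λ. The first is {G, F} with G of degree one: the deformations generated by Miura transformations
(`gauge_obstruction`). The second, canonical one depends on φ₁, φ₂ with ∂₂φ₁ = 4(c+1)φ₁/u² and ∂₁φ₂
= 2(2c+1)φ₂/u² (`canon_obstruction`). Since ∂₂ log|u| = 1/u² = −∂₁ log|u|, on domains with connected
levels these equations say that φ₁ is |u|^(4c+4) times a function of r₁ and φ₂ is |u|^(−4c−2) times
a function of r₂.

Conversely, one cubic symmetry already forces α to be a sum of these two kinds. The coefficient
equations show that the diagonal second-order coefficients give a pair φ; choosing φ and four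
functions β matches six of the ten coefficients of α in the Riemann frame, and the equations force
the other four to agree (`CommutesCubic.isParameterPair`, `CommutesCubic.eq_zero`,
`CommutesCubic.exists_eq`).

The normal form N(g) is such a sum, with g a fixed combination of φ₁ and φ₂ (`frame_normal`). Hence
it is integrable. An integrable deformation with the same φ differs from it by some {G, F}, and this
difference is produced by the Miura transformation q + ε²∂ₓG (`transforms_of_bracket`).

For uniqueness, let A, B be the matrices of second-derivative coefficients of two equivalent
deformations. At order ε² a Miura transformation gives B = A + [Q, F'] (`Transforms.lead2_eq`), so
the diagonal entries in the eigenframe of F' do not change. For normal forms they are nonzero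
multiples of F₁ and F₂ (`frame_normal_a23`). -/

noncomputable section

namespace B2

open Filter

/-! ### Jets of configurations -/

/-- The second-order jets `(q, q_x, q_xx)`. -/
abbrev Jet := (ℝ × ℝ) × (ℝ × ℝ) × (ℝ × ℝ)

/-- The second-order jet of a configuration. -/
def jet (q : Curve) (x : ℝ) : Jet := (q x, deriv q x, deriv (deriv q) x)

/-- The jets lying over `Ω`. -/
def jetDomain (Ω : Set (ℝ × ℝ)) : Set Jet := Prod.fst ⁻¹' Ω

/-- The flow `q_t = ∂ₓ [G(q, q_x, q_xx)]`. -/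
def flow (G : Jet → ℝ × ℝ) : DiffOp := fun q => deriv (fun x => G (jet q x))

/-- The flux of the commutator of two flows in conservation form. -/
def bracket (G H : Jet → ℝ × ℝ) : DiffOp := fun q y =>
  fderiv ℝ G (jet q y) (jet (flow H q) y) - fderiv ℝ H (jet q y) (jet (flow G q) y)

lemma isOpen_jetDomain {Ω : Set (ℝ × ℝ)} (hΩ : IsOpen Ω) : IsOpen (jetDomain Ω) :=
  hΩ.preimage continuous_fst

lemma two_le_infty : (2 : WithTop ℕ∞) ≤ ∞ := ENat.LEInfty.out

/-! ### Calculus of smooth functions of one and two variables -/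

section Calculus

variable {E : Type*} [NormedAddCommGroup E] [NormedSpace ℝ E]

lemma contDiffAt_deriv {f : ℝ → E} {x : ℝ} (h : ContDiffAt ℝ ∞ f x) :
    ContDiffAt ℝ ∞ (deriv f) x := by
  have h1 : ContDiffAt ℝ ∞ (fderiv ℝ f) x := h.fderiv_right (by simp)
  exact h1.clm_apply contDiffAt_const

lemma eventually_contDiffAt {f : ℝ → E} {x : ℝ} (h : ContDiffAt ℝ ∞ f x) :
    ∀ᶠ y in 𝓝 x, ContDiffAt ℝ 1 f y :=
  (h.of_le (by exact_mod_cast le_top) : ContDiffAt ℝ 1 f x).eventually (by simp)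

lemma eventually_contDiffAt_infty {F : Type*} [NormedAddCommGroup F] [NormedSpace ℝ F]
    {f : F → E} {s : Set F} (hs : IsOpen s) (h : ContDiffOn ℝ ∞ f s) {x : F} (hx : x ∈ s) :
    ContDiffAt ℝ ∞ f x := h.contDiffAt (hs.mem_nhds hx)

/-- Mixed partial derivatives commute. -/
lemma deriv_deriv_swap {Γ : ℝ × ℝ → E} {s x : ℝ} (h : ContDiffAt ℝ ∞ Γ (s, x)) :
    deriv (fun t => deriv (fun y => Γ (t, y)) x) s
      = deriv (fun y => deriv (fun t => Γ (t, y)) s) x := by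
  have h1 : ∀ᶠ z in 𝓝 (s, x), DifferentiableAt ℝ Γ z :=
    ((h.of_le (by exact_mod_cast le_top) : ContDiffAt ℝ 1 Γ (s, x)).eventually (by simp)).mono
      fun z hz => hz.differentiableAt one_ne_zero
  have h2 : DifferentiableAt ℝ (fderiv ℝ Γ) (s, x) :=
    ((h.fderiv_right (m := ∞) (by simp)).differentiableAt (by simp))
  have e1 : ∀ t y, DifferentiableAt ℝ Γ (t, y) →
      deriv (fun y => Γ (t, y)) y = fderiv ℝ Γ (t, y) (0, 1) := by
    intro t y hd
    have : HasDerivAt (fun y : ℝ => ((t, y) : ℝ × ℝ)) (0, 1) y :=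
      (hasDerivAt_const y t).prodMk (hasDerivAt_id y)
    exact (hd.hasFDerivAt.comp_hasDerivAt y this).deriv
  have e2 : ∀ t y, DifferentiableAt ℝ Γ (t, y) →
      deriv (fun t => Γ (t, y)) t = fderiv ℝ Γ (t, y) (1, 0) := by
    intro t y hd
    have : HasDerivAt (fun t : ℝ => ((t, y) : ℝ × ℝ)) (1, 0) t :=
      (hasDerivAt_id t).prodMk (hasDerivAt_const t y)
    exact (hd.hasFDerivAt.comp_hasDerivAt t this).deriv
  have c1 : Tendsto (fun t : ℝ => ((t, x) : ℝ × ℝ)) (𝓝 s) (𝓝 (s, x)) :=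
    (Continuous.prodMk continuous_id continuous_const).tendsto' _ _ rfl
  have c2 : Tendsto (fun y : ℝ => ((s, y) : ℝ × ℝ)) (𝓝 x) (𝓝 (s, x)) :=
    (Continuous.prodMk continuous_const continuous_id).tendsto' _ _ rfl
  have l1 : (fun t => deriv (fun y => Γ (t, y)) x)
      =ᶠ[𝓝 s] fun t => fderiv ℝ Γ (t, x) (0, 1) :=
    (c1.eventually h1).mono fun t ht => e1 t x ht
  have l2 : (fun y => deriv (fun t => Γ (t, y)) s)
      =ᶠ[𝓝 x] fun y => fderiv ℝ Γ (s, y) (1, 0) :=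
    (c2.eventually h1).mono fun y hy => e2 s y hy
  rw [l1.deriv_eq, l2.deriv_eq]
  have d1 : HasDerivAt (fun t : ℝ => fderiv ℝ Γ (t, x))
      (fderiv ℝ (fderiv ℝ Γ) (s, x) (1, 0)) s :=
    h2.hasFDerivAt.comp_hasDerivAt s ((hasDerivAt_id s).prodMk (hasDerivAt_const s x))
  have d2 : HasDerivAt (fun y : ℝ => fderiv ℝ Γ (s, y))
      (fderiv ℝ (fderiv ℝ Γ) (s, x) (0, 1)) x :=
    h2.hasFDerivAt.comp_hasDerivAt x ((hasDerivAt_const x s).prodMk (hasDerivAt_id x))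
  have d1' := (d1.clm_apply (hasDerivAt_const s ((0, 1) : ℝ × ℝ))).deriv
  have d2' := (d2.clm_apply (hasDerivAt_const x ((1, 0) : ℝ × ℝ))).deriv
  rw [d1', d2']
  have sym : IsSymmSndFDerivAt ℝ Γ (s, x) :=
    h.isSymmSndFDerivAt (by simpa using two_le_infty)
  simpa using sym (1, 0) (0, 1)

end Calculus

lemma contDiffAt_jet {q : Curve} {x : ℝ} (h : ContDiffAt ℝ ∞ q x) : ContDiffAt ℝ ∞ (jet q) x :=
  h.prodMk ((contDiffAt_deriv h).prodMk (contDiffAt_deriv (contDiffAt_deriv h)))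

lemma jet_congr {q r : Curve} {x : ℝ} (h : q =ᶠ[𝓝 x] r) : jet q x = jet r x := by
  simp only [jet, h.eq_of_nhds, h.deriv_eq, h.deriv.deriv_eq]

lemma jet_eventuallyEq {q r : Curve} {x : ℝ} (h : q =ᶠ[𝓝 x] r) : jet q =ᶠ[𝓝 x] jet r :=
  h.eventuallyEq_nhds.mono fun _ hy => jet_congr hy

lemma jet_zero (x : ℝ) : jet (fun _ => 0) x = 0 := by
  simp [jet]

lemma eventually_jet_add_smul {q h : Curve} {x : ℝ} (hq : ContDiffAt ℝ ∞ q x)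
    (hh : ContDiffAt ℝ ∞ h x) :
    ∀ᶠ y in 𝓝 x, ∀ s : ℝ, jet (q + s • h) y = jet q y + s • jet h y := by
  have k1 : ∀ᶠ y in 𝓝 x, ContDiffAt ℝ 2 q y :=
    (hq.of_le two_le_infty : ContDiffAt ℝ 2 q x).eventually (by simp)
  have k2 : ∀ᶠ y in 𝓝 x, ContDiffAt ℝ 2 h y :=
    (hh.of_le two_le_infty : ContDiffAt ℝ 2 h x).eventually (by simp)
  have d2 : ∀ {f : Curve} {y : ℝ}, ContDiffAt ℝ 2 f y → DifferentiableAt ℝ (deriv f) y := by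
    intro f y hf
    have h1 : ContDiffAt ℝ 1 (fderiv ℝ f) y := hf.fderiv_right (by norm_num)
    exact (h1.clm_apply (contDiffAt_const (c := (1:ℝ)))).differentiableAt one_ne_zero
  filter_upwards [k1, k2] with y hy1 hy2 s
  have a1 : deriv (q + s • h) =ᶠ[𝓝 y] deriv q + s • deriv h := by
    filter_upwards [hy1.eventually (by simp), hy2.eventually (by simp)] with z hz1 hz2
    have h1 := hz1.differentiableAt two_ne_zero
    have h2 := hz2.differentiableAt two_ne_zero
    simp [deriv_add h1 (h2.const_smul s), deriv_const_smul s h2]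
  simp only [jet, a1.deriv_eq, a1.eq_of_nhds, deriv_add (d2 hy1) ((d2 hy2).const_smul s),
    deriv_const_smul s (d2 hy2)]
  rfl

lemma jet_add_smul {q h : Curve} {x : ℝ} (hq : ContDiffAt ℝ ∞ q x) (hh : ContDiffAt ℝ ∞ h x)
    (s : ℝ) : jet (q + s • h) x = jet q x + s • jet h x :=
  (eventually_jet_add_smul hq hh).self_of_nhds s

/-! ### Flows in conservation form and their brackets -/

section Flow

variable {Ω : Set (ℝ × ℝ)} {G H : Jet → ℝ × ℝ} {q h : Curve} {x : ℝ}

lemma contDiffAt_flux (hΩ : IsOpen Ω) (hG : ContDiffOn ℝ ∞ G (jetDomain Ω))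
    (hq : ContDiffAt ℝ ∞ q x) (hx : q x ∈ Ω) : ContDiffAt ℝ ∞ (fun y => G (jet q y)) x :=
  (eventually_contDiffAt_infty (isOpen_jetDomain hΩ) hG (x := jet q x) hx).comp x
    (contDiffAt_jet hq)

lemma contDiffAt_flow (hΩ : IsOpen Ω) (hG : ContDiffOn ℝ ∞ G (jetDomain Ω))
    (hq : ContDiffAt ℝ ∞ q x) (hx : q x ∈ Ω) : ContDiffAt ℝ ∞ (flow G q) x :=
  contDiffAt_deriv (contDiffAt_flux hΩ hG hq hx)

lemma contDiffAt_linearized (hΩ : IsOpen Ω) (hG : ContDiffOn ℝ ∞ G (jetDomain Ω))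
    (hq : ContDiffAt ℝ ∞ q x) (hh : ContDiffAt ℝ ∞ h x) (hx : q x ∈ Ω) :
    ContDiffAt ℝ ∞ (fun y => fderiv ℝ G (jet q y) (jet h y)) x := by
  have h1 : ContDiffAt ℝ ∞ (fderiv ℝ G) (jet q x) :=
    (eventually_contDiffAt_infty (isOpen_jetDomain hΩ) hG (x := jet q x) hx).fderiv_right (by simp)
  exact (h1.comp x (contDiffAt_jet hq)).clm_apply (contDiffAt_jet hh)

/-- The first variation of a flow in conservation form. -/
lemma variation_flow (hΩ : IsOpen Ω) (hG : ContDiffOn ℝ ∞ G (jetDomain Ω))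
    (hq : ContDiffAt ℝ ∞ q x) (hh : ContDiffAt ℝ ∞ h x) (hx : q x ∈ Ω) :
    variation (flow G) q h x = deriv (fun y => fderiv ℝ G (jet q y) (jet h y)) x := by
  have hGx := eventually_contDiffAt_infty (isOpen_jetDomain hΩ) hG (x := jet q x) hx
  have e1 : ∀ s : ℝ, flow G (q + s • h) x = deriv (fun y => G (jet q y + s • jet h y)) x := by
    intro s
    refine Filter.EventuallyEq.deriv_eq ?_
    filter_upwards [eventually_jet_add_smul hq hh] with y hy
    rw [hy s]
  have e2 : ContDiffAt ℝ ∞ (fun z : ℝ × ℝ => G (jet q z.2 + z.1 • jet h z.2)) (0, x) := by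
    have a : ContDiffAt ℝ ∞ (fun z : ℝ × ℝ => jet q z.2 + z.1 • jet h z.2) (0, x) :=
      ((contDiffAt_jet hq).comp (0, x) contDiffAt_snd).add
        (contDiffAt_fst.smul ((contDiffAt_jet hh).comp (0, x) contDiffAt_snd))
    refine ContDiffAt.comp (0, x) ?_ a
    simpa using hGx
  unfold variation
  simp_rw [e1]
  -- Interchanging the derivatives in s and x turns the variation of ∂ₓG into ∂ₓ of the
  -- linearization of G.
  rw [deriv_deriv_swap (Γ := fun z : ℝ × ℝ => G (jet q z.2 + z.1 • jet h z.2)) e2]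
  refine Filter.EventuallyEq.deriv_eq ?_
  have hc : Tendsto (jet q) (𝓝 x) (𝓝 (jet q x)) := (contDiffAt_jet hq).continuousAt
  have hd : ∀ᶠ y in 𝓝 x, DifferentiableAt ℝ G (jet q y) := by
    refine hc.eventually (p := fun j => DifferentiableAt ℝ G j) ?_
    filter_upwards [(isOpen_jetDomain hΩ).mem_nhds (show jet q x ∈ jetDomain Ω from hx)] with j hj
    exact (eventually_contDiffAt_infty (isOpen_jetDomain hΩ) hG hj).differentiableAt (by simp)
  filter_upwards [hd] with y hy
  have l : HasDerivAt (fun s : ℝ => jet q y + s • jet h y) (jet h y) 0 := by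
    simpa using ((hasDerivAt_id (0:ℝ)).smul_const (jet h y)).const_add (jet q y)
  have hy' : HasFDerivAt G (fderiv ℝ G (jet q y)) (jet q y + (0:ℝ) • jet h y) := by
    simpa using hy.hasFDerivAt
  exact (hy'.comp_hasDerivAt (0:ℝ) l).deriv

lemma contDiffAt_bracket (hΩ : IsOpen Ω) (hG : ContDiffOn ℝ ∞ G (jetDomain Ω))
    (hH : ContDiffOn ℝ ∞ H (jetDomain Ω)) (hq : ContDiffAt ℝ ∞ q x) (hx : q x ∈ Ω) :
    ContDiffAt ℝ ∞ (bracket G H q) x :=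
  (contDiffAt_linearized hΩ hG hq (contDiffAt_flow hΩ hH hq hx) hx).sub
    (contDiffAt_linearized hΩ hH hq (contDiffAt_flow hΩ hG hq hx) hx)

/-- The commutator of flows in conservation form is in conservation form. -/
lemma commutator_flow (hΩ : IsOpen Ω) (hG : ContDiffOn ℝ ∞ G (jetDomain Ω))
    (hH : ContDiffOn ℝ ∞ H (jetDomain Ω)) (hq : ContDiffAt ℝ ∞ q x) (hx : q x ∈ Ω) :
    commutator (flow G) (flow H) q x = deriv (bracket G H q) x := by
  have h1 := contDiffAt_linearized hΩ hG hq (contDiffAt_flow hΩ hH hq hx) hx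
  have h2 := contDiffAt_linearized hΩ hH hq (contDiffAt_flow hΩ hG hq hx) hx
  unfold commutator
  rw [variation_flow hΩ hG hq (contDiffAt_flow hΩ hH hq hx) hx,
    variation_flow hΩ hH hq (contDiffAt_flow hΩ hG hq hx) hx]
  exact (deriv_fun_sub (h1.differentiableAt (by simp)) (h2.differentiableAt (by simp))).symm

lemma bracket_antisymm (G H : Jet → ℝ × ℝ) (q : Curve) (x : ℝ) :
    bracket G H q x = -bracket H G q x := by
  simp [bracket]

lemma eventually_mem (hΩ : IsOpen Ω) (hq : ContDiffAt ℝ ∞ q x) (hx : q x ∈ Ω) :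
    ∀ᶠ y in 𝓝 x, q y ∈ Ω := hq.continuousAt.eventually (hΩ.mem_nhds hx)

lemma differentiableAt_flux (hΩ : IsOpen Ω) (hG : ContDiffOn ℝ ∞ G (jetDomain Ω)) {j : Jet}
    (hj : j.1 ∈ Ω) : DifferentiableAt ℝ G j :=
  (eventually_contDiffAt_infty (isOpen_jetDomain hΩ) hG (x := j) hj).differentiableAt (by simp)

lemma flow_add_smul (hΩ : IsOpen Ω) {G₁ G₂ : Jet → ℝ × ℝ} (h₁ : ContDiffOn ℝ ∞ G₁ (jetDomain Ω))
    (h₂ : ContDiffOn ℝ ∞ G₂ (jetDomain Ω)) (r : ℝ) (hq : ContDiff ℝ ∞ q) (hx : q x ∈ Ω) :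
    flow (fun j => G₁ j + r • G₂ j) q =ᶠ[𝓝 x] flow G₁ q + r • flow G₂ q := by
  filter_upwards [eventually_mem hΩ hq.contDiffAt hx] with y hy
  have d1 := (contDiffAt_flux hΩ h₁ hq.contDiffAt hy).differentiableAt (by simp)
  have d2 := (contDiffAt_flux hΩ h₂ hq.contDiffAt hy).differentiableAt (by simp)
  simp only [flow, Pi.add_apply, Pi.smul_apply]
  exact (d1.hasDerivAt.add (d2.hasDerivAt.const_smul r)).deriv

lemma bracket_add_smul_left (hΩ : IsOpen Ω) {G₁ G₂ : Jet → ℝ × ℝ}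
    (h₁ : ContDiffOn ℝ ∞ G₁ (jetDomain Ω)) (h₂ : ContDiffOn ℝ ∞ G₂ (jetDomain Ω)) (r : ℝ)
    (hq : ContDiff ℝ ∞ q) (hx : q x ∈ Ω) :
    bracket (fun j => G₁ j + r • G₂ j) H q x = bracket G₁ H q x + r • bracket G₂ H q x := by
  have d1 := differentiableAt_flux hΩ h₁ (j := jet q x) hx
  have d2 := differentiableAt_flux hΩ h₂ (j := jet q x) hx
  have e := flow_add_smul hΩ h₁ h₂ r hq hx
  unfold bracket
  rw [jet_congr e, jet_add_smul (contDiffAt_flow hΩ h₁ hq.contDiffAt hx)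
    (contDiffAt_flow hΩ h₂ hq.contDiffAt hx),
    show fderiv ℝ (fun j => G₁ j + r • G₂ j) (jet q x)
      = fderiv ℝ G₁ (jet q x) + r • fderiv ℝ G₂ (jet q x) from
      (d1.hasFDerivAt.add (d2.hasFDerivAt.const_smul r)).fderiv]
  simp only [map_add, map_smul, add_apply, smul_apply,
    smul_sub]
  abel

lemma bracket_add_smul_right (hΩ : IsOpen Ω) {G₁ G₂ : Jet → ℝ × ℝ}
    (h₁ : ContDiffOn ℝ ∞ G₁ (jetDomain Ω)) (h₂ : ContDiffOn ℝ ∞ G₂ (jetDomain Ω)) (r : ℝ)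
    (hq : ContDiff ℝ ∞ q) (hx : q x ∈ Ω) :
    bracket H (fun j => G₁ j + r • G₂ j) q x = bracket H G₁ q x + r • bracket H G₂ q x := by
  rw [bracket_antisymm, bracket_add_smul_left hΩ h₁ h₂ r hq hx, bracket_antisymm H G₁,
    bracket_antisymm H G₂]
  simp [add_comm]

lemma bracket_congr {r : Curve} (h : q =ᶠ[𝓝 x] r) (G H : Jet → ℝ × ℝ) :
    bracket G H q x = bracket G H r x := by
  have f : ∀ K : Jet → ℝ × ℝ, flow K q =ᶠ[𝓝 x] flow K r := fun K =>
    Filter.EventuallyEq.deriv ((jet_eventuallyEq h).fun_comp K)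
  simp only [bracket, jet_congr h, jet_congr (f G), jet_congr (f H)]

/-- Constants are rest points of every flow. This gives the base value for
`eq_zero_of_deriv_eq_zero`. -/
lemma bracket_const (G H : Jet → ℝ × ℝ) (p : ℝ × ℝ) (x : ℝ) :
    bracket G H (fun _ => p) x = 0 := by
  have f : ∀ K : Jet → ℝ × ℝ, flow K (fun _ => p) = fun _ => 0 := by
    intro K
    have : (fun y => K (jet (fun _ => p) y)) = fun _ => K (p, 0, 0) := by
      funext y; simp [jet]
    simp only [flow, this]
    exact deriv_const' _
  simp [bracket, f, jet_zero]

end Flow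

/-! ### Removing a total derivative -/

/-- A smooth reparametrization which is the identity near `0`, takes small values, and is
constant somewhere. -/
lemma exists_cutoff {δ : ℝ} (hδ : 0 < δ) : ∃ χ : ℝ → ℝ, ContDiff ℝ ∞ χ ∧
    (∀ᶠ y in 𝓝 0, χ y = y) ∧ (∀ y, |χ y| < δ) ∧ ∃ T, ∀ᶠ y in 𝓝 T, χ y = 0 := by
  let φ : ContDiffBump (0 : ℝ) := ⟨δ / 4, δ / 2, by positivity, by linarith⟩
  -- y φ(y) equals y where the bump is 1, stays below `δ` in modulus because the bump vanishes for
  -- |y| ≥ δ/2, and is zero near T = `δ`.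
  refine ⟨fun y => y * φ y, contDiff_id.mul φ.contDiff, ?_, ?_, δ, ?_⟩
  · filter_upwards [φ.eventuallyEq_one] with y hy
    simp [hy]
  · intro y
    by_cases hy : |y| < δ / 2
    · have h1 := φ.nonneg (x := y)
      have h2 := φ.le_one (x := y)
      rw [abs_mul, abs_of_nonneg h1]
      nlinarith [abs_nonneg y]
    · have : φ y = 0 := φ.zero_of_le_dist (by simpa [Real.dist_eq] using not_lt.1 hy)
      simpa [this] using hδ
  · have : Set.Ioi (δ / 2) ∈ 𝓝 δ := Ioi_mem_nhds (by linarith)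
    filter_upwards [this] with y hy
    have h0 : φ y = 0 := φ.zero_of_le_dist (by
      simp only [Real.dist_eq, sub_zero]
      exact (le_of_lt hy).trans (le_abs_self y))
    simp [h0]

/-- A local functional of positive differential degree vanishes if its total derivative does. -/
lemma eq_zero_of_deriv_eq_zero {Ω : Set (ℝ × ℝ)} (hΩ : IsOpen Ω) {Z : DiffOp}
    (hloc : ∀ q r : Curve, ∀ x, q =ᶠ[𝓝 x] r → Z q x = Z r x)
    (hconst : ∀ p x, Z (fun _ => p) x = 0)
    (hdiff : ∀ q : Curve, ContDiff ℝ ∞ q → ∀ x, q x ∈ Ω → DifferentiableAt ℝ (Z q) x)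
    (hZ : ∀ q : Curve, ContDiff ℝ ∞ q → ∀ x, q x ∈ Ω → deriv (Z q) x = 0)
    {q : Curve} (hq : ContDiff ℝ ∞ q) (hq0 : q 0 ∈ Ω) : Z q 0 = 0 := by
  obtain ⟨δ, hδ, hball⟩ := Metric.eventually_nhds_iff.1
    (hq.continuous.continuousAt.eventually (hΩ.mem_nhds hq0))
  -- The curve q ∘ χ stays in `Ω`, agrees with `q` near 0 and is constant near `T`. By `hZ` the
  -- value of `Z` along it does not change, so its value at 0 equals its value on a constant.
  obtain ⟨χ, hχ, h0, hs, T, hT⟩ := exists_cutoff hδ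
  have hmem : ∀ y, q (χ y) ∈ Ω := fun y => hball (by simpa [Real.dist_eq] using hs y)
  have hr : ContDiff ℝ ∞ (fun y => q (χ y)) := hq.comp hχ
  have c := is_const_of_deriv_eq_zero (f := Z fun y => q (χ y))
    (fun y => hdiff _ hr y (hmem y)) (fun y => hZ _ hr y (hmem y)) 0 T
  rw [hloc (fun y => q (χ y)) q 0 (h0.mono fun y hy => by simp only [hy])] at c
  rw [c, hloc _ (fun _ => q 0) T (hT.mono fun y hy => by simp only [hy]), hconst]

/-! ### Orders of vanishing in ε -/

lemma eq_zero_of_isBigO_pow {E : Type*} [NormedAddCommGroup E] [NormedSpace ℝ E] {c : ℝ → E}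
    {n m : ℕ} (hnm : n < m) (hc : ContinuousAt c 0)
    (h : (fun ε : ℝ => ε ^ n • c ε) =O[𝓝 0] fun ε : ℝ => ε ^ m) : c 0 = 0 := by
  obtain ⟨C, hC⟩ := h.bound
  have h1 : ∀ᶠ ε in 𝓝[≠] (0 : ℝ), ‖c ε‖ ≤ C * |ε| ^ (m - n) := by
    filter_upwards [hC.filter_mono nhdsWithin_le_nhds, self_mem_nhdsWithin] with ε h1 h2
    have hε : 0 < |ε| := abs_pos.2 h2
    rw [norm_smul, norm_pow, norm_pow, Real.norm_eq_abs] at h1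
    have : |ε| ^ m = |ε| ^ n * |ε| ^ (m - n) := by
      rw [← pow_add, Nat.add_sub_cancel' hnm.le]
    rw [this] at h1
    have : |ε| ^ n * ‖c ε‖ ≤ |ε| ^ n * (C * |ε| ^ (m - n)) := by linarith
    exact le_of_mul_le_mul_left this (by positivity)
  have h2 : Tendsto (fun ε : ℝ => C * |ε| ^ (m - n)) (𝓝[≠] 0) (𝓝 0) := by
    have : Continuous fun ε : ℝ => C * |ε| ^ (m - n) := by fun_prop
    have h3 := this.tendsto 0
    simp only [abs_zero, zero_pow (Nat.sub_ne_zero_of_lt hnm), mul_zero] at h3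
    exact h3.mono_left nhdsWithin_le_nhds
  have h3 : Tendsto c (𝓝[≠] 0) (𝓝 0) := squeeze_zero_norm' h1 h2
  exact tendsto_nhds_unique (hc.tendsto.mono_left nhdsWithin_le_nhds) h3

/-- The coefficients are peeled off one power at a time: once the lower ones vanish, the next is a
limit of quotients. Degree four is enough because the commutators to which this applies are quartic
in ε. -/
lemma quartic_isBigO_iff {E : Type*} [NormedAddCommGroup E] [NormedSpace ℝ E]
    (C₀ C₁ C₂ C₃ C₄ : E) :
    (fun ε : ℝ => C₀ + ε • C₁ + ε ^ 2 • C₂ + ε ^ 3 • C₃ + ε ^ 4 • C₄) =O[𝓝 0]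
      (fun ε : ℝ => ε ^ 3) ↔ C₀ = 0 ∧ C₁ = 0 ∧ C₂ = 0 := by
  constructor
  · intro h
    have h0 : C₀ = 0 := by
      have := eq_zero_of_isBigO_pow (n := 0) (m := 3)
        (c := fun ε : ℝ => C₀ + ε • C₁ + ε ^ 2 • C₂ + ε ^ 3 • C₃ + ε ^ 4 • C₄) (by norm_num)
        (by fun_prop) (by simpa using h)
      simpa using this
    subst h0
    have h1 : C₁ = 0 := by
      have := eq_zero_of_isBigO_pow (n := 1) (m := 3)
        (c := fun ε : ℝ => C₁ + ε • C₂ + ε ^ 2 • C₃ + ε ^ 3 • C₄) (by norm_num)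
        (by fun_prop) (by
          refine h.congr_left fun ε => ?_
          simp only [smul_add, smul_smul]; ring_nf; simp)
      simpa using this
    subst h1
    have h2 : C₂ = 0 := by
      have := eq_zero_of_isBigO_pow (n := 2) (m := 3)
        (c := fun ε : ℝ => C₂ + ε • C₃ + ε ^ 2 • C₄) (by norm_num)
        (by fun_prop) (by
          refine h.congr_left fun ε => ?_
          simp only [smul_add, smul_smul]; ring_nf; simp)
      simpa using this
    exact ⟨rfl, rfl, h2⟩
  · rintro ⟨rfl, rfl, rfl⟩
    have hr : (fun ε : ℝ => ε ^ 3) =O[𝓝 0] fun ε : ℝ => ε ^ 3 := isBigO_refl _ _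
    have h : (fun ε : ℝ => C₃ + ε • C₄) =O[𝓝 0] fun _ : ℝ => (1 : ℝ) :=
      (ContinuousAt.tendsto (by fun_prop)).isBigO_one ℝ
    refine (hr.smul h).congr (fun ε => ?_) fun ε => by simp
    simp only [smul_add, smul_smul]; ring_nf; simp

/-! ### Differential polynomials as fluxes, and the second-order obstruction -/

/-- The flux depending on the field values only. -/
def pointFlux (f : ℝ × ℝ → ℝ × ℝ) : Jet → ℝ × ℝ := fun j => f j.1

/-- A degree one differential polynomial as a function on jets. -/
def Poly1.onJet (P : Poly1) (j : Jet) : ℝ := P.ux j.1 * j.2.1.1 + P.vx j.1 * j.2.1.2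

/-- A degree two differential polynomial as a function on jets. -/
def Poly2.onJet (P : Poly2) (j : Jet) : ℝ :=
  P.uxx j.1 * j.2.2.1 + P.vxx j.1 * j.2.2.2 + P.uxux j.1 * j.2.1.1 ^ 2 + P.vxvx j.1 * j.2.1.2 ^ 2
    + P.uxvx j.1 * (j.2.1.1 * j.2.1.2)

/-- The degree one flux with the given components. -/
def flux1 (P₁ P₂ : Poly1) : Jet → ℝ × ℝ := fun j => (P₁.onJet j, P₂.onJet j)

/-- The degree two flux with the given components. -/
def flux2 (P₁ P₂ : Poly2) : Jet → ℝ × ℝ := fun j => (P₁.onJet j, P₂.onJet j)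

section

variable {Ω : Set (ℝ × ℝ)}

lemma contDiffOn_pointFlux {f : ℝ × ℝ → ℝ × ℝ} (hf : ContDiffOn ℝ ∞ f Ω) :
    ContDiffOn ℝ ∞ (pointFlux f) (jetDomain Ω) :=
  hf.comp contDiffOn_fst fun _ h => h

lemma contDiffOn_coeff {E : Type*} [NormedAddCommGroup E] [NormedSpace ℝ E]
    {g : ℝ × ℝ → E} (hg : ContDiffOn ℝ ∞ g Ω) :
    ContDiffOn ℝ ∞ (fun j : Jet => g j.1) (jetDomain Ω) :=
  hg.comp contDiffOn_fst fun _ h => h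

lemma Poly1.contDiffOn_onJet {P : Poly1} (hP : P.SmoothOn Ω) :
    ContDiffOn ℝ ∞ P.onJet (jetDomain Ω) := by
  obtain ⟨h1, h2⟩ := hP
  have h1 := contDiffOn_coeff h1
  have h2 := contDiffOn_coeff h2
  unfold Poly1.onJet
  fun_prop

lemma Poly2.contDiffOn_onJet {P : Poly2} (hP : P.SmoothOn Ω) :
    ContDiffOn ℝ ∞ P.onJet (jetDomain Ω) := by
  obtain ⟨h1, h2, h3, h4, h5⟩ := hP
  have h1 := contDiffOn_coeff h1
  have h2 := contDiffOn_coeff h2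
  have h3 := contDiffOn_coeff h3
  have h4 := contDiffOn_coeff h4
  have h5 := contDiffOn_coeff h5
  unfold Poly2.onJet
  fun_prop

lemma contDiffOn_flux1 {P₁ P₂ : Poly1} (h₁ : P₁.SmoothOn Ω) (h₂ : P₂.SmoothOn Ω) :
    ContDiffOn ℝ ∞ (flux1 P₁ P₂) (jetDomain Ω) :=
  (Poly1.contDiffOn_onJet h₁).prodMk (Poly1.contDiffOn_onJet h₂)

lemma contDiffOn_flux2 {P₁ P₂ : Poly2} (h₁ : P₁.SmoothOn Ω) (h₂ : P₂.SmoothOn Ω) :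
    ContDiffOn ℝ ∞ (flux2 P₁ P₂) (jetDomain Ω) :=
  (Poly2.contDiffOn_onJet h₁).prodMk (Poly2.contDiffOn_onJet h₂)

lemma contDiff_primaryFlux (c : ℝ) : ContDiff ℝ ∞ (primaryFlux c) := by
  unfold primaryFlux
  fun_prop

lemma hydroFlow_eq (f : ℝ × ℝ → ℝ × ℝ) : hydroFlow f = flow (pointFlux f) := rfl

lemma deformedFlow_eq (f : ℝ × ℝ → ℝ × ℝ) (b₁ b₂ : Poly1) (a₁ a₂ : Poly2) (ε : ℝ) :
    deformedFlow f b₁ b₂ a₁ a₂ ε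
      = flow (fun j => (pointFlux f j + ε • flux1 b₁ b₂ j) + ε ^ 2 • flux2 a₁ a₂ j) := rfl

lemma deformedPrimary_eq (c : ℝ) (a₁ a₂ : Poly2) (ε : ℝ) :
    deformedPrimary c a₁ a₂ ε
      = flow (fun j => pointFlux (primaryFlux c) j + ε ^ 2 • flux2 a₁ a₂ j) := by
  unfold deformedPrimary
  rw [deformedFlow_eq]
  congr 1
  funext j
  have : flux1 Poly1.zero Poly1.zero j = 0 := by
    simp [flux1, Poly1.onJet, Poly1.zero]
  simp [this]

lemma flow_pointFlux (hΩ : IsOpen Ω) {f : ℝ × ℝ → ℝ × ℝ} (hf : ContDiffOn ℝ ∞ f Ω) {q : Curve}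
    (hq : ContDiff ℝ ∞ q) {x : ℝ} (hx : q x ∈ Ω) :
    flow (pointFlux f) q x = fderiv ℝ f (q x) (deriv q x) :=
  ((((eventually_contDiffAt_infty hΩ hf hx).differentiableAt (by simp)).hasFDerivAt).comp_hasDerivAt
    x (hq.differentiable (by simp) x).hasDerivAt).deriv

lemma fderiv_pointFlux (hΩ : IsOpen Ω) {f : ℝ × ℝ → ℝ × ℝ} (hf : ContDiffOn ℝ ∞ f Ω) {j : Jet}
    (hj : j.1 ∈ Ω) (δ : Jet) : fderiv ℝ (pointFlux f) j δ = fderiv ℝ f j.1 δ.1 := by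
  have h := ((eventually_contDiffAt_infty hΩ hf hj).differentiableAt (by simp)).hasFDerivAt
  have h2 : HasFDerivAt (pointFlux f) _ j := h.comp j (hasFDerivAt_fst (p := j))
  rw [h2.fderiv]
  rfl

lemma bracket_pointFlux (hΩ : IsOpen Ω) {f g : ℝ × ℝ → ℝ × ℝ} (hf : ContDiffOn ℝ ∞ f Ω)
    (hg : ContDiffOn ℝ ∞ g Ω) {q : Curve} (hq : ContDiff ℝ ∞ q) {x : ℝ} (hx : q x ∈ Ω) :
    bracket (pointFlux f) (pointFlux g) q x
      = fderiv ℝ f (q x) (fderiv ℝ g (q x) (deriv q x))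
        - fderiv ℝ g (q x) (fderiv ℝ f (q x) (deriv q x)) := by
  unfold bracket
  rw [fderiv_pointFlux hΩ hf (by exact hx), fderiv_pointFlux hΩ hg (by exact hx)]
  simp only [jet, flow_pointFlux hΩ hf hq hx, flow_pointFlux hΩ hg hq hx]

/-- A flux is a symmetry exactly if its Jacobian commutes with that of the primary flux. -/
lemma isDispersionlessSymmetry_iff (c : ℝ) (hΩ : IsOpen Ω) (f : ℝ × ℝ → ℝ × ℝ) :
    IsDispersionlessSymmetry c Ω f ↔ ContDiffOn ℝ ∞ f Ω ∧ ∀ p ∈ Ω, ∀ X,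
      fderiv ℝ (primaryFlux c) p (fderiv ℝ f p X) = fderiv ℝ f p (fderiv ℝ (primaryFlux c) p X) := by
  have hF : ContDiffOn ℝ ∞ (primaryFlux c) Ω := (contDiff_primaryFlux c).contDiffOn
  constructor
  · rintro ⟨hf, h⟩
    refine ⟨hf, fun p hp X => ?_⟩
    -- The bracket of two point fluxes involves only q and q_x, so straight lines through `p` test
    -- it on every tangent vector `X`.
    have hq : ContDiff ℝ ∞ (fun x : ℝ => p + x • X) := by fun_prop
    have z := eq_zero_of_deriv_eq_zero hΩ
      (Z := bracket (pointFlux (primaryFlux c)) (pointFlux f))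
      (fun q r x hqr => bracket_congr hqr _ _) (fun p x => bracket_const _ _ p x)
      (fun q hq x hx => (contDiffAt_bracket hΩ (contDiffOn_pointFlux hF) (contDiffOn_pointFlux hf)
        hq.contDiffAt hx).differentiableAt (by simp))
      (fun q hq x hx => by
        rw [← commutator_flow hΩ (contDiffOn_pointFlux hF) (contDiffOn_pointFlux hf)
          hq.contDiffAt hx]
        exact h q hq x hx) hq (by simpa using hp)
    rw [bracket_pointFlux hΩ hF hf hq (by simpa using hp)] at z
    have d : deriv (fun x : ℝ => p + x • X) 0 = X := by
      simpa using (((hasDerivAt_id (0 : ℝ)).smul_const X).const_add p).deriv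
    rw [d] at z
    simpa using sub_eq_zero.1 z
  · rintro ⟨hf, h⟩
    refine ⟨hf, fun q hq x hx => ?_⟩
    rw [hydroFlow_eq, hydroFlow_eq, commutator_flow hΩ (contDiffOn_pointFlux hF)
      (contDiffOn_pointFlux hf) hq.contDiffAt hx]
    have : bracket (pointFlux (primaryFlux c)) (pointFlux f) q =ᶠ[𝓝 x] fun _ => 0 := by
      filter_upwards [eventually_mem hΩ hq.contDiffAt hx] with y hy
      rw [bracket_pointFlux hΩ hF hf hq hy, h _ hy, sub_self]
    rw [this.deriv_eq, deriv_const]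

/-- Bilinearity of the bracket. The deformed primary flow has no term of order ε, so `b₁` and `b₂`
do not enter the coefficient of ε². -/
lemma bracket_deformed (c : ℝ) (hΩ : IsOpen Ω) {f : ℝ × ℝ → ℝ × ℝ} (hf : ContDiffOn ℝ ∞ f Ω)
    {b₁ b₂ : Poly1} {a₁ a₂ d₁ d₂ : Poly2} (hb₁ : b₁.SmoothOn Ω) (hb₂ : b₂.SmoothOn Ω)
    (ha₁ : a₁.SmoothOn Ω) (ha₂ : a₂.SmoothOn Ω) (hd₁ : d₁.SmoothOn Ω) (hd₂ : d₂.SmoothOn Ω)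
    {q : Curve} (hq : ContDiff ℝ ∞ q) {x : ℝ} (hx : q x ∈ Ω) (ε : ℝ) :
    commutator (deformedPrimary c a₁ a₂ ε) (deformedFlow f b₁ b₂ d₁ d₂ ε) q x =
      deriv (bracket (pointFlux (primaryFlux c)) (pointFlux f) q) x
      + ε • deriv (bracket (pointFlux (primaryFlux c)) (flux1 b₁ b₂) q) x
      + ε ^ 2 • deriv (fun y => bracket (pointFlux (primaryFlux c)) (flux2 d₁ d₂) q y
          + bracket (flux2 a₁ a₂) (pointFlux f) q y) x
      + ε ^ 3 • deriv (bracket (flux2 a₁ a₂) (flux1 b₁ b₂) q) x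
      + ε ^ 4 • deriv (bracket (flux2 a₁ a₂) (flux2 d₁ d₂) q) x := by
  have hF := contDiffOn_pointFlux (contDiff_primaryFlux c).contDiffOn (Ω := Ω)
  have hf' := contDiffOn_pointFlux hf
  have hb := contDiffOn_flux1 hb₁ hb₂
  have ha := contDiffOn_flux2 ha₁ ha₂
  have hd := contDiffOn_flux2 hd₁ hd₂
  have hfb : ContDiffOn ℝ ∞ (fun j => pointFlux f j + ε • flux1 b₁ b₂ j) (jetDomain Ω) :=
    hf'.add (hb.const_smul ε)
  have hfbd := hfb.add (hd.const_smul (ε ^ 2))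
  have hFa := hF.add (ha.const_smul (ε ^ 2))
  rw [deformedPrimary_eq, deformedFlow_eq]
  have key := commutator_flow hΩ hFa hfbd hq.contDiffAt hx
  have D : ∀ {G H : Jet → ℝ × ℝ}, ContDiffOn ℝ ∞ G (jetDomain Ω) →
      ContDiffOn ℝ ∞ H (jetDomain Ω) →
      HasDerivAt (bracket G H q) (deriv (bracket G H q) x) x := fun hG hH =>
    ((contDiffAt_bracket hΩ hG hH hq.contDiffAt hx).differentiableAt (by simp)).hasDerivAt
  refine key.trans ?_
  have e : bracket (fun j => pointFlux (primaryFlux c) j + ε ^ 2 • flux2 a₁ a₂ j)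
      (fun j => (pointFlux f j + ε • flux1 b₁ b₂ j) + ε ^ 2 • flux2 d₁ d₂ j) q =ᶠ[𝓝 x]
      fun y => bracket (pointFlux (primaryFlux c)) (pointFlux f) q y
      + ε • bracket (pointFlux (primaryFlux c)) (flux1 b₁ b₂) q y
      + ε ^ 2 • (bracket (pointFlux (primaryFlux c)) (flux2 d₁ d₂) q y
          + bracket (flux2 a₁ a₂) (pointFlux f) q y)
      + ε ^ 3 • bracket (flux2 a₁ a₂) (flux1 b₁ b₂) q y
      + ε ^ 4 • bracket (flux2 a₁ a₂) (flux2 d₁ d₂) q y := by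
    filter_upwards [eventually_mem hΩ hq.contDiffAt hx] with y hy
    rw [bracket_add_smul_left hΩ hF ha _ hq hy, bracket_add_smul_right hΩ hfb hd _ hq hy,
      bracket_add_smul_right hΩ hfb hd _ hq hy, bracket_add_smul_right hΩ hf' hb _ hq hy,
      bracket_add_smul_right hΩ hf' hb _ hq hy]
    module
  have hs : HasDerivAt (fun y => bracket (pointFlux (primaryFlux c)) (flux2 d₁ d₂) q y
          + bracket (flux2 a₁ a₂) (pointFlux f) q y) _ x := (D hF hd).add (D ha hf')
  refine (Filter.EventuallyEq.deriv_eq e).trans (HasDerivAt.deriv ?_)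
  rw [hs.deriv]
  exact (((((D hF hf').add ((D hF hb).const_smul ε)).add (hs.const_smul (ε ^ 2))).add
    ((D ha hb).const_smul (ε ^ 3))).add ((D ha hd).const_smul (ε ^ 4)))

/-- The second-order obstruction to commutativity. -/
def obstruction (c : ℝ) (f : ℝ × ℝ → ℝ × ℝ) (G H : Jet → ℝ × ℝ) : DiffOp := fun q y =>
  bracket (pointFlux (primaryFlux c)) H q y + bracket G (pointFlux f) q y

/-- The coefficient of ε² is the total derivative of `obstruction`, which is local and vanishes on
constants; hence the obstruction itself vanishes. -/
lemma IsIntegrable.exists_obstruction_eq_zero {c : ℝ} (hΩ : IsOpen Ω) {a₁ a₂ : Poly2}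
    (ha₁ : a₁.SmoothOn Ω) (ha₂ : a₂.SmoothOn Ω) (h : IsIntegrable c Ω a₁ a₂)
    {f : ℝ × ℝ → ℝ × ℝ} (hf : IsDispersionlessSymmetry c Ω f) :
    ∃ d₁ d₂ : Poly2, d₁.SmoothOn Ω ∧ d₂.SmoothOn Ω ∧ ∀ q : Curve, ContDiff ℝ ∞ q → q 0 ∈ Ω →
      obstruction c f (flux2 a₁ a₂) (flux2 d₁ d₂) q 0 = 0 := by
  obtain ⟨b₁, b₂, d₁, d₂, hb₁, hb₂, hd₁, hd₂, hO⟩ := h f hf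
  refine ⟨d₁, d₂, hd₁, hd₂, fun q hq hq0 => ?_⟩
  have hF := contDiffOn_pointFlux (contDiff_primaryFlux c).contDiffOn (Ω := Ω)
  have hf' := contDiffOn_pointFlux hf.1
  have ha := contDiffOn_flux2 ha₁ ha₂
  have hd := contDiffOn_flux2 hd₁ hd₂
  refine eq_zero_of_deriv_eq_zero hΩ (fun q r x hqr => ?_) (fun p x => ?_) (fun q hq x hx => ?_)
    (fun q hq x hx => ?_) hq hq0
  · simp only [obstruction, bracket_congr hqr]
  · simp only [obstruction, bracket_const, add_zero]
  · exact ((contDiffAt_bracket hΩ hF hd hq.contDiffAt hx).add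
      (contDiffAt_bracket hΩ ha hf' hq.contDiffAt hx)).differentiableAt (by simp)
  · have := hO q hq x hx
    simp_rw [bracket_deformed c hΩ hf.1 hb₁ hb₂ ha₁ ha₂ hd₁ hd₂ hq hx] at this
    exact ((quartic_isBigO_iff _ _ _ _ _).1 this).2.2

lemma Poly1.smoothOn_zero : Poly1.zero.SmoothOn Ω := ⟨contDiffOn_const, contDiffOn_const⟩

/-- Zero degree one corrections suffice: up to order two they enter only the coefficient of ε, which
is linear in them. -/
lemma isIntegrable_of_obstruction {c : ℝ} (hΩ : IsOpen Ω) {a₁ a₂ : Poly2}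
    (ha₁ : a₁.SmoothOn Ω) (ha₂ : a₂.SmoothOn Ω)
    (h : ∀ f, IsDispersionlessSymmetry c Ω f → ∃ d₁ d₂ : Poly2, d₁.SmoothOn Ω ∧ d₂.SmoothOn Ω ∧
      ∀ q : Curve, ContDiff ℝ ∞ q → ∀ x, q x ∈ Ω →
        obstruction c f (flux2 a₁ a₂) (flux2 d₁ d₂) q x = 0) : IsIntegrable c Ω a₁ a₂ := by
  intro f hf
  obtain ⟨d₁, d₂, hd₁, hd₂, hd⟩ := h f hf
  have hF := contDiffOn_pointFlux (contDiff_primaryFlux c).contDiffOn (Ω := Ω)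
  refine ⟨Poly1.zero, Poly1.zero, d₁, d₂, Poly1.smoothOn_zero, Poly1.smoothOn_zero, hd₁, hd₂,
    fun q hq x hx => ?_⟩
  simp_rw [bracket_deformed c hΩ hf.1 Poly1.smoothOn_zero Poly1.smoothOn_zero ha₁ ha₂ hd₁ hd₂
    hq hx]
  rw [quartic_isBigO_iff]
  refine ⟨?_, ?_, ?_⟩
  · have := hf.2 q hq x hx
    rwa [hydroFlow_eq, hydroFlow_eq, commutator_flow hΩ hF (contDiffOn_pointFlux hf.1)
      hq.contDiffAt hx] at this
  · have hz : flux1 Poly1.zero Poly1.zero = fun _ => 0 := by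
      funext j; simp [flux1, Poly1.onJet, Poly1.zero]
    have hfl : flow (fun _ => 0) q = fun _ => 0 := by
      unfold flow; exact deriv_const' _
    have : bracket (pointFlux (primaryFlux c)) (flux1 Poly1.zero Poly1.zero) q = fun _ => 0 := by
      funext y
      simp [bracket, hz, hfl, jet_zero]
    rw [this, deriv_const]
  · have : (fun y => bracket (pointFlux (primaryFlux c)) (flux2 d₁ d₂) q y
          + bracket (flux2 a₁ a₂) (pointFlux f) q y) =ᶠ[𝓝 x] fun _ => 0 := by
      filter_upwards [eventually_mem hΩ hq.contDiffAt hx] with y hy using hd q hq y hy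
    rw [this.deriv_eq, deriv_const]

end

/-! ### The Riemann invariants as coordinates -/

/-- The differential of `invA`. -/
def L1 (c : ℝ) (p : ℝ × ℝ) : ℝ × ℝ →L[ℝ] ℝ :=
  ContinuousLinearMap.snd ℝ ℝ ℝ - (2 * (c + 1) * p.1) • ContinuousLinearMap.fst ℝ ℝ ℝ

/-- The differential of `invB`. -/
def L2 (c : ℝ) (p : ℝ × ℝ) : ℝ × ℝ →L[ℝ] ℝ :=
  ContinuousLinearMap.snd ℝ ℝ ℝ - ((2 * c + 1) * p.1) • ContinuousLinearMap.fst ℝ ℝ ℝ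

@[simp] lemma L1_apply (c : ℝ) (p X : ℝ × ℝ) : L1 c p X = X.2 - 2 * (c + 1) * p.1 * X.1 := by
  simp [L1]

@[simp] lemma L2_apply (c : ℝ) (p X : ℝ × ℝ) : L2 c p X = X.2 - (2 * c + 1) * p.1 * X.1 := by
  simp [L2]

/-- The derivative along the coordinate field of the first Riemann invariant. -/
def D1 (c : ℝ) (g : ℝ × ℝ → ℝ) (p : ℝ × ℝ) : ℝ := fderiv ℝ g p (-1 / p.1, -(2 * c + 1))

/-- The derivative along the coordinate field of the second Riemann invariant. -/
def D2 (c : ℝ) (g : ℝ × ℝ → ℝ) (p : ℝ × ℝ) : ℝ := fderiv ℝ g p (1 / p.1, 2 * (c + 1))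

/-- `g` is differentiable at `p`, with derivatives `a`, `b` in the Riemann invariants. -/
def HasD (c : ℝ) (g : ℝ × ℝ → ℝ) (p : ℝ × ℝ) (a b : ℝ) : Prop :=
  HasFDerivAt g (a • L1 c p + b • L2 c p) p

section HasD

variable {c : ℝ} {p : ℝ × ℝ} {g h : ℝ × ℝ → ℝ} {a b a' b' : ℝ}

lemma HasD.d1 (hp : p.1 ≠ 0) (hg : HasD c g p a b) : D1 c g p = a := by
  unfold D1
  rw [hg.fderiv]
  simp only [add_apply, smul_apply, L1_apply, L2_apply, smul_eq_mul]
  field_simp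
  ring

lemma HasD.d2 (hp : p.1 ≠ 0) (hg : HasD c g p a b) : D2 c g p = b := by
  unfold D2
  rw [hg.fderiv]
  simp only [add_apply, smul_apply, L1_apply, L2_apply, smul_eq_mul]
  field_simp
  ring

/-- The vectors that define `D1` and `D2` are the basis dual to `L1`, `L2`, which are independent
because u ≠ 0. -/
lemma hasD_of_differentiableAt (hp : p.1 ≠ 0) (hg : DifferentiableAt ℝ g p) :
    HasD c g p (D1 c g p) (D2 c g p) := by
  have h := hg.hasFDerivAt
  refine h.congr_fderiv (ContinuousLinearMap.ext fun X => ?_)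
  have e : X = L1 c p X • ((-1 / p.1, -(2 * c + 1)) : ℝ × ℝ)
      + L2 c p X • ((1 / p.1, 2 * (c + 1)) : ℝ × ℝ) := by
    ext
    · simp only [L1_apply, L2_apply, Prod.fst_add, Prod.smul_fst, smul_eq_mul]
      field_simp
      ring
    · simp only [L1_apply, L2_apply, Prod.snd_add, Prod.smul_snd, smul_eq_mul]
      ring
  conv_lhs => rw [e, map_add, map_smul, map_smul]
  simp only [add_apply, smul_apply, smul_eq_mul, D1, D2]
  ring

lemma HasD.congr (hg : HasD c g p a b) (ha : a = a') (hb : b = b') : HasD c g p a' b' := by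
  subst ha hb; exact hg

lemma HasD.congr_fun (hg : HasD c g p a b) (e : h =ᶠ[𝓝 p] g) : HasD c h p a b :=
  HasFDerivAt.congr_of_eventuallyEq hg e

lemma hasD_const (k : ℝ) : HasD c (fun _ => k) p 0 0 := by
  simpa [HasD] using hasFDerivAt_const k p

lemma HasD.add (hg : HasD c g p a b) (hh : HasD c h p a' b') :
    HasD c (fun x => g x + h x) p (a + a') (b + b') := by
  refine (HasFDerivAt.add hg hh).congr_fderiv ?_
  module

lemma HasD.sub (hg : HasD c g p a b) (hh : HasD c h p a' b') :
    HasD c (fun x => g x - h x) p (a - a') (b - b') := by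
  refine (HasFDerivAt.sub hg hh).congr_fderiv ?_
  module

lemma HasD.neg (hg : HasD c g p a b) : HasD c (fun x => -g x) p (-a) (-b) := by
  refine (HasFDerivAt.neg hg).congr_fderiv ?_
  module

lemma HasD.mul (hg : HasD c g p a b) (hh : HasD c h p a' b') :
    HasD c (fun x => g x * h x) p (a * h p + g p * a') (b * h p + g p * b') := by
  refine (HasFDerivAt.mul hg hh).congr_fderiv ?_
  module

lemma HasD.const_mul (k : ℝ) (hg : HasD c g p a b) :
    HasD c (fun x => k * g x) p (k * a) (k * b) :=
  ((hasD_const k).mul hg).congr (by ring) (by ring)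

lemma hasD_fst (hp : p.1 ≠ 0) : HasD c (fun x => x.1) p (-1 / p.1) (1 / p.1) := by
  refine (hasFDerivAt_fst (p := p)).congr_fderiv (ContinuousLinearMap.ext fun X => ?_)
  simp only [add_apply, smul_apply, smul_eq_mul, L1_apply, L2_apply, ContinuousLinearMap.coe_fst']
  field_simp
  ring

lemma hasD_snd : HasD c (fun x => x.2) p (-(2 * c + 1)) (2 * (c + 1)) := by
  refine (hasFDerivAt_snd (p := p)).congr_fderiv (ContinuousLinearMap.ext fun X => ?_)
  simp only [add_apply, smul_apply, smul_eq_mul, L1_apply, L2_apply, ContinuousLinearMap.coe_snd']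
  ring

lemma HasD.comp {φ : ℝ → ℝ} {φ' : ℝ} (hφ : HasDerivAt φ φ' (g p)) (hg : HasD c g p a b) :
    HasD c (fun x => φ (g x)) p (φ' * a) (φ' * b) := by
  refine (hφ.comp_hasFDerivAt p hg).congr_fderiv ?_
  module

lemma HasD.comp_hasDerivAt {γ : ℝ → ℝ × ℝ} {δ : ℝ × ℝ} {s : ℝ} (hg : HasD c g (γ s) a b)
    (hγ : HasDerivAt γ δ s) :
    HasDerivAt (fun t => g (γ t)) (a * L1 c (γ s) δ + b * L2 c (γ s) δ) s := by
  refine (HasFDerivAt.comp_hasDerivAt s hg hγ).congr_deriv ?_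
  simp

end HasD

/-- `1 / u ^ 2`. -/
def rho (p : ℝ × ℝ) : ℝ := 1 / p.1 ^ 2

/-- As a function of the invariants, `rho` is 1 / (2 (r₂ − r₁)). -/
lemma hasD_rho {c : ℝ} {p : ℝ × ℝ} (hp : p.1 ≠ 0) :
    HasD c rho p (2 * rho p ^ 2) (-2 * rho p ^ 2) := by
  have h : HasDerivAt (fun x : ℝ => 1 / x ^ 2) (-2 / p.1 ^ 3) p.1 := by
    have := (((hasDerivAt_id p.1).pow 2).inv (by simpa using hp))
    simp only [one_div]
    refine this.congr_deriv ?_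
    simp only [id, Pi.pow_apply]
    field_simp
    norm_num
    ring
  refine ((HasD.comp (g := fun x => x.1) h (hasD_fst hp)).congr ?_ ?_)
  · simp only [rho]; field_simp
  · simp only [rho]; field_simp

/-! ### Differential polynomials in the jets of the Riemann invariants -/

section Jets

variable (c : ℝ)

/-- The `x`-derivative of the first Riemann invariant. -/
def xi1 (j : Jet) : ℝ := j.2.1.2 - 2 * (c + 1) * j.1.1 * j.2.1.1

/-- The `x`-derivative of the second Riemann invariant. -/
def xi2 (j : Jet) : ℝ := j.2.1.2 - (2 * c + 1) * j.1.1 * j.2.1.1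

/-- The variation of `xi1` along `δ`. -/
def dxi1 (j δ : Jet) : ℝ :=
  δ.2.1.2 - 2 * (c + 1) * (δ.1.1 * j.2.1.1 + j.1.1 * δ.2.1.1)

/-- The variation of `xi2` along `δ`. -/
def dxi2 (j δ : Jet) : ℝ :=
  δ.2.1.2 - (2 * c + 1) * (δ.1.1 * j.2.1.1 + j.1.1 * δ.2.1.1)

/-- The second `x`-derivative of the first Riemann invariant. -/
def eta1 (j : Jet) : ℝ := j.2.2.2 - 2 * (c + 1) * (j.1.1 * j.2.2.1 + j.2.1.1 ^ 2)

/-- The second `x`-derivative of the second Riemann invariant. -/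
def eta2 (j : Jet) : ℝ := j.2.2.2 - (2 * c + 1) * (j.1.1 * j.2.2.1 + j.2.1.1 ^ 2)

/-- The variation of `eta1` along `δ`. -/
def deta1 (j δ : Jet) : ℝ :=
  δ.2.2.2 - 2 * (c + 1) * (δ.1.1 * j.2.2.1 + j.1.1 * δ.2.2.1 + 2 * j.2.1.1 * δ.2.1.1)

/-- The variation of `eta2` along `δ`. -/
def deta2 (j δ : Jet) : ℝ :=
  δ.2.2.2 - (2 * c + 1) * (δ.1.1 * j.2.2.1 + j.1.1 * δ.2.2.1 + 2 * j.2.1.1 * δ.2.1.1)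

/-- Value of a degree two polynomial in the jets of the Riemann invariants. -/
def Poly2.val (P : Poly2) (p : ℝ × ℝ) (x₁ x₂ n₁ n₂ : ℝ) : ℝ :=
  P.uxx p * n₁ + P.vxx p * n₂ + P.uxux p * x₁ ^ 2 + P.vxvx p * x₂ ^ 2 + P.uxvx p * (x₁ * x₂)

/-- Variation of a degree two polynomial in the jets of the Riemann invariants; `s`, `t` and `r`
are the variations of the invariants, of their first and of their second derivatives. -/
def Poly2.dot (P : Poly2) (p : ℝ × ℝ) (x₁ x₂ n₁ n₂ s₁ s₂ t₁ t₂ r₁ r₂ : ℝ) : ℝ :=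
  (D1 c P.uxx p * s₁ + D2 c P.uxx p * s₂) * n₁ + P.uxx p * r₁
    + ((D1 c P.vxx p * s₁ + D2 c P.vxx p * s₂) * n₂ + P.vxx p * r₂)
    + ((D1 c P.uxux p * s₁ + D2 c P.uxux p * s₂) * x₁ ^ 2 + P.uxux p * (2 * x₁ * t₁))
    + ((D1 c P.vxvx p * s₁ + D2 c P.vxvx p * s₂) * x₂ ^ 2 + P.vxvx p * (2 * x₂ * t₂))
    + ((D1 c P.uxvx p * s₁ + D2 c P.uxvx p * s₂) * (x₁ * x₂) + P.uxvx p * (t₁ * x₂ + x₁ * t₂))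

/-- A degree two polynomial in the jets of the Riemann invariants, as a function of jets. -/
def Poly2.riem (P : Poly2) (j : Jet) : ℝ := P.val j.1 (xi1 c j) (xi2 c j) (eta1 c j) (eta2 c j)

/-- Variation of `Poly2.riem`. -/
def Poly2.driem (P : Poly2) (j δ : Jet) : ℝ :=
  P.dot c j.1 (xi1 c j) (xi2 c j) (eta1 c j) (eta2 c j) (L1 c j.1 δ.1) (L2 c j.1 δ.1)
    (dxi1 c j δ) (dxi2 c j δ) (deta1 c j δ) (deta2 c j δ)

/-- The flux with the given components in the coordinate frame of the Riemann invariants. -/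
def riemFlux (P₁ P₂ : Poly2) (j : Jet) : ℝ × ℝ :=
  ((P₂.riem c j - P₁.riem c j) / j.1.1, 2 * (c + 1) * P₂.riem c j - (2 * c + 1) * P₁.riem c j)

/-- Variation of `riemFlux`. -/
def driemFlux (P₁ P₂ : Poly2) (j δ : Jet) : ℝ × ℝ :=
  ((P₂.driem c j δ - P₁.driem c j δ) / j.1.1
      - (P₂.riem c j - P₁.riem c j) * δ.1.1 / j.1.1 ^ 2,
    2 * (c + 1) * P₂.driem c j δ - (2 * c + 1) * P₁.driem c j δ)

end Jets

section

variable {c : ℝ} {Ω : Set (ℝ × ℝ)}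

lemma hasDerivAt_components {γ : ℝ → Jet} {δ : Jet} {s : ℝ} (hγ : HasDerivAt γ δ s) :
    HasDerivAt (fun t => (γ t).1) δ.1 s ∧
    HasDerivAt (fun t => (γ t).1.1) δ.1.1 s ∧ HasDerivAt (fun t => (γ t).1.2) δ.1.2 s ∧
    HasDerivAt (fun t => (γ t).2.1.1) δ.2.1.1 s ∧ HasDerivAt (fun t => (γ t).2.1.2) δ.2.1.2 s ∧
    HasDerivAt (fun t => (γ t).2.2.1) δ.2.2.1 s ∧ HasDerivAt (fun t => (γ t).2.2.2) δ.2.2.2 s :=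
  ⟨hγ.fst, hγ.fst.fst, hγ.fst.snd, hγ.snd.fst.fst, hγ.snd.fst.snd, hγ.snd.snd.fst,
    hγ.snd.snd.snd⟩

lemma hasDerivAt_xi1 {γ : ℝ → Jet} {δ : Jet} {s : ℝ} (hγ : HasDerivAt γ δ s) :
    HasDerivAt (fun t => xi1 c (γ t)) (dxi1 c (γ s) δ) s := by
  obtain ⟨-, u, v, ux, vx, uxx, vxx⟩ := hasDerivAt_components hγ
  unfold xi1 dxi1
  exact (vx.sub ((u.const_mul (2 * (c + 1))).mul ux)).congr_deriv (by ring)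

lemma hasDerivAt_xi2 {γ : ℝ → Jet} {δ : Jet} {s : ℝ} (hγ : HasDerivAt γ δ s) :
    HasDerivAt (fun t => xi2 c (γ t)) (dxi2 c (γ s) δ) s := by
  obtain ⟨-, u, v, ux, vx, uxx, vxx⟩ := hasDerivAt_components hγ
  unfold xi2 dxi2
  exact (vx.sub ((u.const_mul (2 * c + 1)).mul ux)).congr_deriv (by ring)

lemma hasDerivAt_eta1 {γ : ℝ → Jet} {δ : Jet} {s : ℝ} (hγ : HasDerivAt γ δ s) :
    HasDerivAt (fun t => eta1 c (γ t)) (deta1 c (γ s) δ) s := by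
  obtain ⟨-, u, v, ux, vx, uxx, vxx⟩ := hasDerivAt_components hγ
  unfold eta1 deta1
  exact (vxx.sub (((u.mul uxx).add (ux.pow 2)).const_mul (2 * (c + 1)))).congr_deriv
    (by push_cast; ring)

lemma hasDerivAt_eta2 {γ : ℝ → Jet} {δ : Jet} {s : ℝ} (hγ : HasDerivAt γ δ s) :
    HasDerivAt (fun t => eta2 c (γ t)) (deta2 c (γ s) δ) s := by
  obtain ⟨-, u, v, ux, vx, uxx, vxx⟩ := hasDerivAt_components hγ
  unfold eta2 deta2
  exact (vxx.sub (((u.mul uxx).add (ux.pow 2)).const_mul (2 * c + 1))).congr_deriv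
    (by push_cast; ring)

/-- All coefficients are differentiable at `p`. -/
def Poly2.DiffAt (P : Poly2) (p : ℝ × ℝ) : Prop :=
  DifferentiableAt ℝ P.uxx p ∧ DifferentiableAt ℝ P.vxx p ∧ DifferentiableAt ℝ P.uxux p ∧
    DifferentiableAt ℝ P.vxvx p ∧ DifferentiableAt ℝ P.uxvx p

lemma Poly2.SmoothOn.diffAt {P : Poly2} (h : P.SmoothOn Ω) (hΩ : IsOpen Ω) {p : ℝ × ℝ}
    (hp : p ∈ Ω) : P.DiffAt p := by
  obtain ⟨h1, h2, h3, h4, h5⟩ := h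
  have d : ∀ {g : ℝ × ℝ → ℝ}, ContDiffOn ℝ ∞ g Ω → DifferentiableAt ℝ g p := fun hg =>
    (eventually_contDiffAt_infty hΩ hg hp).differentiableAt (by simp)
  exact ⟨d h1, d h2, d h3, d h4, d h5⟩

lemma Poly2.hasDerivAt_riem {P : Poly2} {γ : ℝ → Jet} {δ : Jet} {s : ℝ} (hγ : HasDerivAt γ δ s)
    (hu : (γ s).1.1 ≠ 0) (hP : P.DiffAt (γ s).1) :
    HasDerivAt (fun t => P.riem c (γ t)) (P.driem c (γ s) δ) s := by
  obtain ⟨h1, h2, h3, h4, h5⟩ := hP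
  have x1 := hasDerivAt_xi1 (c := c) hγ
  have x2 := hasDerivAt_xi2 (c := c) hγ
  have n1 := hasDerivAt_eta1 (c := c) hγ
  have n2 := hasDerivAt_eta2 (c := c) hγ
  have d : ∀ {g : ℝ × ℝ → ℝ}, DifferentiableAt ℝ g (γ s).1 → HasDerivAt (fun t => g (γ t).1)
      (D1 c g (γ s).1 * L1 c (γ s).1 δ.1 + D2 c g (γ s).1 * L2 c (γ s).1 δ.1) s := fun hg =>
    HasD.comp_hasDerivAt (γ := fun t => (γ t).1) (hasD_of_differentiableAt hu hg) hγ.fst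
  unfold Poly2.riem Poly2.driem Poly2.val Poly2.dot
  refine ((((((d h1).mul n1).add ((d h2).mul n2)).add ((d h3).mul (x1.pow 2))).add
    ((d h4).mul (x2.pow 2))).add ((d h5).mul (x1.mul x2))).congr_deriv ?_
  simp only [Pi.pow_apply, Pi.mul_apply]
  push_cast
  ring

lemma hasDerivAt_riemFlux {P₁ P₂ : Poly2} {γ : ℝ → Jet} {δ : Jet} {s : ℝ}
    (hγ : HasDerivAt γ δ s) (hu : (γ s).1.1 ≠ 0) (h₁ : P₁.DiffAt (γ s).1)
    (h₂ : P₂.DiffAt (γ s).1) :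
    HasDerivAt (fun t => riemFlux c P₁ P₂ (γ t)) (driemFlux c P₁ P₂ (γ s) δ) s := by
  have d1 := Poly2.hasDerivAt_riem (c := c) hγ hu h₁
  have d2 := Poly2.hasDerivAt_riem (c := c) hγ hu h₂
  obtain ⟨-, u, -⟩ := hasDerivAt_components hγ
  unfold riemFlux driemFlux
  refine HasDerivAt.prodMk (((d2.sub d1).div u hu).congr_deriv ?_)
    ((d2.const_mul (2 * (c + 1))).sub (d1.const_mul (2 * c + 1)))
  simp only [Pi.sub_apply]
  field_simp

lemma Poly2.contDiffOn_riem {P : Poly2} (hP : P.SmoothOn Ω) :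
    ContDiffOn ℝ ∞ (P.riem c) (jetDomain Ω) := by
  obtain ⟨h1, h2, h3, h4, h5⟩ := hP
  have h1 := contDiffOn_coeff h1
  have h2 := contDiffOn_coeff h2
  have h3 := contDiffOn_coeff h3
  have h4 := contDiffOn_coeff h4
  have h5 := contDiffOn_coeff h5
  unfold Poly2.riem Poly2.val xi1 xi2 eta1 eta2
  fun_prop

lemma contDiffOn_riemFlux (hu : ∀ p ∈ Ω, p.1 ≠ 0) {P₁ P₂ : Poly2} (h₁ : P₁.SmoothOn Ω)
    (h₂ : P₂.SmoothOn Ω) : ContDiffOn ℝ ∞ (riemFlux c P₁ P₂) (jetDomain Ω) := by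
  have h₁ := Poly2.contDiffOn_riem (c := c) h₁
  have h₂ := Poly2.contDiffOn_riem (c := c) h₂
  unfold riemFlux
  refine ContDiffOn.prodMk ?_ (by fun_prop)
  exact (h₂.sub h₁).div (by fun_prop) fun j hj => hu _ hj

lemma fderiv_riemFlux (hΩ : IsOpen Ω) (hu : ∀ p ∈ Ω, p.1 ≠ 0) {P₁ P₂ : Poly2}
    (h₁ : P₁.SmoothOn Ω) (h₂ : P₂.SmoothOn Ω) {j : Jet} (hj : j.1 ∈ Ω) (δ : Jet) :
    fderiv ℝ (riemFlux c P₁ P₂) j δ = driemFlux c P₁ P₂ j δ := by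
  have h := (differentiableAt_flux hΩ (contDiffOn_riemFlux (c := c) hu h₁ h₂) hj).hasFDerivAt
  have l : HasDerivAt (fun s : ℝ => j + s • δ) δ 0 := by
    simpa using ((hasDerivAt_id (0:ℝ)).smul_const δ).const_add j
  have a := hasDerivAt_riemFlux (c := c) (P₁ := P₁) (P₂ := P₂) l (by simpa using hu _ hj)
    (by simpa using h₁.diffAt hΩ hj) (by simpa using h₂.diffAt hΩ hj)
  have h' : HasFDerivAt (riemFlux c P₁ P₂) (fderiv ℝ (riemFlux c P₁ P₂) j) (j + (0:ℝ) • δ) := by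
    simpa using h
  have b := h'.comp_hasDerivAt (0:ℝ) l
  simpa using b.unique a

end

/-! ### The obstruction in the Riemann frame -/

/-- First, second and third derivatives of the Riemann invariants along a configuration. -/
structure InvJet where
  x₁ : ℝ
  x₂ : ℝ
  n₁ : ℝ
  n₂ : ℝ
  z₁ : ℝ
  z₂ : ℝ

/-- Characteristic speeds along a configuration, with their first and second derivatives. -/
structure SpeedJet where
  m₁ : ℝ
  dm₁ : ℝ
  ddm₁ : ℝ
  m₂ : ℝ
  dm₂ : ℝ
  ddm₂ : ℝ

/-- The total `x`-derivative of a degree two polynomial. -/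
def Poly2.dotX (c : ℝ) (P : Poly2) (p : ℝ × ℝ) (X : InvJet) : ℝ :=
  P.dot c p X.x₁ X.x₂ X.n₁ X.n₂ X.x₁ X.x₂ X.n₁ X.n₂ X.z₁ X.z₂

/-- The derivative of a degree two polynomial along a diagonal flow. -/
def Poly2.dotT (c : ℝ) (P : Poly2) (p : ℝ × ℝ) (X : InvJet) (M : SpeedJet) : ℝ :=
  P.dot c p X.x₁ X.x₂ X.n₁ X.n₂ (M.m₁ * X.x₁) (M.m₂ * X.x₂)
    (M.dm₁ * X.x₁ + M.m₁ * X.n₁) (M.dm₂ * X.x₂ + M.m₂ * X.n₂)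
    (M.ddm₁ * X.x₁ + 2 * (M.dm₁ * X.n₁) + M.m₁ * X.z₁)
    (M.ddm₂ * X.x₂ + 2 * (M.dm₂ * X.n₂) + M.m₂ * X.z₂)

/-- First component of the obstruction, in the frame of the Riemann invariants. -/
def Z1 (c : ℝ) (A₁ A₂ E₁ E₂ : Poly2) (p : ℝ × ℝ) (X : InvJet) (L M : SpeedJet) : ℝ :=
  L.m₁ * E₁.dotX c p X - E₁.dotT c p X L - (M.m₁ * A₁.dotX c p X - A₁.dotT c p X M)
    + 2 * (c + 1) * rho p * X.x₂ *
      ((L.m₁ - L.m₂) * (E₂.val p X.x₁ X.x₂ X.n₁ X.n₂ - E₁.val p X.x₁ X.x₂ X.n₁ X.n₂)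
        - (M.m₁ - M.m₂) * (A₂.val p X.x₁ X.x₂ X.n₁ X.n₂ - A₁.val p X.x₁ X.x₂ X.n₁ X.n₂))

/-- Second component of the obstruction, in the frame of the Riemann invariants. -/
def Z2 (c : ℝ) (A₁ A₂ E₁ E₂ : Poly2) (p : ℝ × ℝ) (X : InvJet) (L M : SpeedJet) : ℝ :=
  L.m₂ * E₂.dotX c p X - E₂.dotT c p X L - (M.m₂ * A₂.dotX c p X - A₂.dotT c p X M)
    + (2 * c + 1) * rho p * X.x₁ *
      ((L.m₁ - L.m₂) * (E₂.val p X.x₁ X.x₂ X.n₁ X.n₂ - E₁.val p X.x₁ X.x₂ X.n₁ X.n₂)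
        - (M.m₁ - M.m₂) * (A₂.val p X.x₁ X.x₂ X.n₁ X.n₂ - A₁.val p X.x₁ X.x₂ X.n₁ X.n₂))

/-- The flux `f` is diagonal in the Riemann invariants, with characteristic speeds `μ₁`, `μ₂`. -/
structure IsDiagonal (c : ℝ) (Ω : Set (ℝ × ℝ)) (f : ℝ × ℝ → ℝ × ℝ) (μ₁ μ₂ : ℝ × ℝ → ℝ) : Prop where
  smooth : ContDiffOn ℝ ∞ f Ω
  smooth₁ : ContDiffOn ℝ ∞ μ₁ Ω
  smooth₂ : ContDiffOn ℝ ∞ μ₂ Ω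
  fst : ∀ p ∈ Ω, HasD c (fun x => (f x).1) p (-μ₁ p / p.1) (μ₂ p / p.1)
  snd : ∀ p ∈ Ω, HasD c (fun x => (f x).2) p (-(2 * c + 1) * μ₁ p) (2 * (c + 1) * μ₂ p)

/-- Jets of the Riemann invariants along `q`. -/
def invJet (c : ℝ) (q : Curve) (y : ℝ) : InvJet :=
  ⟨xi1 c (jet q y), xi2 c (jet q y), eta1 c (jet q y), eta2 c (jet q y),
    deta1 c (jet q y) (jet (deriv q) y), deta2 c (jet q y) (jet (deriv q) y)⟩

/-- Jets of the speeds along `q`. -/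
def speedJet (μ₁ μ₂ : ℝ × ℝ → ℝ) (q : Curve) (y : ℝ) : SpeedJet :=
  ⟨μ₁ (q y), deriv (fun z => μ₁ (q z)) y, deriv (deriv fun z => μ₁ (q z)) y,
    μ₂ (q y), deriv (fun z => μ₂ (q z)) y, deriv (deriv fun z => μ₂ (q z)) y⟩

section

variable {c : ℝ} {Ω : Set (ℝ × ℝ)}

lemma isDiagonal_primaryFlux (hu : ∀ p ∈ Ω, p.1 ≠ 0) :
    IsDiagonal c Ω (primaryFlux c) (fun p => -(2 * (c + 1) * p.1))
      (fun p => -((2 * c + 1) * p.1)) where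
  smooth := (contDiff_primaryFlux c).contDiffOn
  smooth₁ := by fun_prop
  smooth₂ := by fun_prop
  fst p hp := by
    have h := hu p hp
    refine (hasD_snd.sub (((hasD_fst (c := c) h).mul (hasD_fst h)).const_mul
      (2 * (c + 3 / 4)))).congr_fun (Eventually.of_forall fun x => ?_) |>.congr ?_ ?_
    · simp only [primaryFlux]; ring
    · field_simp; ring
    · field_simp; ring
  snd p hp := by
    have h := hu p hp
    refine (((hasD_fst (c := c) h).mul ((hasD_fst h).mul (hasD_fst h))).const_mul
      (-(4 / 3) * (c + 1 / 2) * (c + 1))).congr_fun (Eventually.of_forall fun x => ?_)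
      |>.congr ?_ ?_
    · simp only [primaryFlux]; ring
    · field_simp; ring
    · field_simp; ring

lemma IsDiagonal.fderiv_apply {f : ℝ × ℝ → ℝ × ℝ} {μ₁ μ₂ : ℝ × ℝ → ℝ}
    (h : IsDiagonal c Ω f μ₁ μ₂) {p : ℝ × ℝ} (hp : p ∈ Ω) (X : ℝ × ℝ) :
    fderiv ℝ f p X = ((μ₂ p * L2 c p X - μ₁ p * L1 c p X) / p.1,
      2 * (c + 1) * μ₂ p * L2 c p X - (2 * c + 1) * μ₁ p * L1 c p X) := by
  have h2 := HasFDerivAt.prodMk (h.fst p hp) (h.snd p hp)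
  have h3 : HasFDerivAt f _ p := h2
  rw [h3.fderiv]
  ext
  · simp only [ContinuousLinearMap.prod_apply, add_apply, smul_apply, smul_eq_mul]
    ring
  · simp only [ContinuousLinearMap.prod_apply, add_apply, smul_apply, smul_eq_mul]
    ring

lemma contDiffAt_comp_curve (hΩ : IsOpen Ω) {g : ℝ × ℝ → ℝ} (hg : ContDiffOn ℝ ∞ g Ω) {q : Curve}
    (hq : ContDiff ℝ ∞ q) {y : ℝ} (hy : q y ∈ Ω) : ContDiffAt ℝ ∞ (fun z => g (q z)) y :=
  (eventually_contDiffAt_infty hΩ hg hy).comp y hq.contDiffAt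

lemma hasDerivAt_of_contDiffAt {E : Type*} [NormedAddCommGroup E] [NormedSpace ℝ E] {f : ℝ → E}
    {x : ℝ} (h : ContDiffAt ℝ ∞ f x) : HasDerivAt f (deriv f x) x :=
  (h.differentiableAt (by simp)).hasDerivAt

lemma hasDerivAt_jet {q : Curve} {y : ℝ} (hq : ContDiffAt ℝ ∞ q y) :
    HasDerivAt (jet q) (jet (deriv q) y) y :=
  (hasDerivAt_of_contDiffAt hq).prodMk ((hasDerivAt_of_contDiffAt (contDiffAt_deriv hq)).prodMk
    (hasDerivAt_of_contDiffAt (contDiffAt_deriv (contDiffAt_deriv hq))))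

lemma hasDerivAt_xi1_jet {q : Curve} {y : ℝ} (hq : ContDiffAt ℝ ∞ q y) :
    HasDerivAt (fun z => xi1 c (jet q z)) (eta1 c (jet q y)) y := by
  refine (hasDerivAt_xi1 (hasDerivAt_jet hq)).congr_deriv ?_
  simp only [dxi1, eta1, jet]; ring

lemma hasDerivAt_xi2_jet {q : Curve} {y : ℝ} (hq : ContDiffAt ℝ ∞ q y) :
    HasDerivAt (fun z => xi2 c (jet q z)) (eta2 c (jet q y)) y := by
  refine (hasDerivAt_xi2 (hasDerivAt_jet hq)).congr_deriv ?_
  simp only [dxi2, eta2, jet]; ring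

/-- Linearization of the jets of `k * u ^ 2` type quadratic invariants along `h`. -/
lemma hasDerivAt_linearized (k : ℝ) {q h : Curve} {y : ℝ} (hq : ContDiffAt ℝ ∞ q y)
    (hh : ContDiffAt ℝ ∞ h y) :
    HasDerivAt (fun z => (h z).2 - k * ((h z).1 * (q z).1))
      ((deriv h y).2 - k * ((h y).1 * (deriv q y).1 + (q y).1 * (deriv h y).1)) y ∧
    HasDerivAt
      (fun z => (deriv h z).2 - k * ((h z).1 * (deriv q z).1 + (q z).1 * (deriv h z).1))
      ((deriv (deriv h) y).2 - k * ((h y).1 * (deriv (deriv q) y).1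
        + (q y).1 * (deriv (deriv h) y).1 + 2 * (deriv q y).1 * (deriv h y).1)) y := by
  have q0 := hasDerivAt_of_contDiffAt hq
  have q1 := hasDerivAt_of_contDiffAt (contDiffAt_deriv hq)
  have h0 := hasDerivAt_of_contDiffAt hh
  have h1 := hasDerivAt_of_contDiffAt (contDiffAt_deriv hh)
  have h01 : HasDerivAt (fun z => (h z).1) (deriv h y).1 y := h0.fst
  have h02 : HasDerivAt (fun z => (h z).2) (deriv h y).2 y := h0.snd
  have h11 : HasDerivAt (fun z => (deriv h z).1) (deriv (deriv h) y).1 y := h1.fst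
  have h12 : HasDerivAt (fun z => (deriv h z).2) (deriv (deriv h) y).2 y := h1.snd
  have q01 : HasDerivAt (fun z => (q z).1) (deriv q y).1 y := q0.fst
  have q11 : HasDerivAt (fun z => (deriv q z).1) (deriv (deriv q) y).1 y := q1.fst
  constructor
  · exact (h02.sub ((h01.mul q01).const_mul k)).congr_deriv (by ring)
  · exact (h12.sub (((h01.mul q11).add (q01.mul h11)).const_mul k)).congr_deriv (by ring)

lemma eventually_contDiffAt_flow (hΩ : IsOpen Ω) {G : Jet → ℝ × ℝ}
    (hG : ContDiffOn ℝ ∞ G (jetDomain Ω)) {q : Curve} (hq : ContDiff ℝ ∞ q) {y : ℝ}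
    (hy : q y ∈ Ω) : ∀ᶠ z in 𝓝 y, ContDiffAt ℝ ∞ (flow G q) z := by
  filter_upwards [eventually_mem hΩ hq.contDiffAt hy] with z hz
  exact contDiffAt_flow hΩ hG hq.contDiffAt hz

/-- The Leibniz rule, read through uniqueness of derivatives, when the derivatives of t = m x are
given by other formulas. With m a speed and x the derivative of an invariant it computes how a
diagonal flow moves the first and second derivatives of that invariant. -/
lemma second_deriv_mul {m x n : ℝ → ℝ} {z y : ℝ} (hm : ContDiffAt ℝ ∞ m y)
    (hx : ∀ᶠ t in 𝓝 y, HasDerivAt x (n t) t) (hn : HasDerivAt n z y) {t dt : ℝ → ℝ} {ddt : ℝ}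
    (ht : t =ᶠ[𝓝 y] fun s => m s * x s) (hdt : ∀ᶠ s in 𝓝 y, HasDerivAt t (dt s) s)
    (hddt : HasDerivAt dt ddt y) :
    dt y = deriv m y * x y + m y * n y ∧
      ddt = deriv (deriv m) y * x y + 2 * (deriv m y * n y) + m y * z := by
  have hm' : ∀ᶠ s in 𝓝 y, HasDerivAt m (deriv m s) s :=
    (eventually_contDiffAt hm).mono fun s hs => (hs.differentiableAt one_ne_zero).hasDerivAt
  have e : dt =ᶠ[𝓝 y] fun s => deriv m s * x s + m s * n s := by
    filter_upwards [hm', hx, hdt, ht.eventuallyEq_nhds] with s h1 h2 h3 h4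
    exact h3.unique ((h1.mul h2).congr_of_eventuallyEq h4)
  refine ⟨e.eq_of_nhds, ?_⟩
  have d := ((hasDerivAt_of_contDiffAt (contDiffAt_deriv hm)).mul hx.self_of_nhds).add
    ((hm'.self_of_nhds).mul hn)
  rw [hddt.unique (d.congr_of_eventuallyEq e)]
  ring

/-- The jets of the Riemann invariants are transported by a diagonal flow. -/
lemma IsDiagonal.transport_jet (hΩ : IsOpen Ω) (hu : ∀ p ∈ Ω, p.1 ≠ 0) {f : ℝ × ℝ → ℝ × ℝ}
    {μ₁ μ₂ : ℝ × ℝ → ℝ} (h : IsDiagonal c Ω f μ₁ μ₂) {q : Curve} (hq : ContDiff ℝ ∞ q) {y : ℝ}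
    (hy : q y ∈ Ω) {X : InvJet} (hX : X = invJet c q y) {M : SpeedJet}
    (hM : M = speedJet μ₁ μ₂ q y) {δ : Jet} (hδ : δ = jet (flow (pointFlux f) q) y) :
    (L1 c (q y) δ.1 = M.m₁ * X.x₁ ∧ dxi1 c (jet q y) δ = M.dm₁ * X.x₁ + M.m₁ * X.n₁ ∧
      deta1 c (jet q y) δ = M.ddm₁ * X.x₁ + 2 * (M.dm₁ * X.n₁) + M.m₁ * X.z₁) ∧
    (L2 c (q y) δ.1 = M.m₂ * X.x₂ ∧ dxi2 c (jet q y) δ = M.dm₂ * X.x₂ + M.m₂ * X.n₂ ∧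
      deta2 c (jet q y) δ = M.ddm₂ * X.x₂ + 2 * (M.dm₂ * X.n₂) + M.m₂ * X.z₂) := by
  have hfl := eventually_contDiffAt_flow hΩ (contDiffOn_pointFlux h.smooth) hq hy
  have ev : ∀ᶠ z in 𝓝 y, q z ∈ Ω := eventually_mem hΩ hq.contDiffAt hy
  have t1 : (fun z => L1 c (q z) (flow (pointFlux f) q z))
      =ᶠ[𝓝 y] fun z => μ₁ (q z) * xi1 c (jet q z) := by
    filter_upwards [ev] with z hz
    have := hu _ hz
    rw [flow_pointFlux hΩ h.smooth hq hz, h.fderiv_apply hz]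
    simp only [L1_apply, L2_apply, xi1, jet]
    field_simp
    ring
  have t2 : (fun z => L2 c (q z) (flow (pointFlux f) q z))
      =ᶠ[𝓝 y] fun z => μ₂ (q z) * xi2 c (jet q z) := by
    filter_upwards [ev] with z hz
    have := hu _ hz
    rw [flow_pointFlux hΩ h.smooth hq hz, h.fderiv_apply hz]
    simp only [L1_apply, L2_apply, xi2, jet]
    field_simp
    ring
  have z1 : HasDerivAt (fun z => eta1 c (jet q z)) (deta1 c (jet q y) (jet (deriv q) y)) y :=
    hasDerivAt_eta1 (hasDerivAt_jet hq.contDiffAt)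
  have z2 : HasDerivAt (fun z => eta2 c (jet q z)) (deta2 c (jet q y) (jet (deriv q) y)) y :=
    hasDerivAt_eta2 (hasDerivAt_jet hq.contDiffAt)
  obtain ⟨a1, a2⟩ := second_deriv_mul (t := fun z => L1 c (q z) (flow (pointFlux f) q z))
    (dt := fun z => dxi1 c (jet q z) (jet (flow (pointFlux f) q) z))
    (ddt := deta1 c (jet q y) (jet (flow (pointFlux f) q) y))
    (contDiffAt_comp_curve hΩ h.smooth₁ hq hy)
    (Eventually.of_forall fun t => hasDerivAt_xi1_jet (c := c) hq.contDiffAt) z1 t1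
    (hfl.mono fun z hz => by
      have := (hasDerivAt_linearized (2 * (c + 1)) hq.contDiffAt hz).1
      refine (this.congr_of_eventuallyEq (Eventually.of_forall fun s => ?_)).congr_deriv ?_
      · simp only [L1_apply]; ring
      · simp only [dxi1, jet])
    (by
      have := (hasDerivAt_linearized (2 * (c + 1)) hq.contDiffAt hfl.self_of_nhds).2
      refine (this.congr_of_eventuallyEq (Eventually.of_forall fun s => ?_)).congr_deriv ?_
      · simp only [dxi1, jet]
      · simp only [deta1, jet])
  obtain ⟨b1, b2⟩ := second_deriv_mul (t := fun z => L2 c (q z) (flow (pointFlux f) q z))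
    (dt := fun z => dxi2 c (jet q z) (jet (flow (pointFlux f) q) z))
    (ddt := deta2 c (jet q y) (jet (flow (pointFlux f) q) y))
    (contDiffAt_comp_curve hΩ h.smooth₂ hq hy)
    (Eventually.of_forall fun t => hasDerivAt_xi2_jet (c := c) hq.contDiffAt) z2 t2
    (hfl.mono fun z hz => by
      have := (hasDerivAt_linearized (2 * c + 1) hq.contDiffAt hz).1
      refine (this.congr_of_eventuallyEq (Eventually.of_forall fun s => ?_)).congr_deriv ?_
      · simp only [L2_apply]; ring
      · simp only [dxi2, jet])
    (by
      have := (hasDerivAt_linearized (2 * c + 1) hq.contDiffAt hfl.self_of_nhds).2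
      refine (this.congr_of_eventuallyEq (Eventually.of_forall fun s => ?_)).congr_deriv ?_
      · simp only [dxi2, jet]
      · simp only [deta2, jet])
  subst hX hM hδ
  exact ⟨⟨t1.eq_of_nhds, a1, a2⟩, t2.eq_of_nhds, b1, b2⟩

lemma IsDiagonal.transport (hΩ : IsOpen Ω) (hu : ∀ p ∈ Ω, p.1 ≠ 0) {f : ℝ × ℝ → ℝ × ℝ}
    {μ₁ μ₂ : ℝ × ℝ → ℝ} (h : IsDiagonal c Ω f μ₁ μ₂) {q : Curve} (hq : ContDiff ℝ ∞ q) {y : ℝ}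
    (hy : q y ∈ Ω) (P : Poly2) :
    P.driem c (jet q y) (jet (flow (pointFlux f) q) y)
      = P.dotT c (q y) (invJet c q y) (speedJet μ₁ μ₂ q y) := by
  obtain ⟨⟨c1, a1, a2⟩, c2, b1, b2⟩ := h.transport_jet hΩ hu hq hy rfl rfl rfl
  unfold Poly2.driem Poly2.dotT
  rw [← a1, ← a2, ← b1, ← b2, ← c1, ← c2]
  rfl

lemma driem_deriv {q : Curve} {y : ℝ} (P : Poly2) :
    P.driem c (jet q y) (jet (deriv q) y) = P.dotX c (q y) (invJet c q y) := by
  unfold Poly2.driem Poly2.dotX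
  have e1 : L1 c (jet q y).1 (jet (deriv q) y).1 = xi1 c (jet q y) := by simp [xi1, jet]
  have e2 : L2 c (jet q y).1 (jet (deriv q) y).1 = xi2 c (jet q y) := by simp [xi2, jet]
  have e3 : dxi1 c (jet q y) (jet (deriv q) y) = eta1 c (jet q y) := by
    simp only [dxi1, eta1, jet]; ring
  have e4 : dxi2 c (jet q y) (jet (deriv q) y) = eta2 c (jet q y) := by
    simp only [dxi2, eta2, jet]; ring
  rw [e1, e2, e3, e4]
  rfl

lemma flow_riemFlux (hu : ∀ p ∈ Ω, p.1 ≠ 0) (hΩ : IsOpen Ω) {P₁ P₂ : Poly2}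
    (h₁ : P₁.SmoothOn Ω) (h₂ : P₂.SmoothOn Ω) {q : Curve} (hq : ContDiff ℝ ∞ q) {y : ℝ}
    (hy : q y ∈ Ω) :
    flow (riemFlux c P₁ P₂) q y = driemFlux c P₁ P₂ (jet q y) (jet (deriv q) y) :=
  (hasDerivAt_riemFlux (hasDerivAt_jet hq.contDiffAt) (hu _ hy) (h₁.diffAt hΩ hy)
    (h₂.diffAt hΩ hy)).deriv

/-- Components of the bracket of a diagonal flow with a degree two flux. -/
lemma bracket_riemFlux (hΩ : IsOpen Ω) (hu : ∀ p ∈ Ω, p.1 ≠ 0) {f : ℝ × ℝ → ℝ × ℝ}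
    {μ₁ μ₂ : ℝ × ℝ → ℝ} (h : IsDiagonal c Ω f μ₁ μ₂) {P₁ P₂ : Poly2}
    (h₁ : P₁.SmoothOn Ω) (h₂ : P₂.SmoothOn Ω) {q : Curve} (hq : ContDiff ℝ ∞ q) {y : ℝ}
    (hy : q y ∈ Ω) (X : InvJet) (hX : X = invJet c q y) (M : SpeedJet)
    (hM : M = speedJet μ₁ μ₂ q y) :
    L1 c (q y) (bracket (pointFlux f) (riemFlux c P₁ P₂) q y)
      = M.m₁ * P₁.dotX c (q y) X - P₁.dotT c (q y) X M
        + 2 * (c + 1) * rho (q y) * X.x₂ * ((M.m₁ - M.m₂) *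
          (P₂.val (q y) X.x₁ X.x₂ X.n₁ X.n₂ - P₁.val (q y) X.x₁ X.x₂ X.n₁ X.n₂)) ∧
    L2 c (q y) (bracket (pointFlux f) (riemFlux c P₁ P₂) q y)
      = M.m₂ * P₂.dotX c (q y) X - P₂.dotT c (q y) X M
        + (2 * c + 1) * rho (q y) * X.x₁ * ((M.m₁ - M.m₂) *
          (P₂.val (q y) X.x₁ X.x₂ X.n₁ X.n₂ - P₁.val (q y) X.x₁ X.x₂ X.n₁ X.n₂)) := by
  have hne := hu _ hy
  -- The frame vectors in `riemFlux` contain 1/u. Differentiating this factor along the flow (`hs`)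
  -- and along x (`hs'`) is what produces the terms with `rho`.
  have hs : (flow (pointFlux f) q y).1
      = (M.m₂ * X.x₂ - M.m₁ * X.x₁) / (q y).1 := by
    rw [flow_pointFlux hΩ h.smooth hq hy, h.fderiv_apply hy, hX, hM]
    simp only [L1_apply, L2_apply, invJet, speedJet, xi1, xi2, jet]
  have hs' : (deriv q y).1 = (X.x₂ - X.x₁) / (q y).1 := by
    rw [hX]
    simp only [invJet, xi1, xi2, jet]
    field_simp
    ring
  have e : bracket (pointFlux f) (riemFlux c P₁ P₂) q y
      = fderiv ℝ f (q y) (driemFlux c P₁ P₂ (jet q y) (jet (deriv q) y))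
        - driemFlux c P₁ P₂ (jet q y) (jet (flow (pointFlux f) q) y) := by
    unfold bracket
    rw [fderiv_pointFlux hΩ h.smooth (by exact hy), fderiv_riemFlux hΩ hu h₁ h₂ (by exact hy)]
    simp only [jet, flow_riemFlux hu hΩ h₁ h₂ hq hy]
  have r1 : P₁.riem c (jet q y) = P₁.val (q y) X.x₁ X.x₂ X.n₁ X.n₂ := by rw [hX]; rfl
  have r2 : P₂.riem c (jet q y) = P₂.val (q y) X.x₁ X.x₂ X.n₁ X.n₂ := by rw [hX]; rfl
  have m1 : μ₁ (q y) = M.m₁ := by rw [hM]; rfl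
  have m2 : μ₂ (q y) = M.m₂ := by rw [hM]; rfl
  rw [e, h.fderiv_apply hy]
  simp only [driemFlux, driem_deriv, h.transport hΩ hu hq hy, ← hX, ← hM, r1, r2, m1, m2]
  have j1 : (jet q y).1.1 = (q y).1 := rfl
  have j2 : (jet (deriv q) y).1.1 = (X.x₂ - X.x₁) / (q y).1 := hs'
  have j3 : (jet (flow (pointFlux f) q) y).1.1
      = (M.m₂ * X.x₂ - M.m₁ * X.x₁) / (q y).1 := hs
  simp only [L1_apply, L2_apply, j1, j2, j3, Prod.fst_sub, Prod.snd_sub, rho]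
  generalize P₁.val (q y) X.x₁ X.x₂ X.n₁ X.n₂ = V₁
  generalize P₂.val (q y) X.x₁ X.x₂ X.n₁ X.n₂ = V₂
  generalize P₁.dotX c (q y) X = X₁
  generalize P₂.dotX c (q y) X = X₂
  generalize P₁.dotT c (q y) X M = T₁
  generalize P₂.dotT c (q y) X M = T₂
  constructor
  · field_simp
    ring
  · field_simp
    ring

/-- Only jets over `Ω` matter, since `Ω` is open and both ingredients of the bracket are local. The
passage to the Riemann frame is valid only there. -/
lemma obstruction_congr (hΩ : IsOpen Ω) {f : ℝ × ℝ → ℝ × ℝ} {G G' H H' : Jet → ℝ × ℝ}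
    (hG : Set.EqOn G G' (jetDomain Ω)) (hH : Set.EqOn H H' (jetDomain Ω)) {q : Curve}
    (hq : ContDiff ℝ ∞ q) {y : ℝ} (hy : q y ∈ Ω) :
    obstruction c f G H q y = obstruction c f G' H' q y := by
  have e : ∀ {K K' : Jet → ℝ × ℝ}, Set.EqOn K K' (jetDomain Ω) →
      fderiv ℝ K (jet q y) = fderiv ℝ K' (jet q y) ∧
      jet (flow K q) y = jet (flow K' q) y := by
    intro K K' hK
    refine ⟨(hK.eventuallyEq_of_mem ((isOpen_jetDomain hΩ).mem_nhds hy)).fderiv_eq,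
      jet_congr (Filter.EventuallyEq.deriv ?_)⟩
    filter_upwards [eventually_mem hΩ hq.contDiffAt hy] with z hz
    exact hK hz
  simp only [obstruction, bracket, (e hG).1, (e hG).2, (e hH).1, (e hH).2]

/-- The obstruction vanishes exactly if its components in the Riemann frame do. -/
lemma obstruction_riemFlux (hΩ : IsOpen Ω) (hu : ∀ p ∈ Ω, p.1 ≠ 0) {f : ℝ × ℝ → ℝ × ℝ}
    {μ₁ μ₂ : ℝ × ℝ → ℝ} (h : IsDiagonal c Ω f μ₁ μ₂) {A₁ A₂ E₁ E₂ : Poly2}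
    (hA₁ : A₁.SmoothOn Ω) (hA₂ : A₂.SmoothOn Ω) (hE₁ : E₁.SmoothOn Ω) (hE₂ : E₂.SmoothOn Ω)
    {q : Curve} (hq : ContDiff ℝ ∞ q) {y : ℝ} (hy : q y ∈ Ω) :
    obstruction c f (riemFlux c A₁ A₂) (riemFlux c E₁ E₂) q y = 0 ↔
      Z1 c A₁ A₂ E₁ E₂ (q y) (invJet c q y) (speedJet (fun p => -(2 * (c + 1) * p.1))
        (fun p => -((2 * c + 1) * p.1)) q y) (speedJet μ₁ μ₂ q y) = 0 ∧
      Z2 c A₁ A₂ E₁ E₂ (q y) (invJet c q y) (speedJet (fun p => -(2 * (c + 1) * p.1))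
        (fun p => -((2 * c + 1) * p.1)) q y) (speedJet μ₁ μ₂ q y) = 0 := by
  have a := bracket_riemFlux hΩ hu (isDiagonal_primaryFlux (c := c) hu) hE₁ hE₂ hq hy _ rfl _ rfl
  have b := bracket_riemFlux hΩ hu h hA₁ hA₂ hq hy _ rfl _ rfl
  set O := obstruction c f (riemFlux c A₁ A₂) (riemFlux c E₁ E₂) q y with hO
  have hO' : O = bracket (pointFlux (primaryFlux c)) (riemFlux c E₁ E₂) q y
      - bracket (pointFlux f) (riemFlux c A₁ A₂) q y := by
    rw [hO, obstruction, bracket_antisymm (riemFlux c A₁ A₂)]; abel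
  have k1 := congrArg (L1 c (q y)) hO'
  have k2 := congrArg (L2 c (q y)) hO'
  rw [map_sub, a.1, b.1] at k1
  rw [map_sub, a.2, b.2] at k2
  -- `L1` − `L2` is −u du, so with u ≠ 0 the two components determine the vector.
  have s : O = 0 ↔ L1 c (q y) O = 0 ∧ L2 c (q y) O = 0 := by
    constructor
    · intro h0; simp [h0]
    · rintro ⟨h1, h2⟩
      simp only [L1_apply, L2_apply] at h1 h2
      have h3 : (q y).1 * O.1 = 0 := by linarith
      have h4 := (mul_eq_zero.1 h3).resolve_left (hu _ hy)
      rw [h4] at h1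
      exact Prod.ext h4 (by simpa using h1)
  rw [s, k1, k2]
  unfold Z1 Z2
  constructor
  · rintro ⟨h1, h2⟩
    exact ⟨by linarith, by linarith⟩
  · rintro ⟨h1, h2⟩
    exact ⟨by linarith, by linarith⟩

end

/-! ### Commuting derivatives and the speeds of symmetries -/

section Commute

variable {c : ℝ} {Ω : Set (ℝ × ℝ)} {g : ℝ × ℝ → ℝ}

lemma contDiffOn_fderiv_apply (hΩ : IsOpen Ω) (hg : ContDiffOn ℝ ∞ g Ω) {w : ℝ × ℝ → ℝ × ℝ}
    (hw : ContDiffOn ℝ ∞ w Ω) : ContDiffOn ℝ ∞ (fun p => fderiv ℝ g p (w p)) Ω :=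
  (hg.fderiv_of_isOpen hΩ (by simp)).clm_apply hw

lemma contDiffOn_inv_fst (hu : ∀ p ∈ Ω, p.1 ≠ 0) (k : ℝ) :
    ContDiffOn ℝ ∞ (fun p : ℝ × ℝ => k / p.1) Ω :=
  contDiffOn_const.div contDiffOn_fst hu

lemma contDiffOn_D1 (hΩ : IsOpen Ω) (hu : ∀ p ∈ Ω, p.1 ≠ 0) (hg : ContDiffOn ℝ ∞ g Ω) :
    ContDiffOn ℝ ∞ (D1 c g) Ω :=
  contDiffOn_fderiv_apply hΩ hg ((contDiffOn_inv_fst hu _).prodMk contDiffOn_const)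

lemma contDiffOn_D2 (hΩ : IsOpen Ω) (hu : ∀ p ∈ Ω, p.1 ≠ 0) (hg : ContDiffOn ℝ ∞ g Ω) :
    ContDiffOn ℝ ∞ (D2 c g) Ω :=
  contDiffOn_fderiv_apply hΩ hg ((contDiffOn_inv_fst hu _).prodMk contDiffOn_const)

lemma hasD_of_contDiffOn (hΩ : IsOpen Ω) (hu : ∀ p ∈ Ω, p.1 ≠ 0) (hg : ContDiffOn ℝ ∞ g Ω)
    {p : ℝ × ℝ} (hp : p ∈ Ω) : HasD c g p (D1 c g p) (D2 c g p) :=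
  hasD_of_differentiableAt (hu p hp)
    ((eventually_contDiffAt_infty hΩ hg hp).differentiableAt (by simp))

/-- Derivatives in the Riemann invariants commute. -/
lemma D2_D1 (hΩ : IsOpen Ω) (hu : ∀ p ∈ Ω, p.1 ≠ 0) (hg : ContDiffOn ℝ ∞ g Ω) {p : ℝ × ℝ}
    (hp : p ∈ Ω) : D2 c (D1 c g) p = D1 c (D2 c g) p := by
  have hgp := eventually_contDiffAt_infty hΩ hg hp
  have hf : HasFDerivAt (fderiv ℝ g) (fderiv ℝ (fderiv ℝ g) p) p :=
    ((hgp.fderiv_right (m := ∞) (by simp)).differentiableAt (by simp)).hasFDerivAt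
  have hp' := hu p hp
  have k : ∀ a b : ℝ, HasFDerivAt (fun x : ℝ × ℝ => ((a / x.1, b) : ℝ × ℝ))
      ((-a / p.1 ^ 2) • (ContinuousLinearMap.fst ℝ ℝ ℝ).prod (0 : ℝ × ℝ →L[ℝ] ℝ)) p := by
    intro a b
    have h1 : HasDerivAt (fun t : ℝ => a / t) (-a / p.1 ^ 2) p.1 := by
      have := (hasDerivAt_inv hp').const_mul a
      refine (this.congr_of_eventuallyEq (Eventually.of_forall fun t => ?_)).congr_deriv ?_
      · simp [div_eq_mul_inv]
      · field_simp
    have h2 := h1.comp_hasFDerivAt p (hasFDerivAt_fst (𝕜 := ℝ) (p := p))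
    refine (h2.prodMk (hasFDerivAt_const b p)).congr_fderiv ?_
    ext <;> simp
  have sym : IsSymmSndFDerivAt ℝ g p := hgp.isSymmSndFDerivAt (by simpa using two_le_infty)
  have e1 := (hf.clm_apply (k (-1) (-(2 * c + 1)))).fderiv
  have e2 := (hf.clm_apply (k 1 (2 * (c + 1)))).fderiv
  have s := sym (1 / p.1, 2 * (c + 1)) (-1 / p.1, -(2 * c + 1))
  have l1 : D2 c (D1 c g) p
      = fderiv ℝ (fun x => fderiv ℝ g x (-1 / x.1, -(2 * c + 1))) p (1 / p.1, 2 * (c + 1)) := rfl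
  have l2 : D1 c (D2 c g) p
      = fderiv ℝ (fun x => fderiv ℝ g x (1 / x.1, 2 * (c + 1))) p (-1 / p.1, -(2 * c + 1)) := rfl
  rw [l1, l2, e1, e2]
  simp only [add_apply, ContinuousLinearMap.comp_apply, ContinuousLinearMap.flip_apply,
    smul_apply, ContinuousLinearMap.prod_apply, ContinuousLinearMap.coe_fst',
    zero_apply]
  rw [s]
  -- The second derivatives of `g` agree by symmetry. What remains is the Lie bracket of the two
  -- coordinate fields, and it vanishes: each field maps the other's coefficient ∓1/u to the same
  -- value 1/u³.
  have : (-(-1 : ℝ) / p.1 ^ 2) • ((1 / p.1, (0 : ℝ)) : ℝ × ℝ)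
      = (-1 / p.1 ^ 2) • ((-1 / p.1, (0 : ℝ)) : ℝ × ℝ) := by
    ext
    · simp only [Prod.smul_fst, smul_eq_mul]; ring
    · simp
  rw [this]

end Commute

/-- A pair of functions satisfying the equations of characteristic speeds of symmetries. -/
structure IsSpeedPair (c : ℝ) (Ω : Set (ℝ × ℝ)) (μ₁ μ₂ : ℝ × ℝ → ℝ) : Prop where
  smooth₁ : ContDiffOn ℝ ∞ μ₁ Ω
  smooth₂ : ContDiffOn ℝ ∞ μ₂ Ω
  d2 : ∀ p ∈ Ω, D2 c μ₁ p = 2 * (c + 1) * (rho p * (μ₁ p - μ₂ p))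
  d1 : ∀ p ∈ Ω, D1 c μ₂ p = -(2 * c + 1) * (rho p * (μ₁ p - μ₂ p))

section Gap

variable (c : ℝ) (μ₁ μ₂ : ℝ × ℝ → ℝ)

/-- `(μ₁ - μ₂) / u ^ 2`. -/
def gap (p : ℝ × ℝ) : ℝ := rho p * (μ₁ p - μ₂ p)

/-- First derivative of `gap` in the first Riemann invariant. -/
def gap1 (p : ℝ × ℝ) : ℝ := 2 * rho p * gap μ₁ μ₂ p + rho p * (D1 c μ₁ p + (2 * c + 1) * gap μ₁ μ₂ p)

/-- First derivative of `gap` in the second Riemann invariant. -/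
def gap2 (p : ℝ × ℝ) : ℝ :=
  -2 * rho p * gap μ₁ μ₂ p + rho p * (2 * (c + 1) * gap μ₁ μ₂ p - D2 c μ₂ p)

/-- Second derivative of `gap`. -/
def gap11 (p : ℝ × ℝ) : ℝ :=
  4 * rho p ^ 2 * gap μ₁ μ₂ p + 2 * rho p * gap1 c μ₁ μ₂ p
    + 2 * rho p ^ 2 * (D1 c μ₁ p + (2 * c + 1) * gap μ₁ μ₂ p)
    + rho p * (D1 c (D1 c μ₁) p + (2 * c + 1) * gap1 c μ₁ μ₂ p)

/-- Mixed second derivative of `gap`. -/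
def gap12 (p : ℝ × ℝ) : ℝ :=
  -4 * rho p ^ 2 * gap μ₁ μ₂ p + 2 * rho p * gap2 c μ₁ μ₂ p
    - 2 * rho p ^ 2 * (D1 c μ₁ p + (2 * c + 1) * gap μ₁ μ₂ p)
    + rho p * (2 * (c + 1) * gap1 c μ₁ μ₂ p + (2 * c + 1) * gap2 c μ₁ μ₂ p)

/-- Second derivative of `gap`. -/
def gap22 (p : ℝ × ℝ) : ℝ :=
  4 * rho p ^ 2 * gap μ₁ μ₂ p - 2 * rho p * gap2 c μ₁ μ₂ p
    - 2 * rho p ^ 2 * (2 * (c + 1) * gap μ₁ μ₂ p - D2 c μ₂ p)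
    + rho p * (2 * (c + 1) * gap2 c μ₁ μ₂ p - D2 c (D2 c μ₂) p)

end Gap

section SpeedPair

variable {c : ℝ} {Ω : Set (ℝ × ℝ)} {μ₁ μ₂ : ℝ × ℝ → ℝ} {p : ℝ × ℝ}

lemma contDiffOn_rho (hu : ∀ p ∈ Ω, p.1 ≠ 0) : ContDiffOn ℝ ∞ rho Ω :=
  contDiffOn_const.div (contDiffOn_fst.pow 2) fun p hp => pow_ne_zero 2 (hu p hp)

lemma IsSpeedPair.hasD_fst (h : IsSpeedPair c Ω μ₁ μ₂) (hΩ : IsOpen Ω) (hu : ∀ p ∈ Ω, p.1 ≠ 0)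
    (hp : p ∈ Ω) : HasD c μ₁ p (D1 c μ₁ p) (2 * (c + 1) * gap μ₁ μ₂ p) :=
  (hasD_of_contDiffOn hΩ hu h.smooth₁ hp).congr rfl (h.d2 p hp)

lemma IsSpeedPair.hasD_snd (h : IsSpeedPair c Ω μ₁ μ₂) (hΩ : IsOpen Ω) (hu : ∀ p ∈ Ω, p.1 ≠ 0)
    (hp : p ∈ Ω) : HasD c μ₂ p (-(2 * c + 1) * gap μ₁ μ₂ p) (D2 c μ₂ p) :=
  (hasD_of_contDiffOn hΩ hu h.smooth₂ hp).congr (h.d1 p hp) rfl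

lemma IsSpeedPair.hasD_gap (h : IsSpeedPair c Ω μ₁ μ₂) (hΩ : IsOpen Ω) (hu : ∀ p ∈ Ω, p.1 ≠ 0)
    (hp : p ∈ Ω) : HasD c (gap μ₁ μ₂) p (gap1 c μ₁ μ₂ p) (gap2 c μ₁ μ₂ p) := by
  refine ((hasD_rho (hu p hp)).mul ((h.hasD_fst hΩ hu hp).sub (h.hasD_snd hΩ hu hp))).congr ?_ ?_
  · simp only [gap1, gap]; ring
  · simp only [gap2, gap]; ring

lemma IsSpeedPair.contDiffOn_gap (h : IsSpeedPair c Ω μ₁ μ₂) (hu : ∀ p ∈ Ω, p.1 ≠ 0) :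
    ContDiffOn ℝ ∞ (gap μ₁ μ₂) Ω :=
  (contDiffOn_rho hu).mul (h.smooth₁.sub h.smooth₂)

/-- A prescribed first derivative determines the mixed one after commuting `D1` and `D2`. Repeated
use closes the system `IsSpeedPair`: only the pure derivatives of μ₁ in r₁ and of μ₂ in r₂ remain
free. -/
lemma D2_D1_of_eqOn (hΩ : IsOpen Ω) (hu : ∀ p ∈ Ω, p.1 ≠ 0) {g h : ℝ × ℝ → ℝ} {a b : ℝ}
    (hg : ContDiffOn ℝ ∞ g Ω) (e : ∀ p ∈ Ω, D2 c g p = h p) (hp : p ∈ Ω) (hh : HasD c h p a b) :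
    D2 c (D1 c g) p = a := by
  rw [D2_D1 hΩ hu hg hp]
  exact (hh.congr_fun (eventually_of_mem (hΩ.mem_nhds hp) e)).d1 (hu p hp)

lemma D1_D2_of_eqOn (hΩ : IsOpen Ω) (hu : ∀ p ∈ Ω, p.1 ≠ 0) {g h : ℝ × ℝ → ℝ} {a b : ℝ}
    (hg : ContDiffOn ℝ ∞ g Ω) (e : ∀ p ∈ Ω, D1 c g p = h p) (hp : p ∈ Ω) (hh : HasD c h p a b) :
    D1 c (D2 c g) p = b := by
  rw [← D2_D1 hΩ hu hg hp]
  exact (hh.congr_fun (eventually_of_mem (hΩ.mem_nhds hp) e)).d2 (hu p hp)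

lemma IsSpeedPair.hasD_D1 (h : IsSpeedPair c Ω μ₁ μ₂) (hΩ : IsOpen Ω) (hu : ∀ p ∈ Ω, p.1 ≠ 0)
    (hp : p ∈ Ω) :
    HasD c (D1 c μ₁) p (D1 c (D1 c μ₁) p) (2 * (c + 1) * gap1 c μ₁ μ₂ p) :=
  (hasD_of_contDiffOn hΩ hu (contDiffOn_D1 hΩ hu h.smooth₁) hp).congr rfl
    (D2_D1_of_eqOn hΩ hu h.smooth₁ h.d2 hp ((h.hasD_gap hΩ hu hp).const_mul _))

lemma IsSpeedPair.hasD_D2 (h : IsSpeedPair c Ω μ₁ μ₂) (hΩ : IsOpen Ω) (hu : ∀ p ∈ Ω, p.1 ≠ 0)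
    (hp : p ∈ Ω) :
    HasD c (D2 c μ₂) p (-(2 * c + 1) * gap2 c μ₁ μ₂ p) (D2 c (D2 c μ₂) p) :=
  (hasD_of_contDiffOn hΩ hu (contDiffOn_D2 hΩ hu h.smooth₂) hp).congr
    (D1_D2_of_eqOn hΩ hu h.smooth₂ h.d1 hp ((h.hasD_gap hΩ hu hp).const_mul _)) rfl

lemma IsSpeedPair.hasD_gap1 (h : IsSpeedPair c Ω μ₁ μ₂) (hΩ : IsOpen Ω) (hu : ∀ p ∈ Ω, p.1 ≠ 0)
    (hp : p ∈ Ω) : HasD c (gap1 c μ₁ μ₂) p (gap11 c μ₁ μ₂ p) (gap12 c μ₁ μ₂ p) := by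
  have hr := hasD_rho (c := c) (hu p hp)
  have hg := h.hasD_gap hΩ hu hp
  refine (((hr.const_mul 2).mul hg).add (hr.mul ((h.hasD_D1 hΩ hu hp).add
    (hg.const_mul (2 * c + 1))))).congr ?_ ?_
  · simp only [gap11]; ring
  · simp only [gap12]; ring

lemma IsSpeedPair.hasD_gap2 (h : IsSpeedPair c Ω μ₁ μ₂) (hΩ : IsOpen Ω) (hu : ∀ p ∈ Ω, p.1 ≠ 0)
    (hp : p ∈ Ω) : HasD c (gap2 c μ₁ μ₂) p (gap12 c μ₁ μ₂ p) (gap22 c μ₁ μ₂ p) := by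
  have hr := hasD_rho (c := c) (hu p hp)
  have hg := h.hasD_gap hΩ hu hp
  refine (((hr.const_mul (-2)).mul hg).add (hr.mul ((hg.const_mul (2 * (c + 1))).sub
    (h.hasD_D2 hΩ hu hp)))).congr ?_ ?_
  · simp only [gap12, gap1, gap2, gap]; ring
  · simp only [gap22]; ring

lemma IsSpeedPair.hasD_D1D1 (h : IsSpeedPair c Ω μ₁ μ₂) (hΩ : IsOpen Ω) (hu : ∀ p ∈ Ω, p.1 ≠ 0)
    (hp : p ∈ Ω) : HasD c (D1 c (D1 c μ₁)) p (D1 c (D1 c (D1 c μ₁)) p)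
      (2 * (c + 1) * gap11 c μ₁ μ₂ p) := by
  have hs := contDiffOn_D1 (c := c) hΩ hu h.smooth₁
  exact (hasD_of_contDiffOn hΩ hu (contDiffOn_D1 hΩ hu hs) hp).congr rfl
    (D2_D1_of_eqOn hΩ hu hs (fun x hx => (h.hasD_D1 hΩ hu hx).d2 (hu x hx)) hp
      ((h.hasD_gap1 hΩ hu hp).const_mul _))

lemma IsSpeedPair.hasD_D2D2 (h : IsSpeedPair c Ω μ₁ μ₂) (hΩ : IsOpen Ω) (hu : ∀ p ∈ Ω, p.1 ≠ 0)
    (hp : p ∈ Ω) : HasD c (D2 c (D2 c μ₂)) p (-(2 * c + 1) * gap22 c μ₁ μ₂ p)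
      (D2 c (D2 c (D2 c μ₂)) p) := by
  have hs := contDiffOn_D2 (c := c) hΩ hu h.smooth₂
  exact (hasD_of_contDiffOn hΩ hu (contDiffOn_D2 hΩ hu hs) hp).congr
    (D1_D2_of_eqOn hΩ hu hs (fun x hx => (h.hasD_D2 hΩ hu hx).d1 (hu x hx)) hp
      ((h.hasD_gap2 hΩ hu hp).const_mul _)) rfl

/-- Speeds along a configuration, expressed by the jets of the Riemann invariants. -/
def speedNum (c : ℝ) (μ₁ μ₂ : ℝ × ℝ → ℝ) (p : ℝ × ℝ) (X : InvJet) : SpeedJet where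
  m₁ := μ₁ p
  dm₁ := D1 c μ₁ p * X.x₁ + 2 * (c + 1) * gap μ₁ μ₂ p * X.x₂
  ddm₁ := D1 c (D1 c μ₁) p * X.x₁ ^ 2 + 4 * (c + 1) * gap1 c μ₁ μ₂ p * (X.x₁ * X.x₂)
    + 2 * (c + 1) * gap2 c μ₁ μ₂ p * X.x₂ ^ 2
    + D1 c μ₁ p * X.n₁ + 2 * (c + 1) * gap μ₁ μ₂ p * X.n₂
  m₂ := μ₂ p
  dm₂ := -(2 * c + 1) * gap μ₁ μ₂ p * X.x₁ + D2 c μ₂ p * X.x₂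
  ddm₂ := -(2 * c + 1) * gap1 c μ₁ μ₂ p * X.x₁ ^ 2
    - 2 * (2 * c + 1) * gap2 c μ₁ μ₂ p * (X.x₁ * X.x₂) + D2 c (D2 c μ₂) p * X.x₂ ^ 2
    - (2 * c + 1) * gap μ₁ μ₂ p * X.n₁ + D2 c μ₂ p * X.n₂

lemma HasD.along {g : ℝ × ℝ → ℝ} {a b : ℝ} {q : Curve} (hq : ContDiff ℝ ∞ q) {y : ℝ}
    (hg : HasD c g (q y) a b) : HasDerivAt (fun z => g (q z))
      (a * xi1 c (jet q y) + b * xi2 c (jet q y)) y := by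
  have := HasD.comp_hasDerivAt hg (hasDerivAt_of_contDiffAt hq.contDiffAt)
  simpa [xi1, xi2, jet] using this

lemma IsSpeedPair.speedJet_eq (h : IsSpeedPair c Ω μ₁ μ₂) (hΩ : IsOpen Ω)
    (hu : ∀ p ∈ Ω, p.1 ≠ 0) {q : Curve} (hq : ContDiff ℝ ∞ q) {y : ℝ} (hy : q y ∈ Ω) :
    speedJet μ₁ μ₂ q y = speedNum c μ₁ μ₂ (q y) (invJet c q y) := by
  have ev := eventually_mem hΩ hq.contDiffAt hy
  have e1 : (deriv fun z => μ₁ (q z)) =ᶠ[𝓝 y] fun z =>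
      D1 c μ₁ (q z) * xi1 c (jet q z) + 2 * (c + 1) * gap μ₁ μ₂ (q z) * xi2 c (jet q z) := by
    filter_upwards [ev] with z hz
    exact ((h.hasD_fst hΩ hu hz).along hq).deriv
  have e2 : (deriv fun z => μ₂ (q z)) =ᶠ[𝓝 y] fun z =>
      -(2 * c + 1) * gap μ₁ μ₂ (q z) * xi1 c (jet q z) + D2 c μ₂ (q z) * xi2 c (jet q z) := by
    filter_upwards [ev] with z hz
    exact ((h.hasD_snd hΩ hu hz).along hq).deriv
  have x1 := hasDerivAt_xi1_jet (c := c) (hq.contDiffAt (x := y))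
  have x2 := hasDerivAt_xi2_jet (c := c) (hq.contDiffAt (x := y))
  have g := (h.hasD_gap hΩ hu hy).along hq
  have f1 := ((((h.hasD_D1 hΩ hu hy).along hq).mul x1).add ((g.const_mul (2 * (c + 1))).mul x2)).deriv
  have f2 := (((g.const_mul (-(2 * c + 1))).mul x1).add (((h.hasD_D2 hΩ hu hy).along hq).mul x2)).deriv
  simp only [speedJet, speedNum, e1.deriv_eq, e2.deriv_eq, e1.eq_of_nhds, e2.eq_of_nhds, invJet]
  congr 1
  · refine f1.trans ?_
    ring
  · refine f2.trans ?_
    ring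

end SpeedPair

/-! ### The canonical and the Miura-generated families -/

section Families

variable (c : ℝ)

/-- First component of the canonical deformation of the diagonal flow with speeds `μ₁`, `μ₂`. -/
def canon₁ (φ₁ φ₂ μ₁ μ₂ : ℝ × ℝ → ℝ) : Poly2 where
  uxx p := 2 * (φ₁ p * D1 c μ₁ p)
  vxx p := 2 * (c + 1) * (gap μ₁ μ₂ p * (φ₁ p - φ₂ p))
  uxux p := φ₁ p * D1 c (D1 c μ₁) p
  vxvx p := 2 * (c + 1) * (φ₁ p * gap2 c μ₁ μ₂ p)
  uxvx p := 4 * (c + 1) * (φ₁ p * gap1 c μ₁ μ₂ p)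

/-- Second component of the canonical deformation. -/
def canon₂ (φ₁ φ₂ μ₁ μ₂ : ℝ × ℝ → ℝ) : Poly2 where
  uxx p := (2 * c + 1) * (gap μ₁ μ₂ p * (φ₁ p - φ₂ p))
  vxx p := 2 * (φ₂ p * D2 c μ₂ p)
  uxux p := -(2 * c + 1) * (φ₂ p * gap1 c μ₁ μ₂ p)
  vxvx p := φ₂ p * D2 c (D2 c μ₂) p
  uxvx p := -(2 * (2 * c + 1)) * (φ₂ p * gap2 c μ₁ μ₂ p)

/-- First component of the deformation generated by the Miura transformation with coefficients
`β`. -/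
def gauge₁ (β₁₁ β₁₂ β₂₁ β₂₂ μ₁ μ₂ : ℝ × ℝ → ℝ) : Poly2 where
  uxx _ := 0
  vxx p := -(β₁₂ p * (μ₁ p - μ₂ p))
  uxux p := β₁₁ p * D1 c μ₁ p
  vxvx p := β₁₂ p * D2 c μ₂ p - (μ₁ p - μ₂ p) * D2 c β₁₂ p
    + 2 * (c + 1) * (gap μ₁ μ₂ p * (β₁₂ p - β₂₂ p))
  uxvx p := 2 * (c + 1) * (gap μ₁ μ₂ p * β₁₁ p) - (2 * c + 1) * (gap μ₁ μ₂ p * β₁₂ p)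
    - (μ₁ p - μ₂ p) * D2 c β₁₁ p + 2 * (c + 1) * (gap μ₁ μ₂ p * (β₁₁ p - β₂₁ p))

/-- Second component of the deformation generated by the Miura transformation with coefficients
`β`. -/
def gauge₂ (β₁₁ β₁₂ β₂₁ β₂₂ μ₁ μ₂ : ℝ × ℝ → ℝ) : Poly2 where
  uxx p := β₂₁ p * (μ₁ p - μ₂ p)
  vxx _ := 0
  uxux p := β₂₁ p * D1 c μ₁ p + (μ₁ p - μ₂ p) * D1 c β₂₁ p
    + (2 * c + 1) * (gap μ₁ μ₂ p * (β₁₁ p - β₂₁ p))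
  vxvx p := β₂₂ p * D2 c μ₂ p
  uxvx p := 2 * (c + 1) * (gap μ₁ μ₂ p * β₂₁ p) - (2 * c + 1) * (gap μ₁ μ₂ p * β₂₂ p)
    + (μ₁ p - μ₂ p) * D1 c β₂₂ p + (2 * c + 1) * (gap μ₁ μ₂ p * (β₁₂ p - β₂₂ p))

end Families

/-- The gradients of all coefficients of `P` at `p` are those listed in `A` and `B`. -/
structure Poly2.HasGrad (c : ℝ) (P : Poly2) (p : ℝ × ℝ) (a₁ b₁ a₂ b₂ a₃ b₃ a₄ b₄ a₅ b₅ : ℝ) :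
    Prop where
  uxx : HasD c P.uxx p a₁ b₁
  vxx : HasD c P.vxx p a₂ b₂
  uxux : HasD c P.uxux p a₃ b₃
  vxvx : HasD c P.vxvx p a₄ b₄
  uxvx : HasD c P.uxvx p a₅ b₅

lemma Poly2.HasGrad.dot_eq {c : ℝ} {P : Poly2} {p : ℝ × ℝ} (hp : p.1 ≠ 0)
    {a₁ b₁ a₂ b₂ a₃ b₃ a₄ b₄ a₅ b₅ : ℝ} (h : P.HasGrad c p a₁ b₁ a₂ b₂ a₃ b₃ a₄ b₄ a₅ b₅)
    (x₁ x₂ n₁ n₂ s₁ s₂ t₁ t₂ r₁ r₂ : ℝ) :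
    P.dot c p x₁ x₂ n₁ n₂ s₁ s₂ t₁ t₂ r₁ r₂ =
      (a₁ * s₁ + b₁ * s₂) * n₁ + P.uxx p * r₁ + ((a₂ * s₁ + b₂ * s₂) * n₂ + P.vxx p * r₂)
      + ((a₃ * s₁ + b₃ * s₂) * x₁ ^ 2 + P.uxux p * (2 * x₁ * t₁))
      + ((a₄ * s₁ + b₄ * s₂) * x₂ ^ 2 + P.vxvx p * (2 * x₂ * t₂))
      + ((a₅ * s₁ + b₅ * s₂) * (x₁ * x₂) + P.uxvx p * (t₁ * x₂ + x₁ * t₂)) := by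
  simp only [Poly2.dot, h.uxx.d1 hp, h.uxx.d2 hp, h.vxx.d1 hp, h.vxx.d2 hp, h.uxux.d1 hp,
    h.uxux.d2 hp, h.vxvx.d1 hp, h.vxvx.d2 hp, h.uxvx.d1 hp, h.uxvx.d2 hp]

section

variable {c : ℝ} {Ω : Set (ℝ × ℝ)} {p : ℝ × ℝ}

/-- The equations on the functional parameters of canonical deformations. -/
structure IsParameterPair (c : ℝ) (Ω : Set (ℝ × ℝ)) (φ₁ φ₂ : ℝ × ℝ → ℝ) : Prop where
  smooth₁ : ContDiffOn ℝ ∞ φ₁ Ω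
  smooth₂ : ContDiffOn ℝ ∞ φ₂ Ω
  d2 : ∀ p ∈ Ω, D2 c φ₁ p = 4 * (c + 1) * rho p * φ₁ p
  d1 : ∀ p ∈ Ω, D1 c φ₂ p = 2 * (2 * c + 1) * rho p * φ₂ p

lemma IsParameterPair.hasD_fst {φ₁ φ₂ : ℝ × ℝ → ℝ} (h : IsParameterPair c Ω φ₁ φ₂)
    (hΩ : IsOpen Ω) (hu : ∀ p ∈ Ω, p.1 ≠ 0) (hp : p ∈ Ω) :
    HasD c φ₁ p (D1 c φ₁ p) (4 * (c + 1) * rho p * φ₁ p) :=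
  (hasD_of_contDiffOn hΩ hu h.smooth₁ hp).congr rfl (h.d2 p hp)

lemma IsParameterPair.hasD_snd {φ₁ φ₂ : ℝ × ℝ → ℝ} (h : IsParameterPair c Ω φ₁ φ₂)
    (hΩ : IsOpen Ω) (hu : ∀ p ∈ Ω, p.1 ≠ 0) (hp : p ∈ Ω) :
    HasD c φ₂ p (2 * (2 * c + 1) * rho p * φ₂ p) (D2 c φ₂ p) :=
  (hasD_of_contDiffOn hΩ hu h.smooth₂ hp).congr (h.d1 p hp) rfl

/-- For {i, j} = {1, 2} the canonical component i is φᵢ ∂ₓ²μᵢ + φᵢ ∂ᵢμᵢ rᵢ'' − φⱼ ∂ⱼμᵢ rⱼ'', which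
is linear in the speeds. The equations on φ₁, φ₂ are what makes the deformations built from two
speed pairs compatible. -/
lemma canon_obstruction {φ₁ φ₂ lam₁ lam₂ μ₁ μ₂ : ℝ × ℝ → ℝ} (hΩ : IsOpen Ω)
    (hu : ∀ p ∈ Ω, p.1 ≠ 0) (hφ : IsParameterPair c Ω φ₁ φ₂) (hl : IsSpeedPair c Ω lam₁ lam₂)
    (hm : IsSpeedPair c Ω μ₁ μ₂) (hp : p ∈ Ω) (X : InvJet) :
    Z1 c (canon₁ c φ₁ φ₂ lam₁ lam₂) (canon₂ c φ₁ φ₂ lam₁ lam₂) (canon₁ c φ₁ φ₂ μ₁ μ₂)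
      (canon₂ c φ₁ φ₂ μ₁ μ₂) p X (speedNum c lam₁ lam₂ p X) (speedNum c μ₁ μ₂ p X) = 0 ∧
    Z2 c (canon₁ c φ₁ φ₂ lam₁ lam₂) (canon₂ c φ₁ φ₂ lam₁ lam₂) (canon₁ c φ₁ φ₂ μ₁ μ₂)
      (canon₂ c φ₁ φ₂ μ₁ μ₂) p X (speedNum c lam₁ lam₂ p X) (speedNum c μ₁ μ₂ p X) = 0 := by
  have f1 := hφ.hasD_fst hΩ hu hp
  have f2 := hφ.hasD_snd hΩ hu hp
  have g1 : ∀ {μ₁ μ₂ : ℝ × ℝ → ℝ} (hm : IsSpeedPair c Ω μ₁ μ₂),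
      (canon₁ c φ₁ φ₂ μ₁ μ₂).HasGrad c p _ _ _ _ _ _ _ _ _ _ := fun hm =>
    ⟨(f1.mul (hm.hasD_D1 hΩ hu hp)).const_mul _,
      ((hm.hasD_gap hΩ hu hp).mul (f1.sub f2)).const_mul _,
      f1.mul (hm.hasD_D1D1 hΩ hu hp), (f1.mul (hm.hasD_gap2 hΩ hu hp)).const_mul _,
      (f1.mul (hm.hasD_gap1 hΩ hu hp)).const_mul _⟩
  have g2 : ∀ {μ₁ μ₂ : ℝ × ℝ → ℝ} (hm : IsSpeedPair c Ω μ₁ μ₂),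
      (canon₂ c φ₁ φ₂ μ₁ μ₂).HasGrad c p _ _ _ _ _ _ _ _ _ _ := fun hm =>
    ⟨((hm.hasD_gap hΩ hu hp).mul (f1.sub f2)).const_mul _,
      (f2.mul (hm.hasD_D2 hΩ hu hp)).const_mul _,
      (f2.mul (hm.hasD_gap1 hΩ hu hp)).const_mul _, f2.mul (hm.hasD_D2D2 hΩ hu hp),
      (f2.mul (hm.hasD_gap2 hΩ hu hp)).const_mul _⟩
  have e : ∀ ν₁ ν₂ : ℝ × ℝ → ℝ, gap ν₁ ν₂ p = rho p * (ν₁ p - ν₂ p) := fun _ _ => rfl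
  have hp1 := hu p hp
  simp only [Z1, Z2, Poly2.dotX, Poly2.dotT, (g1 hl).dot_eq hp1, (g1 hm).dot_eq hp1,
    (g2 hl).dot_eq hp1, (g2 hm).dot_eq hp1, Poly2.val, speedNum]
  -- Once the gradients are inserted and `gap` is unfolded, both components are polynomial
  -- identities in `rho`, the jets and the free derivatives.
  simp only [canon₁, canon₂, gap11, gap12, gap22, gap1, gap2, e]
  constructor <;> ring

/-- Conceptually this is the Jacobi identity: the deformations are brackets {G, F} and {G, f} with
one degree one flux G (see `bracket_riemFlux1`), and F commutes with f. The proof verifies it by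
expansion. -/
lemma gauge_obstruction {β₁₁ β₁₂ β₂₁ β₂₂ lam₁ lam₂ μ₁ μ₂ : ℝ × ℝ → ℝ} (hΩ : IsOpen Ω)
    (hu : ∀ p ∈ Ω, p.1 ≠ 0) (h₁₁ : ContDiffOn ℝ ∞ β₁₁ Ω) (h₁₂ : ContDiffOn ℝ ∞ β₁₂ Ω)
    (h₂₁ : ContDiffOn ℝ ∞ β₂₁ Ω) (h₂₂ : ContDiffOn ℝ ∞ β₂₂ Ω)
    (hl : IsSpeedPair c Ω lam₁ lam₂)
    (hm : IsSpeedPair c Ω μ₁ μ₂) (hp : p ∈ Ω) (X : InvJet) :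
    Z1 c (gauge₁ c β₁₁ β₁₂ β₂₁ β₂₂ lam₁ lam₂) (gauge₂ c β₁₁ β₁₂ β₂₁ β₂₂ lam₁ lam₂)
      (gauge₁ c β₁₁ β₁₂ β₂₁ β₂₂ μ₁ μ₂) (gauge₂ c β₁₁ β₁₂ β₂₁ β₂₂ μ₁ μ₂) p X
      (speedNum c lam₁ lam₂ p X) (speedNum c μ₁ μ₂ p X) = 0 ∧
    Z2 c (gauge₁ c β₁₁ β₁₂ β₂₁ β₂₂ lam₁ lam₂) (gauge₂ c β₁₁ β₁₂ β₂₁ β₂₂ lam₁ lam₂)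
      (gauge₁ c β₁₁ β₁₂ β₂₁ β₂₂ μ₁ μ₂) (gauge₂ c β₁₁ β₁₂ β₂₁ β₂₂ μ₁ μ₂) p X
      (speedNum c lam₁ lam₂ p X) (speedNum c μ₁ μ₂ p X) = 0 := by
  have b11 := hasD_of_contDiffOn (c := c) hΩ hu h₁₁ hp
  have b12 := hasD_of_contDiffOn (c := c) hΩ hu h₁₂ hp
  have b21 := hasD_of_contDiffOn (c := c) hΩ hu h₂₁ hp
  have b22 := hasD_of_contDiffOn (c := c) hΩ hu h₂₂ hp
  have d11 := hasD_of_contDiffOn (c := c) hΩ hu (contDiffOn_D2 (c := c) hΩ hu h₁₁) hp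
  have d12 := hasD_of_contDiffOn (c := c) hΩ hu (contDiffOn_D2 (c := c) hΩ hu h₁₂) hp
  have d21 := hasD_of_contDiffOn (c := c) hΩ hu (contDiffOn_D1 (c := c) hΩ hu h₂₁) hp
  have d22 := hasD_of_contDiffOn (c := c) hΩ hu (contDiffOn_D1 (c := c) hΩ hu h₂₂) hp
  have g1 : ∀ {μ₁ μ₂ : ℝ × ℝ → ℝ} (hm : IsSpeedPair c Ω μ₁ μ₂),
      (gauge₁ c β₁₁ β₁₂ β₂₁ β₂₂ μ₁ μ₂).HasGrad c p _ _ _ _ _ _ _ _ _ _ := fun hm =>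
    have m1 := hm.hasD_fst hΩ hu hp
    have m2 := hm.hasD_snd hΩ hu hp
    have g := hm.hasD_gap hΩ hu hp
    ⟨hasD_const 0, (b12.mul (m1.sub m2)).neg, b11.mul (hm.hasD_D1 hΩ hu hp),
      ((b12.mul (hm.hasD_D2 hΩ hu hp)).sub ((m1.sub m2).mul d12)).add
        ((g.mul (b12.sub b22)).const_mul _),
      ((((g.mul b11).const_mul _).sub ((g.mul b12).const_mul _)).sub ((m1.sub m2).mul d11)).add
        ((g.mul (b11.sub b21)).const_mul _)⟩
  have g2 : ∀ {μ₁ μ₂ : ℝ × ℝ → ℝ} (hm : IsSpeedPair c Ω μ₁ μ₂),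
      (gauge₂ c β₁₁ β₁₂ β₂₁ β₂₂ μ₁ μ₂).HasGrad c p _ _ _ _ _ _ _ _ _ _ := fun hm =>
    have m1 := hm.hasD_fst hΩ hu hp
    have m2 := hm.hasD_snd hΩ hu hp
    have g := hm.hasD_gap hΩ hu hp
    ⟨b21.mul (m1.sub m2), hasD_const 0,
      ((b21.mul (hm.hasD_D1 hΩ hu hp)).add ((m1.sub m2).mul d21)).add
        ((g.mul (b11.sub b21)).const_mul _), b22.mul (hm.hasD_D2 hΩ hu hp),
      ((((g.mul b21).const_mul _).sub ((g.mul b22).const_mul _)).add ((m1.sub m2).mul d22)).add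
        ((g.mul (b12.sub b22)).const_mul _)⟩
  have e : ∀ ν₁ ν₂ : ℝ × ℝ → ℝ, gap ν₁ ν₂ p = rho p * (ν₁ p - ν₂ p) := fun _ _ => rfl
  have hp1 := hu p hp
  simp only [Z1, Z2, Poly2.dotX, Poly2.dotT, (g1 hl).dot_eq hp1, (g1 hm).dot_eq hp1,
    (g2 hl).dot_eq hp1, (g2 hm).dot_eq hp1, Poly2.val, speedNum]
  simp only [gauge₁, gauge₂, gap1, gap2, e]
  constructor <;> ring

end

/-! ### Symmetries are diagonal in the Riemann invariants -/

section

variable {c : ℝ} {Ω : Set (ℝ × ℝ)}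

lemma isSpeedPair_primary (hu : ∀ p ∈ Ω, p.1 ≠ 0) :
    IsSpeedPair c Ω (fun p => -(2 * (c + 1) * p.1)) (fun p => -((2 * c + 1) * p.1)) where
  smooth₁ := by fun_prop
  smooth₂ := by fun_prop
  d2 p hp := by
    have h := hu p hp
    rw [(((hasD_fst h).const_mul (2 * (c + 1))).neg).d2 h]
    simp only [rho]
    field_simp
    ring
  d1 p hp := by
    have h := hu p hp
    rw [(((hasD_fst h).const_mul (2 * c + 1)).neg).d1 h]
    simp only [rho]
    field_simp
    ring

lemma IsDiagonal.isSpeedPair (hΩ : IsOpen Ω) (hu : ∀ p ∈ Ω, p.1 ≠ 0) {f : ℝ × ℝ → ℝ × ℝ}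
    {μ₁ μ₂ : ℝ × ℝ → ℝ} (h : IsDiagonal c Ω f μ₁ μ₂) : IsSpeedPair c Ω μ₁ μ₂ := by
  have main : ∀ p ∈ Ω, D2 c μ₁ p = 2 * (c + 1) * (rho p * (μ₁ p - μ₂ p)) ∧
      D1 c μ₂ p = -(2 * c + 1) * (rho p * (μ₁ p - μ₂ p)) := by
    intro p hp
    have hp1 := hu p hp
    have m1 := hasD_of_contDiffOn (c := c) hΩ hu h.smooth₁ hp
    have m2 := hasD_of_contDiffOn (c := c) hΩ hu h.smooth₂ hp
    have hi : HasD c (fun x => x.1⁻¹) p (1 / p.1 ^ 3) (-1 / p.1 ^ 3) := by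
      refine ((HasD.comp (g := fun x => x.1) (hasDerivAt_inv hp1) (hasD_fst hp1)).congr ?_ ?_)
      · field_simp
      · field_simp
    -- The mixed derivative of each component of `f` is computed in both orders. This yields two
    -- linear equations for D2 μ₁ and D1 μ₂, solved at the end.
    have s1 := D2_D1_of_eqOn (c := c) hΩ hu h.smooth.fst
      (fun x hx => (h.fst x hx).d2 (hu x hx)) hp (h := fun p => μ₂ p / p.1) (m2.mul hi)
    have s1' : D2 c (D1 c fun x => (f x).1) p = _ := ((m1.neg.mul hi).congr_fun
      (eventually_of_mem (hΩ.mem_nhds hp) fun x hx => (h.fst x hx).d1 (hu x hx))).d2 hp1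
    have s2 := D2_D1_of_eqOn (c := c) hΩ hu h.smooth.snd
      (fun x hx => (h.snd x hx).d2 (hu x hx)) hp (m2.const_mul (2 * (c + 1)))
    have s2' : D2 c (D1 c fun x => (f x).2) p = _ := ((m1.const_mul (-(2 * c + 1))).congr_fun
      (eventually_of_mem (hΩ.mem_nhds hp) fun x hx => (h.snd x hx).d1 (hu x hx))).d2 hp1
    have e1 := s1'.symm.trans s1
    have e2 := s2'.symm.trans s2
    have e1' : D2 c μ₁ p + D1 c μ₂ p = rho p * (μ₁ p - μ₂ p) := by
      simp only [rho]
      field_simp at e1 ⊢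
      linarith
    constructor
    · linear_combination 2 * (c + 1) * e1' + e2
    · linear_combination -(2 * c + 1) * e1' - e2
  exact ⟨h.smooth₁, h.smooth₂, fun p hp => (main p hp).1, fun p hp => (main p hp).2⟩

/-- A symmetry of the primary flow is diagonal in its Riemann invariants. -/
lemma IsDispersionlessSymmetry.exists_isDiagonal (hΩ : IsOpen Ω) (hu : ∀ p ∈ Ω, p.1 ≠ 0)
    {f : ℝ × ℝ → ℝ × ℝ} (hf : IsDispersionlessSymmetry c Ω f) :
    ∃ μ₁ μ₂, IsDiagonal c Ω f μ₁ μ₂ := by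
  obtain ⟨hs, hcomm⟩ := (isDispersionlessSymmetry_iff c hΩ f).1 hf
  -- `R₁` and `R₂` are eigenvectors of the primary Jacobian whose eigenvalues differ by ±u ≠ 0, so a
  -- Jacobian that commutes with it preserves both eigenlines.
  let R₁ : ℝ × ℝ → ℝ × ℝ := fun p => (-1 / p.1, -(2 * c + 1))
  let R₂ : ℝ × ℝ → ℝ × ℝ := fun p => (1 / p.1, 2 * (c + 1))
  let Y₁ : ℝ × ℝ → ℝ × ℝ := fun p => fderiv ℝ f p (R₁ p)
  let Y₂ : ℝ × ℝ → ℝ × ℝ := fun p => fderiv ℝ f p (R₂ p)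
  have hR₁ : ContDiffOn ℝ ∞ R₁ Ω := (contDiffOn_inv_fst hu _).prodMk contDiffOn_const
  have hR₂ : ContDiffOn ℝ ∞ R₂ Ω := (contDiffOn_inv_fst hu _).prodMk contDiffOn_const
  have hY₁ : ContDiffOn ℝ ∞ Y₁ Ω := (hs.fderiv_of_isOpen hΩ (by simp)).clm_apply hR₁
  have hY₂ : ContDiffOn ℝ ∞ Y₂ Ω := (hs.fderiv_of_isOpen hΩ (by simp)).clm_apply hR₂
  have hF := fun p hp X => (isDiagonal_primaryFlux (c := c) hu).fderiv_apply (p := p) hp X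
  have key : ∀ p ∈ Ω, L2 c p (Y₁ p) = 0 ∧ L1 c p (Y₂ p) = 0 := by
    intro p hp
    have hp1 := hu p hp
    have l1 : ∀ X, L1 c p (fderiv ℝ (primaryFlux c) p X) = -(2 * (c + 1) * p.1) * L1 c p X := by
      intro X
      rw [hF p hp]
      simp only [L1_apply, L2_apply]
      field_simp
      ring
    have l2 : ∀ X, L2 c p (fderiv ℝ (primaryFlux c) p X) = -((2 * c + 1) * p.1) * L2 c p X := by
      intro X
      rw [hF p hp]
      simp only [L1_apply, L2_apply]
      field_simp
      ring
    have r1 : fderiv ℝ (primaryFlux c) p (R₁ p) = (-(2 * (c + 1) * p.1)) • R₁ p := by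
      rw [hF p hp]
      simp only [L1_apply, L2_apply, R₁]
      ext
      · simp only [Prod.smul_mk, smul_eq_mul]; field_simp; ring
      · simp only [Prod.smul_mk, smul_eq_mul]; field_simp; ring
    have r2 : fderiv ℝ (primaryFlux c) p (R₂ p) = (-((2 * c + 1) * p.1)) • R₂ p := by
      rw [hF p hp]
      simp only [L1_apply, L2_apply, R₂]
      ext
      · simp only [Prod.smul_mk, smul_eq_mul]; field_simp; ring
      · simp only [Prod.smul_mk, smul_eq_mul]; field_simp; ring
    constructor
    · have h := congrArg (L2 c p) (hcomm p hp (R₁ p))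
      rw [l2, r1, map_smul, map_smul, smul_eq_mul] at h
      have : p.1 * L2 c p (Y₁ p) = 0 := by
        simp only [Y₁]
        linear_combination h
      exact (mul_eq_zero.1 this).resolve_left hp1
    · have h := congrArg (L1 c p) (hcomm p hp (R₂ p))
      rw [l1, r2, map_smul, map_smul, smul_eq_mul] at h
      have : p.1 * L1 c p (Y₂ p) = 0 := by
        simp only [Y₂]
        linear_combination -h
      exact (mul_eq_zero.1 this).resolve_left hp1
  have hd : ∀ p ∈ Ω, DifferentiableAt ℝ f p := fun p hp =>
    (eventually_contDiffAt_infty hΩ hs hp).differentiableAt (by simp)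
  have c1 : ∀ p ∈ Ω, D1 c (fun x => (f x).1) p = (Y₁ p).1 ∧ D2 c (fun x => (f x).1) p = (Y₂ p).1 ∧
      D1 c (fun x => (f x).2) p = (Y₁ p).2 ∧ D2 c (fun x => (f x).2) p = (Y₂ p).2 := by
    intro p hp
    simp only [D1, D2, (hd p hp).hasFDerivAt.fst.fderiv, (hd p hp).hasFDerivAt.snd.fderiv]
    exact ⟨rfl, rfl, rfl, rfl⟩
  -- Y₁ = μ₁ R₁ and Y₂ = μ₂ R₂, where the first components of R₁ and R₂ are −1/u and 1/u; hence the
  -- factors −u and u.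
  refine ⟨fun p => -p.1 * (Y₁ p).1, fun p => p.1 * (Y₂ p).1, hs, ?_, ?_, fun p hp => ?_,
    fun p hp => ?_⟩
  · exact (contDiffOn_fst.neg).mul hY₁.fst
  · exact contDiffOn_fst.mul hY₂.fst
  · have hp1 := hu p hp
    refine (hasD_of_contDiffOn (c := c) hΩ hu hs.fst hp).congr ?_ ?_
    · rw [(c1 p hp).1]; field_simp
    · rw [(c1 p hp).2.1]; field_simp
  · have hp1 := hu p hp
    obtain ⟨k1, k2⟩ := key p hp
    rw [L1_apply] at k2
    rw [L2_apply] at k1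
    refine (hasD_of_contDiffOn (c := c) hΩ hu hs.snd hp).congr ?_ ?_
    · rw [(c1 p hp).2.2.1]; linear_combination k1
    · rw [(c1 p hp).2.2.2]; linear_combination k2

end

/-! ### Change of frame for differential polynomials -/

/-- Rewriting a scalar degree two polynomial in the jets of the Riemann invariants. -/
def Poly2.toInv (c : ℝ) (A : Poly2) : Poly2 where
  uxx p := -(A.uxx p / p.1) - (2 * c + 1) * A.vxx p
  vxx p := A.uxx p / p.1 + 2 * (c + 1) * A.vxx p
  uxux p := -(A.uxx p / p.1 ^ 3) + A.uxux p / p.1 ^ 2 + (2 * c + 1) ^ 2 * A.vxvx p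
    + (2 * c + 1) * (A.uxvx p / p.1)
  vxvx p := -(A.uxx p / p.1 ^ 3) + A.uxux p / p.1 ^ 2 + (2 * (c + 1)) ^ 2 * A.vxvx p
    + 2 * (c + 1) * (A.uxvx p / p.1)
  uxvx p := 2 * (A.uxx p / p.1 ^ 3) - 2 * (A.uxux p / p.1 ^ 2)
    - 2 * (2 * (c + 1) * (2 * c + 1)) * A.vxvx p - (4 * c + 3) * (A.uxvx p / p.1)

/-- Rewriting a polynomial in the jets of the Riemann invariants in the original jets. -/
def Poly2.ofInv (c : ℝ) (P : Poly2) : Poly2 where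
  uxx p := -(2 * (c + 1) * p.1 * P.uxx p) - (2 * c + 1) * p.1 * P.vxx p
  vxx p := P.uxx p + P.vxx p
  uxux p := -(2 * (c + 1) * P.uxx p) - (2 * c + 1) * P.vxx p
    + (2 * (c + 1) * p.1) ^ 2 * P.uxux p + ((2 * c + 1) * p.1) ^ 2 * P.vxvx p
    + 2 * (c + 1) * (2 * c + 1) * p.1 ^ 2 * P.uxvx p
  vxvx p := P.uxux p + P.vxvx p + P.uxvx p
  uxvx p := -(4 * (c + 1) * p.1 * P.uxux p) - 2 * (2 * c + 1) * p.1 * P.vxvx p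
    - (4 * c + 3) * p.1 * P.uxvx p

/-- The linear combination `k₁ P + k₂ Q` with function coefficients. -/
def Poly2.comb (k₁ k₂ : ℝ × ℝ → ℝ) (P Q : Poly2) : Poly2 where
  uxx p := k₁ p * P.uxx p + k₂ p * Q.uxx p
  vxx p := k₁ p * P.vxx p + k₂ p * Q.vxx p
  uxux p := k₁ p * P.uxux p + k₂ p * Q.uxux p
  vxvx p := k₁ p * P.vxvx p + k₂ p * Q.vxvx p
  uxvx p := k₁ p * P.uxvx p + k₂ p * Q.uxvx p

/-- First component, in the Riemann frame, of a pair of polynomials. -/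
def frame₁ (c : ℝ) (a₁ a₂ : Poly2) : Poly2 :=
  .comb (fun p => -(2 * (c + 1) * p.1)) (fun _ => 1) (a₁.toInv c) (a₂.toInv c)

/-- Second component, in the Riemann frame, of a pair of polynomials. -/
def frame₂ (c : ℝ) (a₁ a₂ : Poly2) : Poly2 :=
  .comb (fun p => -((2 * c + 1) * p.1)) (fun _ => 1) (a₁.toInv c) (a₂.toInv c)

/-- First original component of a pair given in the Riemann frame. -/
def unframe₁ (c : ℝ) (P₁ P₂ : Poly2) : Poly2 :=
  .comb (fun p => -1 / p.1) (fun p => 1 / p.1) (P₁.ofInv c) (P₂.ofInv c)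

/-- Second original component of a pair given in the Riemann frame. -/
def unframe₂ (c : ℝ) (P₁ P₂ : Poly2) : Poly2 :=
  .comb (fun _ => -(2 * c + 1)) (fun _ => 2 * (c + 1)) (P₁.ofInv c) (P₂.ofInv c)

section

variable {c : ℝ} {Ω : Set (ℝ × ℝ)}

lemma Poly2.comb_smoothOn {k₁ k₂ : ℝ × ℝ → ℝ} {P Q : Poly2} (h₁ : ContDiffOn ℝ ∞ k₁ Ω)
    (h₂ : ContDiffOn ℝ ∞ k₂ Ω) (hP : P.SmoothOn Ω) (hQ : Q.SmoothOn Ω) :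
    (Poly2.comb k₁ k₂ P Q).SmoothOn Ω := by
  obtain ⟨p1, p2, p3, p4, p5⟩ := hP
  obtain ⟨q1, q2, q3, q4, q5⟩ := hQ
  exact ⟨(h₁.mul p1).add (h₂.mul q1), (h₁.mul p2).add (h₂.mul q2), (h₁.mul p3).add (h₂.mul q3),
    (h₁.mul p4).add (h₂.mul q4), (h₁.mul p5).add (h₂.mul q5)⟩

lemma Poly2.toInv_smoothOn (hu : ∀ p ∈ Ω, p.1 ≠ 0) {A : Poly2} (hA : A.SmoothOn Ω) :
    (A.toInv c).SmoothOn Ω := by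
  obtain ⟨h1, h2, h3, h4, h5⟩ := hA
  have d1 : ∀ {g : ℝ × ℝ → ℝ}, ContDiffOn ℝ ∞ g Ω → ContDiffOn ℝ ∞ (fun p => g p / p.1) Ω :=
    fun hg => hg.div contDiffOn_fst hu
  have dn : ∀ (n : ℕ) {g : ℝ × ℝ → ℝ}, ContDiffOn ℝ ∞ g Ω →
      ContDiffOn ℝ ∞ (fun p => g p / p.1 ^ n) Ω :=
    fun n _ hg => hg.div (contDiffOn_fst.pow n) fun p hp => pow_ne_zero n (hu p hp)
  have k1 := d1 h1
  have k13 := dn 3 h1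
  have k32 := dn 2 h3
  have k51 := d1 h5
  refine ⟨?_, ?_, ?_, ?_, ?_⟩ <;> (simp only [Poly2.toInv]; fun_prop)

lemma Poly2.ofInv_smoothOn {P : Poly2} (hP : P.SmoothOn Ω) : (P.ofInv c).SmoothOn Ω := by
  obtain ⟨h1, h2, h3, h4, h5⟩ := hP
  refine ⟨?_, ?_, ?_, ?_, ?_⟩ <;> (simp only [Poly2.ofInv]; fun_prop)

lemma frame₁_smoothOn (hu : ∀ p ∈ Ω, p.1 ≠ 0) {a₁ a₂ : Poly2} (h₁ : a₁.SmoothOn Ω)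
    (h₂ : a₂.SmoothOn Ω) : (frame₁ c a₁ a₂).SmoothOn Ω :=
  Poly2.comb_smoothOn (by fun_prop) contDiffOn_const (Poly2.toInv_smoothOn hu h₁)
    (Poly2.toInv_smoothOn hu h₂)

lemma frame₂_smoothOn (hu : ∀ p ∈ Ω, p.1 ≠ 0) {a₁ a₂ : Poly2} (h₁ : a₁.SmoothOn Ω)
    (h₂ : a₂.SmoothOn Ω) : (frame₂ c a₁ a₂).SmoothOn Ω :=
  Poly2.comb_smoothOn (by fun_prop) contDiffOn_const (Poly2.toInv_smoothOn hu h₁)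
    (Poly2.toInv_smoothOn hu h₂)

lemma unframe₁_smoothOn (hu : ∀ p ∈ Ω, p.1 ≠ 0) {P₁ P₂ : Poly2} (h₁ : P₁.SmoothOn Ω)
    (h₂ : P₂.SmoothOn Ω) : (unframe₁ c P₁ P₂).SmoothOn Ω :=
  Poly2.comb_smoothOn (contDiffOn_inv_fst hu _) (contDiffOn_inv_fst hu _)
    (Poly2.ofInv_smoothOn h₁) (Poly2.ofInv_smoothOn h₂)

lemma unframe₂_smoothOn {P₁ P₂ : Poly2} (h₁ : P₁.SmoothOn Ω)
    (h₂ : P₂.SmoothOn Ω) : (unframe₂ c P₁ P₂).SmoothOn Ω :=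
  Poly2.comb_smoothOn contDiffOn_const contDiffOn_const
    (Poly2.ofInv_smoothOn h₁) (Poly2.ofInv_smoothOn h₂)

lemma Poly2.toInv_riem (A : Poly2) {j : Jet} (hj : j.1.1 ≠ 0) :
    (A.toInv c).riem c j = A.onJet j := by
  simp only [Poly2.riem, Poly2.val, Poly2.toInv, Poly2.onJet, xi1, xi2, eta1, eta2]
  field_simp
  ring

lemma Poly2.ofInv_onJet (P : Poly2) (j : Jet) : (P.ofInv c).onJet j = P.riem c j := by
  simp only [Poly2.riem, Poly2.val, Poly2.ofInv, Poly2.onJet, xi1, xi2, eta1, eta2]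
  ring

lemma Poly2.comb_riem (k₁ k₂ : ℝ × ℝ → ℝ) (P Q : Poly2) (j : Jet) :
    (Poly2.comb k₁ k₂ P Q).riem c j = k₁ j.1 * P.riem c j + k₂ j.1 * Q.riem c j := by
  simp only [Poly2.riem, Poly2.val, Poly2.comb]
  ring

lemma Poly2.comb_onJet (k₁ k₂ : ℝ × ℝ → ℝ) (P Q : Poly2) (j : Jet) :
    (Poly2.comb k₁ k₂ P Q).onJet j = k₁ j.1 * P.onJet j + k₂ j.1 * Q.onJet j := by
  simp only [Poly2.onJet, Poly2.comb]
  ring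

/-- `frame₁` and `frame₂` pair the flux with `L1` and `L2`; `riemFlux` reassembles a vector from its
components along the dual basis. -/
lemma riemFlux_frame (hu : ∀ p ∈ Ω, p.1 ≠ 0) (a₁ a₂ : Poly2) :
    Set.EqOn (flux2 a₁ a₂) (riemFlux c (frame₁ c a₁ a₂) (frame₂ c a₁ a₂)) (jetDomain Ω) := by
  intro j hj
  have h : j.1.1 ≠ 0 := hu _ hj
  simp only [flux2, riemFlux, frame₁, frame₂, Poly2.comb_riem, Poly2.toInv_riem _ h]
  ext
  · simp only; field_simp; ring
  · simp only; ring

lemma flux2_unframe (P₁ P₂ : Poly2) :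
    flux2 (unframe₁ c P₁ P₂) (unframe₂ c P₁ P₂) = riemFlux c P₁ P₂ := by
  funext j
  simp only [flux2, riemFlux, unframe₁, unframe₂, Poly2.comb_onJet, Poly2.ofInv_onJet]
  ext
  · simp only; ring
  · simp only; ring

end

/-! ### The normal form in the Riemann frame -/

/-- First characteristic speed of the primary flow. -/
abbrev lam₁ (c : ℝ) : ℝ × ℝ → ℝ := fun p => -(2 * (c + 1) * p.1)

/-- Second characteristic speed of the primary flow. -/
abbrev lam₂ (c : ℝ) : ℝ × ℝ → ℝ := fun p => -((2 * c + 1) * p.1)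

section Betas

variable (c : ℝ) (φ₁ φ₂ : ℝ × ℝ → ℝ)

/-- Coefficient of the Miura transformation from the canonical to the normal form. -/
def normalβ₁₁ (p : ℝ × ℝ) : ℝ :=
  -(12 * c + 9) * (rho p * φ₁ p)
    + (6 * c + 5) / (4 * c + 3) * (D1 c φ₁ p + 4 * (c + 1) * (rho p * φ₁ p))

/-- Coefficient of the Miura transformation from the canonical to the normal form. -/
def normalβ₁₂ (p : ℝ × ℝ) : ℝ := rho p * (2 * (c + 1) * φ₁ p - (6 * c + 4) * φ₂ p)

/-- Coefficient of the Miura transformation from the canonical to the normal form. -/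
def normalβ₂₁ (p : ℝ × ℝ) : ℝ := rho p * (-(6 * c + 5) * φ₁ p + (2 * c + 1) * φ₂ p)

/-- Coefficient of the Miura transformation from the canonical to the normal form. -/
def normalβ₂₂ (p : ℝ × ℝ) : ℝ :=
  -(12 * c + 9) * (rho p * φ₂ p)
    + (6 * c + 4) / (4 * c + 3) * (D2 c φ₂ p + 2 * (2 * c + 1) * (rho p * φ₂ p))

/-- The parameter function of the normal form. -/
def normalParam (p : ℝ × ℝ) : ℝ := -(8 * (c + 1) ^ 2) * φ₁ p + 2 * (2 * c + 1) ^ 2 * φ₂ p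

end Betas

/-- Sum of polynomials. -/
def Poly2.add (P Q : Poly2) : Poly2 := .comb (fun _ => 1) (fun _ => 1) P Q

/-- Two polynomials have the same coefficients at `p`. -/
def Poly2.EqAt (P Q : Poly2) (p : ℝ × ℝ) : Prop :=
  P.uxx p = Q.uxx p ∧ P.vxx p = Q.vxx p ∧ P.uxux p = Q.uxux p ∧ P.vxvx p = Q.vxvx p ∧
    P.uxvx p = Q.uxvx p

section

variable {c : ℝ} {Ω : Set (ℝ × ℝ)} {p : ℝ × ℝ}

lemma HasD.dV {g : ℝ × ℝ → ℝ} {a b : ℝ} (h : HasD c g p a b) : dV g p = a + b := by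
  unfold B2.dV
  rw [h.fderiv]
  simp

lemma HasD.dU {g : ℝ × ℝ → ℝ} {a b : ℝ} (h : HasD c g p a b) :
    dU g p = -(2 * (c + 1) * (p.1 * a)) - (2 * c + 1) * (p.1 * b) := by
  unfold B2.dU
  rw [h.fderiv]
  simp only [add_apply, smul_apply, L1_apply, L2_apply, smul_eq_mul]
  ring

lemma IsParameterPair.hasD_D1 {φ₁ φ₂ : ℝ × ℝ → ℝ} (h : IsParameterPair c Ω φ₁ φ₂)
    (hΩ : IsOpen Ω) (hu : ∀ p ∈ Ω, p.1 ≠ 0) (hp : p ∈ Ω) :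
    HasD c (D1 c φ₁) p (D1 c (D1 c φ₁) p)
      (8 * (c + 1) * rho p ^ 2 * φ₁ p + 4 * (c + 1) * rho p * D1 c φ₁ p) :=
  (hasD_of_contDiffOn hΩ hu (contDiffOn_D1 hΩ hu h.smooth₁) hp).congr rfl
    ((D2_D1_of_eqOn hΩ hu h.smooth₁ h.d2 hp
      (((hasD_rho (hu p hp)).const_mul (4 * (c + 1))).mul (h.hasD_fst hΩ hu hp))).trans (by ring))

lemma IsParameterPair.hasD_D2 {φ₁ φ₂ : ℝ × ℝ → ℝ} (h : IsParameterPair c Ω φ₁ φ₂)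
    (hΩ : IsOpen Ω) (hu : ∀ p ∈ Ω, p.1 ≠ 0) (hp : p ∈ Ω) :
    HasD c (D2 c φ₂) p
      (-(4 * (2 * c + 1)) * rho p ^ 2 * φ₂ p + 2 * (2 * c + 1) * rho p * D2 c φ₂ p)
      (D2 c (D2 c φ₂) p) :=
  (hasD_of_contDiffOn hΩ hu (contDiffOn_D2 hΩ hu h.smooth₂) hp).congr
    ((D1_D2_of_eqOn hΩ hu h.smooth₂ h.d1 hp
      (((hasD_rho (hu p hp)).const_mul (2 * (2 * c + 1))).mul
        (h.hasD_snd hΩ hu hp))).trans (by ring)) rfl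

lemma hasD_normalParam (hΩ : IsOpen Ω) (hu : ∀ p ∈ Ω, p.1 ≠ 0) {φ₁ φ₂ g : ℝ × ℝ → ℝ}
    (hφ : IsParameterPair c Ω φ₁ φ₂) (hg : Set.EqOn g (normalParam c φ₁ φ₂) Ω) (hp : p ∈ Ω) :
    HasD c g p (-(8 * (c + 1) ^ 2) * D1 c φ₁ p
        + 2 * (2 * c + 1) ^ 2 * (2 * (2 * c + 1) * rho p * φ₂ p))
      (-(8 * (c + 1) ^ 2) * (4 * (c + 1) * rho p * φ₁ p) + 2 * (2 * c + 1) ^ 2 * D2 c φ₂ p) :=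
  (((hφ.hasD_fst hΩ hu hp).const_mul _).add ((hφ.hasD_snd hΩ hu hp).const_mul _)).congr_fun
    (eventually_of_mem (hΩ.mem_nhds hp) hg)

/-- The second derivatives of the parameter function of a normal form. -/
lemma normalParam_derivs (hΩ : IsOpen Ω) (hu : ∀ p ∈ Ω, p.1 ≠ 0) {φ₁ φ₂ g : ℝ × ℝ → ℝ}
    (hφ : IsParameterPair c Ω φ₁ φ₂) (hg : Set.EqOn g (normalParam c φ₁ φ₂) Ω) (hp : p ∈ Ω)
    {u f h : ℝ} (hpu : p.1 = u) (hf : φ₁ p = f) (hh : φ₂ p = h) :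
    ∃ f' f'' h' h'' : ℝ, D1 c φ₁ p = f' - 4 * (c + 1) * f / u ^ 2 ∧
      D2 c φ₂ p = h' - 2 * (2 * c + 1) * h / u ^ 2 ∧
      g p = -(8 * (c + 1) ^ 2) * f + 2 * (2 * c + 1) ^ 2 * h ∧
      dV g p = -(8 * (c + 1) ^ 2) * f' + 2 * (2 * c + 1) ^ 2 * h' ∧
      dU g p = -(8 * (c + 1) ^ 2) * (4 * (c + 1) * f / u - 2 * (c + 1) * u * f')
        - 2 * (2 * c + 1) ^ 2 * (2 * (2 * c + 1) * h / u + (2 * c + 1) * u * h') ∧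
      dV (dV g) p = -(8 * (c + 1) ^ 2) * f'' + 2 * (2 * c + 1) ^ 2 * h'' ∧
      dU (dV g) p = -(8 * (c + 1) ^ 2) * (4 * (c + 1) * f' / u - 2 * (c + 1) * u * f'')
        - 2 * (2 * c + 1) ^ 2 * (2 * (2 * c + 1) * h' / u + (2 * c + 1) * u * h'') ∧
      dU (dU g) p = -(8 * (c + 1) ^ 2) * (4 * (c + 1) * (4 * c + 3) * f / u ^ 2
          - 2 * (c + 1) * (8 * c + 9) * f' + 4 * (c + 1) ^ 2 * u ^ 2 * f'')
        + 2 * (2 * c + 1) ^ 2 * (2 * (2 * c + 1) * (4 * c + 3) * h / u ^ 2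
          + (2 * c + 1) * (8 * c + 3) * h' + (2 * c + 1) ^ 2 * u ^ 2 * h'') := by
  have hp1 := hu p hp
  have hr := hasD_rho (c := c) hp1
  have f1 := hφ.hasD_fst hΩ hu hp
  have f2 := hφ.hasD_snd hΩ hu hp
  have ff1 := hφ.hasD_D1 hΩ hu hp
  have ff2 := hφ.hasD_D2 hΩ hu hp
  have hu1 := hasD_fst (c := c) hp1
  have e0 := hg hp
  have G := hasD_normalParam hΩ hu hφ hg hp
  have eV : dV g =ᶠ[𝓝 p] fun p => -(8 * (c + 1) ^ 2) * (D1 c φ₁ p + 4 * (c + 1) * (rho p * φ₁ p))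
      + 2 * (2 * c + 1) ^ 2 * (2 * (2 * c + 1) * (rho p * φ₂ p) + D2 c φ₂ p) :=
    eventually_of_mem (hΩ.mem_nhds hp) fun x hx =>
      ((hasD_normalParam hΩ hu hφ hg hx).dV).trans (by ring)
  have eU : dU g =ᶠ[𝓝 p] fun p => p.1 *
      (8 * (c + 1) ^ 2 * (2 * (c + 1) * D1 c φ₁ p + 4 * (c + 1) * (2 * c + 1) * (rho p * φ₁ p))
      + -(2 * (2 * c + 1) ^ 2) * (4 * (c + 1) * (2 * c + 1) * (rho p * φ₂ p)
        + (2 * c + 1) * D2 c φ₂ p)) :=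
    eventually_of_mem (hΩ.mem_nhds hp) fun x hx =>
      ((hasD_normalParam hΩ hu hφ hg hx).dU).trans (by ring)
  have GV : HasD c (dV g) p _ _ :=
    (((ff1.add ((hr.mul f1).const_mul _)).const_mul _).add
      ((((hr.mul f2).const_mul _).add ff2).const_mul _)).congr_fun eV
  have GU : HasD c (dU g) p _ _ :=
    (hu1.mul ((((ff1.const_mul _).add ((hr.mul f1).const_mul _)).const_mul _).add
      ((((hr.mul f2).const_mul _).add (ff2.const_mul _)).const_mul _))).congr_fun eU
  rw [hpu] at hp1
  rw [GV.dV, GV.dU, GU.dU, G.dV, G.dU, e0]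
  simp only [normalParam, rho, hpu, hf, hh]
  generalize D1 c (D1 c φ₁) p = dd
  generalize D2 c (D2 c φ₂) p = ee
  generalize D1 c φ₁ p = d
  generalize D2 c φ₂ p = e
  -- Since ∂_v = ∂₁ + ∂₂, these are the first and second v-derivatives of φ₁ and φ₂, with the mixed
  -- terms eliminated by the parameter equations.
  refine ⟨d + 4 * (c + 1) * f / u ^ 2,
    dd + 8 * (c + 1) * d / u ^ 2 + 8 * (c + 1) * (2 * c + 3) * f / u ^ 4,
    e + 2 * (2 * c + 1) * h / u ^ 2,
    ee + 4 * (2 * c + 1) * e / u ^ 2 + 8 * (2 * c + 1) * c * h / u ^ 4, ?_, ?_, ?_, ?_, ?_,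
    ?_, ?_, ?_⟩
  · ring
  · ring
  · trivial
  all_goals field_simp; ring

/-- The values of the differential expressions occurring in the normal form. -/
lemma normal_coefs (hc₁ : c ≠ -3 / 4) (hc₂ : c ≠ -1 / 2) (hc₃ : c ≠ -1)
    {g : ℝ × ℝ → ℝ} {u f f' f'' h h' h'' : ℝ} (hpu : p.1 = u) (hu0 : u ≠ 0)
    (h0 : g p = -(8 * (c + 1) ^ 2) * f + 2 * (2 * c + 1) ^ 2 * h)
    (h1 : dV g p = -(8 * (c + 1) ^ 2) * f' + 2 * (2 * c + 1) ^ 2 * h')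
    (h2 : dU g p = -(8 * (c + 1) ^ 2) * (4 * (c + 1) * f / u - 2 * (c + 1) * u * f')
        - 2 * (2 * c + 1) ^ 2 * (2 * (2 * c + 1) * h / u + (2 * c + 1) * u * h'))
    (h3 : dV (dV g) p = -(8 * (c + 1) ^ 2) * f'' + 2 * (2 * c + 1) ^ 2 * h'')
    (h4 : dU (dV g) p = -(8 * (c + 1) ^ 2) * (4 * (c + 1) * f' / u - 2 * (c + 1) * u * f'')
        - 2 * (2 * c + 1) ^ 2 * (2 * (2 * c + 1) * h' / u + (2 * c + 1) * u * h''))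
    (h5 : dU (dU g) p = -(8 * (c + 1) ^ 2) * (4 * (c + 1) * (4 * c + 3) * f / u ^ 2
          - 2 * (c + 1) * (8 * c + 9) * f' + 4 * (c + 1) ^ 2 * u ^ 2 * f'')
        + 2 * (2 * c + 1) ^ 2 * (2 * (2 * c + 1) * (4 * c + 3) * h / u ^ 2
          + (2 * c + 1) * (8 * c + 3) * h' + (2 * c + 1) ^ 2 * u ^ 2 * h'')) :
    coef16 c g p = 2 * ((8 * c ^ 2 + 6 * c + 1) * f + (8 * c ^ 2 + 18 * c + 10) * h) / u ^ 4 ∧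
    coef24 c g p = 4 * (c + 1) * f / u - 2 * (2 * c + 1) * h / u ∧
    ∃ Q₁₁ Q₂₂ Q₁₂ : ℝ,
      Q₁₁ = -(8 * (c + 1) * (3 * c + 2)) * f / u ^ 3
        + 2 * (c + 1) * (6 * c + 5) / (4 * c + 3) * f' / u ∧
      Q₂₂ = 2 * (2 * c + 1) * (6 * c + 5) * h / u ^ 3
        - (2 * c + 1) * (6 * c + 4) / (4 * c + 3) * h' / u ∧
      Q₁₂ = (8 * (c + 1) ^ 2 * f + 2 * (4 * c ^ 2 + 14 * c + 9) * h) / u ^ 3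
        + (2 * c + 1) * u * coef16 c g p ∧
      coef25 c g p = 4 * (c + 1) ^ 2 * u ^ 2 * Q₁₁ + (2 * c + 1) ^ 2 * u ^ 2 * Q₂₂
        + 2 * (c + 1) * (2 * c + 1) * u ^ 2 * Q₁₂ - 8 * (c + 1) ^ 2 * f / u
        + 2 * (2 * c + 1) ^ 2 * h / u ∧
      coef26 c g p = Q₁₁ + Q₂₂ + Q₁₂ ∧
      coef27 c g p = -(4 * (c + 1) * u * Q₁₁) - 2 * (2 * c + 1) * u * Q₂₂
        - (4 * c + 3) * u * Q₁₂ := by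
  have n1 : c + 1 ≠ 0 := fun h => hc₃ (by linarith)
  have n2 : 2 * c + 1 ≠ 0 := fun h => hc₂ (by linarith)
  have n2' : c * 2 + 1 ≠ 0 := mul_comm c 2 ▸ n2
  have n3 : 4 * c + 3 ≠ 0 := fun h => hc₁ (by linarith)
  have n3' : c * 4 + 3 ≠ 0 := mul_comm c 4 ▸ n3
  have e16 : coef16 c g p
      = 2 * ((8 * c ^ 2 + 6 * c + 1) * f + (8 * c ^ 2 + 18 * c + 10) * h) / u ^ 4 := by
    simp only [coef16, h0, h2, h3, h4, h5, hpu]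
    field_simp
    ring
  -- `Q₁₁`, `Q₂₂`, `Q₁₂` are the coefficients of r₁'², r₂'², r₁'r₂' in α₂ rewritten in the jets of
  -- the invariants. The last three identities then have the shape of `Poly2.ofInv`, with
  -- second-order coefficients 4(c+1)f/u and −2(2c+1)h/u.
  refine ⟨e16, ?_, _, _, _, rfl, rfl, rfl, ?_, ?_, ?_⟩
  · simp only [coef24, h0, h2, h3, h4, h5, hpu]
    field_simp
    ring
  · simp only [coef25, e16, h0, h1, h2, h3, h4, h5, hpu]
    field_simp
    ring
  · simp only [coef26, e16, h0, h1, h2, h3, h4, h5, hpu]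
    field_simp
    ring
  · simp only [coef27, e16, h0, h1, h2, h3, h4, h5, hpu]
    field_simp
    ring

set_option maxHeartbeats 1000000 in
/-- The normal form is the canonical deformation up to a Miura transformation. -/
lemma frame_normal (hc₁ : c ≠ -3 / 4) (hc₂ : c ≠ -1 / 2) (hc₃ : c ≠ -1)
    (hΩ : IsOpen Ω) (hu : ∀ p ∈ Ω, p.1 ≠ 0) {φ₁ φ₂ g : ℝ × ℝ → ℝ}
    (hφ : IsParameterPair c Ω φ₁ φ₂) (hg : Set.EqOn g (normalParam c φ₁ φ₂) Ω) (hp : p ∈ Ω) :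
    (frame₁ c (normal₁ c g) (normal₂ c g)).EqAt
      ((canon₁ c φ₁ φ₂ (lam₁ c) (lam₂ c)).add (gauge₁ c (normalβ₁₁ c φ₁) (normalβ₁₂ c φ₁ φ₂)
        (normalβ₂₁ c φ₁ φ₂) (normalβ₂₂ c φ₂) (lam₁ c) (lam₂ c))) p ∧
    (frame₂ c (normal₁ c g) (normal₂ c g)).EqAt
      ((canon₂ c φ₁ φ₂ (lam₁ c) (lam₂ c)).add (gauge₂ c (normalβ₁₁ c φ₁) (normalβ₁₂ c φ₁ φ₂)
        (normalβ₂₁ c φ₁ φ₂) (normalβ₂₂ c φ₂) (lam₁ c) (lam₂ c))) p := by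
  have n1 : c + 1 ≠ 0 := fun h => hc₃ (by linarith)
  have n2 : 2 * c + 1 ≠ 0 := fun h => hc₂ (by linarith)
  have n3 : 4 * c + 3 ≠ 0 := fun h => hc₁ (by linarith)
  have n3' : c * 4 + 3 ≠ 0 := mul_comm c 4 ▸ n3
  have hp1 := hu p hp
  have hr := hasD_rho (c := c) hp1
  have f1 := hφ.hasD_fst hΩ hu hp
  have f2 := hφ.hasD_snd hΩ hu hp
  have ff1 := hφ.hasD_D1 hΩ hu hp
  have ff2 := hφ.hasD_D2 hΩ hu hp
  have b11 : HasD c (normalβ₁₁ c φ₁) p _ _ :=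
    ((hr.mul f1).const_mul _).add ((ff1.add ((hr.mul f1).const_mul _)).const_mul _)
  have b12 : HasD c (normalβ₁₂ c φ₁ φ₂) p _ _ :=
    hr.mul ((f1.const_mul _).sub (f2.const_mul _))
  have b21 : HasD c (normalβ₂₁ c φ₁ φ₂) p _ _ :=
    hr.mul ((f1.const_mul _).add (f2.const_mul _))
  have b22 : HasD c (normalβ₂₂ c φ₂) p _ _ :=
    ((hr.mul f2).const_mul _).add ((ff2.add ((hr.mul f2).const_mul _)).const_mul _)
  have l1 : ∀ x ∈ Ω, D1 c (lam₁ c) x = 2 * (c + 1) * x.1⁻¹ := fun x hx => by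
    rw [(((hasD_fst (hu x hx)).const_mul (2 * (c + 1))).neg).d1 (hu x hx)]
    ring
  have l2 : ∀ x ∈ Ω, D2 c (lam₂ c) x = -(2 * c + 1) * x.1⁻¹ := fun x hx => by
    rw [(((hasD_fst (hu x hx)).const_mul (2 * c + 1)).neg).d2 (hu x hx)]
    ring
  have hi : HasD c (fun x => x.1⁻¹) p (1 / p.1 ^ 3) (-1 / p.1 ^ 3) := by
    refine ((HasD.comp (g := fun x => x.1) (hasDerivAt_inv hp1) (hasD_fst hp1)).congr ?_ ?_)
    · field_simp
    · field_simp
  have l11 : D1 c (D1 c (lam₁ c)) p = _ :=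
    ((hi.const_mul _).congr_fun (eventually_of_mem (hΩ.mem_nhds hp) l1)).d1 hp1
  have l22 : D2 c (D2 c (lam₂ c)) p = _ :=
    ((hi.const_mul _).congr_fun (eventually_of_mem (hΩ.mem_nhds hp) l2)).d2 hp1
  have l1p := l1 p hp
  have l2p := l2 p hp
  -- By definition α₁ of the normal form is a multiple of r₁'r₂'. The vanishing of its four other
  -- coefficients determines the four `normalβ`; for β₁₁ and β₂₂ one divides by 4c+3. What remains
  -- is to compare all ten coefficients as rational functions of u.
  obtain ⟨f', f'', h', h'', ed, ee, h0, h1, h2, h3, h4, h5⟩ :=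
    normalParam_derivs hΩ hu hφ hg hp rfl rfl rfl
  obtain ⟨e16, e24, Q₁₁, Q₂₂, Q₁₂, E₁, E₂, E₃, e25, e26, e27⟩ :=
    normal_coefs hc₁ hc₂ hc₃ rfl hp1 h0 h1 h2 h3 h4 h5
  clear h1 h2 h3 h4 h5
  simp only [Poly2.EqAt, frame₁, frame₂, Poly2.add, Poly2.comb, Poly2.toInv, normal₁, normal₂,
    canon₁, canon₂, gauge₁, gauge₂, gap1, gap2, gap, l11, l22, l1p, l2p, b11.d2 hp1, b12.d2 hp1,
    b21.d1 hp1, b22.d1 hp1]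
  simp only [normalβ₁₁, normalβ₁₂, normalβ₂₁, normalβ₂₂, e24, e25, e26, e27,
    h0, ed, ee, E₁, E₂, E₃, e16]
  generalize φ₁ p = f
  generalize φ₂ p = h
  simp only [rho, lam₁, lam₂]
  clear E₁ E₂ E₃ e16 e24 e25 e26 e27 h0 ed ee
  clear b11 b12 b21 b22 l11 l22 l1p l2p hi l1 l2 ff1 ff2 f1 f2 hr
  generalize p.1 = u at hp1
  refine ⟨⟨?_, ?_, ?_, ?_, ?_⟩, ⟨?_, ?_, ?_, ?_, ?_⟩⟩ 
  · field_simp; ring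
  · field_simp; ring
  · field_simp; ring
  · field_simp; ring
  · field_simp; ring
  · field_simp; ring
  · field_simp; ring
  · field_simp; ring
  · field_simp; ring
  · field_simp; ring

end

/-! ### Functions of one Riemann invariant and powers of |u| -/

section Level

/-- The function whose level sets are the parabolas `v = m u ^ 2 + t`. -/
def level (m : ℝ) (p : ℝ × ℝ) : ℝ := p.2 - m * p.1 ^ 2

lemma invA_eq_level (c : ℝ) : invA c = level (c + 1) := by
  funext p; simp only [invA, level]; ring

lemma invB_eq_level (c : ℝ) : invB c = level (c + 1 / 2) := by
  funext p; simp only [invB, level]; ring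

lemma contDiff_level (m : ℝ) : ContDiff ℝ ∞ (level m) := by
  unfold level; fun_prop

/-- Moving a point vertically changes its level at unit rate. On an open image, smoothness on the
set gives differentiability at each point, as the chain rule requires. -/
lemma isOpen_level_image (m : ℝ) {Ω : Set (ℝ × ℝ)} (hΩ : IsOpen Ω) : IsOpen (level m '' Ω) := by
  rw [isOpen_iff_mem_nhds]
  rintro _ ⟨p, hp, rfl⟩
  have hc : Continuous fun t : ℝ => (p.1, t + m * p.1 ^ 2) := by fun_prop
  have h := (hΩ.preimage hc).mem_nhds (x := level m p) (by simpa [level] using hp)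
  exact mem_of_superset h fun t ht => ⟨_, ht, by simp [level]⟩

lemma hasD_level {c : ℝ} {p : ℝ × ℝ} (m : ℝ) (hp : p.1 ≠ 0) :
    HasD c (level m) p (2 * m - (2 * c + 1)) (2 * (c + 1) - 2 * m) := by
  refine (hasD_snd.sub (((hasD_fst (c := c) hp).mul (hasD_fst hp)).const_mul m)).congr_fun
    (Eventually.of_forall fun x => ?_) |>.congr ?_ ?_
  · simp only [level]; ring
  · field_simp; ring
  · field_simp; ring

lemma hasD_comp_level {c : ℝ} {Ω : Set (ℝ × ℝ)} (hΩ : IsOpen Ω) {m : ℝ} {F : ℝ → ℝ}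
    (hF : ContDiffOn ℝ ∞ F (level m '' Ω)) {p : ℝ × ℝ} (hp : p ∈ Ω) (hp1 : p.1 ≠ 0) :
    HasD c (fun x => F (level m x)) p (deriv F (level m p) * (2 * m - (2 * c + 1)))
      (deriv F (level m p) * (2 * (c + 1) - 2 * m)) :=
  HasD.comp (((hF.contDiffAt ((isOpen_level_image m hΩ).mem_nhds ⟨p, hp, rfl⟩)).differentiableAt
    (by simp)).hasDerivAt) (hasD_level m hp1)

lemma contDiffOn_comp_level {Ω : Set (ℝ × ℝ)} {m : ℝ} {F : ℝ → ℝ}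
    (hF : ContDiffOn ℝ ∞ F (level m '' Ω)) : ContDiffOn ℝ ∞ (fun x => F (level m x)) Ω :=
  hF.comp (contDiff_level m).contDiffOn fun p hp => ⟨p, hp, rfl⟩

lemma contDiffOn_abs_rpow {Ω : Set (ℝ × ℝ)} (hu : ∀ p ∈ Ω, p.1 ≠ 0) (a : ℝ) :
    ContDiffOn ℝ ∞ (fun p : ℝ × ℝ => |p.1| ^ a) Ω := fun p hp =>
  (ContDiffAt.rpow_const_of_ne (f := fun p : ℝ × ℝ => |p.1|)
    ((contDiffAt_abs (hu p hp)).comp p contDiffAt_fst)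
    (abs_ne_zero.2 (hu p hp))).contDiffWithinAt

/-- Powers of |u| are the integrating factors of the equations in `IsParameterPair`: matching a =
4(c+1) for φ₁ and −a = 2(2c+1) for φ₂ gives the exponents of `a23`. -/
lemma hasD_abs_rpow {c : ℝ} {p : ℝ × ℝ} (a : ℝ) (hp : p.1 ≠ 0) :
    HasD c (fun x => |x.1| ^ a) p (-(a * rho p * |p.1| ^ a)) (a * rho p * |p.1| ^ a) := by
  have h : HasDerivAt (fun x : ℝ => |x| ^ a) (a * |p.1| ^ a / p.1) p.1 := by
    refine ((hasDerivAt_abs hp).rpow_const (Or.inl (abs_ne_zero.2 hp))).congr_deriv ?_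
    rw [Real.rpow_sub_one (abs_ne_zero.2 hp)]
    rcases lt_or_gt_of_ne hp with h | h
    · simp only [sign_neg h, SignType.coe_neg_one, abs_of_neg h]; field_simp
    · simp only [sign_pos h, SignType.coe_one, abs_of_pos h]; field_simp
  refine (HasD.comp (g := fun x => x.1) h (hasD_fst hp)).congr ?_ ?_
  · simp only [rho]; field_simp
  · simp only [rho]; field_simp

end Level

/-! ### Sufficiency: normal forms are integrable -/

section Sufficiency

variable {c : ℝ} {Ω : Set (ℝ × ℝ)}

lemma AdmissiblePair.isParameterPair {F₁ F₂ : ℝ → ℝ} (h : AdmissiblePair c Ω F₁ F₂)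
    (hΩ : IsOpen Ω) (hu : ∀ p ∈ Ω, p.1 ≠ 0) (k₁ k₂ : ℝ) :
    IsParameterPair c Ω (fun p => k₁ * (|p.1| ^ (4 * c + 4) * F₁ (invA c p)))
      (fun p => k₂ * (|p.1| ^ (-4 * c - 2) * F₂ (invB c p))) := by
  obtain ⟨h₁, h₂⟩ := h
  rw [invA_eq_level] at *
  rw [invB_eq_level] at *
  refine ⟨contDiffOn_const.mul ((contDiffOn_abs_rpow hu _).mul (contDiffOn_comp_level h₁)),
    contDiffOn_const.mul ((contDiffOn_abs_rpow hu _).mul (contDiffOn_comp_level h₂)),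
    fun p hp => ?_, fun p hp => ?_⟩
  · rw [(((hasD_abs_rpow (4 * c + 4) (hu p hp)).mul
      (hasD_comp_level hΩ h₁ hp (hu p hp))).const_mul k₁).d2 (hu p hp)]
    ring
  · rw [(((hasD_abs_rpow (-4 * c - 2) (hu p hp)).mul
      (hasD_comp_level hΩ h₂ hp (hu p hp))).const_mul k₂).d1 (hu p hp)]
    ring

lemma a23_eq_normalParam (hc₂ : c ≠ -1 / 2) (hc₃ : c ≠ -1) (F₁ F₂ : ℝ → ℝ) (p : ℝ × ℝ) :
    a23 c F₁ F₂ p = normalParam c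
      (fun p => -1 / (8 * (c + 1) ^ 2) * (|p.1| ^ (4 * c + 4) * F₁ (invA c p)))
      (fun p => 1 / (2 * (2 * c + 1) ^ 2) * (|p.1| ^ (-4 * c - 2) * F₂ (invB c p))) p := by
  have n1 : c + 1 ≠ 0 := fun h => hc₃ (by linarith)
  have n2 : 2 * c + 1 ≠ 0 := fun h => hc₂ (by linarith)
  have n2' : c * 2 + 1 ≠ 0 := mul_comm c 2 ▸ n2
  simp only [a23, normalParam]
  field_simp

lemma IsParameterPair.contDiffOn_normalParam {φ₁ φ₂ : ℝ × ℝ → ℝ}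
    (h : IsParameterPair c Ω φ₁ φ₂) : ContDiffOn ℝ ∞ (normalParam c φ₁ φ₂) Ω :=
  (contDiffOn_const.mul h.smooth₁).add (contDiffOn_const.mul h.smooth₂)

lemma contDiffOn_dU (hΩ : IsOpen Ω) {g : ℝ × ℝ → ℝ} (hg : ContDiffOn ℝ ∞ g Ω) :
    ContDiffOn ℝ ∞ (dU g) Ω :=
  contDiffOn_fderiv_apply hΩ hg contDiffOn_const

lemma contDiffOn_dV (hΩ : IsOpen Ω) {g : ℝ × ℝ → ℝ} (hg : ContDiffOn ℝ ∞ g Ω) :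
    ContDiffOn ℝ ∞ (dV g) Ω :=
  contDiffOn_fderiv_apply hΩ hg contDiffOn_const

lemma contDiffOn_normal_coefs (hc₁ : c ≠ -3 / 4) (hc₂ : c ≠ -1 / 2) (hc₃ : c ≠ -1)
    (hΩ : IsOpen Ω) (hu : ∀ p ∈ Ω, p.1 ≠ 0) {g : ℝ × ℝ → ℝ} (hg : ContDiffOn ℝ ∞ g Ω) :
    ContDiffOn ℝ ∞ (coef16 c g) Ω ∧ ContDiffOn ℝ ∞ (coef24 c g) Ω ∧
    ContDiffOn ℝ ∞ (coef25 c g) Ω ∧ ContDiffOn ℝ ∞ (coef26 c g) Ω ∧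
    ContDiffOn ℝ ∞ (coef27 c g) Ω := by
  have n1 : c + 1 ≠ 0 := fun h => hc₃ (by linarith)
  have n2 : 2 * c + 1 ≠ 0 := fun h => hc₂ (by linarith)
  have n3 : 4 * c + 3 ≠ 0 := fun h => hc₁ (by linarith)
  have gu := contDiffOn_dU hΩ hg
  have gv := contDiffOn_dV hΩ hg
  have guu := contDiffOn_dU hΩ gu
  have guv := contDiffOn_dU hΩ gv
  have gvv := contDiffOn_dV hΩ gv
  have d : ∀ {N D h : ℝ × ℝ → ℝ}, ContDiffOn ℝ ∞ N Ω → ContDiffOn ℝ ∞ D Ω →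
      (∀ p ∈ Ω, D p ≠ 0) → ContDiffOn ℝ ∞ h Ω → ContDiffOn ℝ ∞ (fun p => N p / D p * h p) Ω :=
    fun hN hD h0 hh => (hN.div hD h0).mul hh
  unfold coef16 coef24 coef25 coef26 coef27
  refine ⟨?_, ?_, ?_, ?_, ?_⟩
  · refine ((((d ?_ ?_ ?_ gvv).add (d ?_ ?_ ?_ guv)).add (d ?_ ?_ ?_ guu)).sub (d ?_ ?_ ?_ gu)).sub
      (d ?_ ?_ ?_ hg) <;> first
      | fun_prop
      | (intro p hp; have := hu p hp; positivity)
  · refine ((((d ?_ ?_ ?_ gvv).sub (d ?_ ?_ ?_ guv)).sub (d ?_ ?_ ?_ guu)).add (d ?_ ?_ ?_ gu)).sub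
      (d ?_ ?_ ?_ hg) <;> first
      | fun_prop
      | (intro p hp; have := hu p hp; positivity)
  · refine ((((ContDiffOn.mul ?_ gvv).add (d ?_ ?_ ?_ guv)).add (d ?_ ?_ ?_ guu)).add
      (d ?_ ?_ ?_ gv)).sub (d ?_ ?_ ?_ gu) |>.sub (d ?_ ?_ ?_ hg) <;> first
      | fun_prop
      | (intro p hp; have := hu p hp; positivity)
  · refine ((((d ?_ ?_ ?_ gvv).add (d ?_ ?_ ?_ guv)).add (d ?_ ?_ ?_ guu)).sub
      (d ?_ ?_ ?_ gv)).sub (d ?_ ?_ ?_ gu) |>.sub (d ?_ ?_ ?_ hg) <;> first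
      | fun_prop
      | (intro p hp; have := hu p hp; positivity)
  · refine ((((d ?_ ?_ ?_ gvv).sub (d ?_ ?_ ?_ guv)).sub (d ?_ ?_ ?_ guu)).add gv).add
      (d ?_ ?_ ?_ gu) |>.add (d ?_ ?_ ?_ hg) <;> first
      | fun_prop
      | (intro p hp; have := hu p hp; positivity)

lemma normal₁_smoothOn (hc₁ : c ≠ -3 / 4) (hc₂ : c ≠ -1 / 2) (hc₃ : c ≠ -1)
    (hΩ : IsOpen Ω) (hu : ∀ p ∈ Ω, p.1 ≠ 0) {g : ℝ × ℝ → ℝ} (hg : ContDiffOn ℝ ∞ g Ω) :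
    (normal₁ c g).SmoothOn Ω := by
  have h := (contDiffOn_normal_coefs hc₁ hc₂ hc₃ hΩ hu hg).1
  exact ⟨contDiffOn_const, contDiffOn_const, h.mul (by fun_prop), h, (h.mul (by fun_prop)).neg⟩

lemma normal₂_smoothOn (hc₁ : c ≠ -3 / 4) (hc₂ : c ≠ -1 / 2) (hc₃ : c ≠ -1)
    (hΩ : IsOpen Ω) (hu : ∀ p ∈ Ω, p.1 ≠ 0) {g : ℝ × ℝ → ℝ} (hg : ContDiffOn ℝ ∞ g Ω) :
    (normal₂ c g).SmoothOn Ω :=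
  ⟨hg, (contDiffOn_normal_coefs hc₁ hc₂ hc₃ hΩ hu hg).2⟩

lemma canon_smoothOn {φ₁ φ₂ μ₁ μ₂ : ℝ × ℝ → ℝ} (hΩ : IsOpen Ω) (hu : ∀ p ∈ Ω, p.1 ≠ 0)
    (h₁ : ContDiffOn ℝ ∞ φ₁ Ω) (h₂ : ContDiffOn ℝ ∞ φ₂ Ω) (hm : IsSpeedPair c Ω μ₁ μ₂) :
    (canon₁ c φ₁ φ₂ μ₁ μ₂).SmoothOn Ω ∧ (canon₂ c φ₁ φ₂ μ₁ μ₂).SmoothOn Ω := by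
  have hr := contDiffOn_rho hu
  have hg := hm.contDiffOn_gap hu
  have m1 := contDiffOn_D1 (c := c) hΩ hu hm.smooth₁
  have m2 := contDiffOn_D2 (c := c) hΩ hu hm.smooth₂
  have m11 := contDiffOn_D1 (c := c) hΩ hu m1
  have m22 := contDiffOn_D2 (c := c) hΩ hu m2
  refine ⟨⟨?_, ?_, ?_, ?_, ?_⟩, ⟨?_, ?_, ?_, ?_, ?_⟩⟩ <;>
    (simp only [canon₁, canon₂, gap1, gap2]; fun_prop)

lemma gauge_smoothOn {β₁₁ β₁₂ β₂₁ β₂₂ μ₁ μ₂ : ℝ × ℝ → ℝ} (hΩ : IsOpen Ω)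
    (hu : ∀ p ∈ Ω, p.1 ≠ 0) (h₁₁ : ContDiffOn ℝ ∞ β₁₁ Ω) (h₁₂ : ContDiffOn ℝ ∞ β₁₂ Ω)
    (h₂₁ : ContDiffOn ℝ ∞ β₂₁ Ω) (h₂₂ : ContDiffOn ℝ ∞ β₂₂ Ω) (hm : IsSpeedPair c Ω μ₁ μ₂) :
    (gauge₁ c β₁₁ β₁₂ β₂₁ β₂₂ μ₁ μ₂).SmoothOn Ω ∧
      (gauge₂ c β₁₁ β₁₂ β₂₁ β₂₂ μ₁ μ₂).SmoothOn Ω := by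
  have hr := contDiffOn_rho hu
  have hg := hm.contDiffOn_gap hu
  have s1 := hm.smooth₁
  have s2 := hm.smooth₂
  have m1 := contDiffOn_D1 (c := c) hΩ hu hm.smooth₁
  have m2 := contDiffOn_D2 (c := c) hΩ hu hm.smooth₂
  have d11 := contDiffOn_D2 (c := c) hΩ hu h₁₁
  have d12 := contDiffOn_D2 (c := c) hΩ hu h₁₂
  have d21 := contDiffOn_D1 (c := c) hΩ hu h₂₁
  have d22 := contDiffOn_D1 (c := c) hΩ hu h₂₂
  refine ⟨⟨?_, ?_, ?_, ?_, ?_⟩, ⟨?_, ?_, ?_, ?_, ?_⟩⟩ <;>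
    (simp only [gauge₁, gauge₂]; fun_prop)

lemma normalβ_smoothOn {φ₁ φ₂ : ℝ × ℝ → ℝ} (hΩ : IsOpen Ω) (hu : ∀ p ∈ Ω, p.1 ≠ 0)
    (h₁ : ContDiffOn ℝ ∞ φ₁ Ω) (h₂ : ContDiffOn ℝ ∞ φ₂ Ω) :
    ContDiffOn ℝ ∞ (normalβ₁₁ c φ₁) Ω ∧ ContDiffOn ℝ ∞ (normalβ₁₂ c φ₁ φ₂) Ω ∧
      ContDiffOn ℝ ∞ (normalβ₂₁ c φ₁ φ₂) Ω ∧ ContDiffOn ℝ ∞ (normalβ₂₂ c φ₂) Ω := by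
  have hr := contDiffOn_rho hu
  have m1 := contDiffOn_D1 (c := c) hΩ hu h₁
  have m2 := contDiffOn_D2 (c := c) hΩ hu h₂
  unfold normalβ₁₁ normalβ₁₂ normalβ₂₁ normalβ₂₂
  refine ⟨?_, ?_, ?_, ?_⟩ <;> fun_prop

lemma Poly2.SmoothOn.add {P Q : Poly2} (hP : P.SmoothOn Ω) (hQ : Q.SmoothOn Ω) :
    (P.add Q).SmoothOn Ω :=
  Poly2.comb_smoothOn contDiffOn_const contDiffOn_const hP hQ

lemma Poly2.val_add (P Q : Poly2) (p : ℝ × ℝ) (x₁ x₂ n₁ n₂ : ℝ) :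
    (P.add Q).val p x₁ x₂ n₁ n₂ = P.val p x₁ x₂ n₁ n₂ + Q.val p x₁ x₂ n₁ n₂ := by
  simp only [Poly2.val, Poly2.add, Poly2.comb]
  ring

lemma Poly2.SmoothOn.dot_add (hΩ : IsOpen Ω) (hu : ∀ p ∈ Ω, p.1 ≠ 0) {P Q : Poly2}
    (hP : P.SmoothOn Ω) (hQ : Q.SmoothOn Ω) {p : ℝ × ℝ} (hp : p ∈ Ω)
    (x₁ x₂ n₁ n₂ s₁ s₂ t₁ t₂ r₁ r₂ : ℝ) :
    (P.add Q).dot c p x₁ x₂ n₁ n₂ s₁ s₂ t₁ t₂ r₁ r₂ =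
      P.dot c p x₁ x₂ n₁ n₂ s₁ s₂ t₁ t₂ r₁ r₂ + Q.dot c p x₁ x₂ n₁ n₂ s₁ s₂ t₁ t₂ r₁ r₂ := by
  have k : ∀ {g h : ℝ × ℝ → ℝ}, ContDiffOn ℝ ∞ g Ω → ContDiffOn ℝ ∞ h Ω →
      HasD c (fun p => 1 * g p + 1 * h p) p (1 * D1 c g p + 1 * D1 c h p)
        (1 * D2 c g p + 1 * D2 c h p) := fun hg hh =>
    ((hasD_of_contDiffOn hΩ hu hg hp).const_mul 1).add
      ((hasD_of_contDiffOn hΩ hu hh hp).const_mul 1)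
  obtain ⟨p1, p2, p3, p4, p5⟩ := hP
  obtain ⟨q1, q2, q3, q4, q5⟩ := hQ
  have := Poly2.HasGrad.dot_eq (hu p hp) (P := P.add Q)
    ⟨k p1 q1, k p2 q2, k p3 q3, k p4 q4, k p5 q5⟩ x₁ x₂ n₁ n₂ s₁ s₂ t₁ t₂ r₁ r₂
  rw [this]
  simp only [Poly2.dot, Poly2.add, Poly2.comb]
  ring

/-- The obstruction is linear in the deformation and the extension taken together, so the canonical
and the Miura-generated parts can be treated separately. -/
lemma Z_add (hΩ : IsOpen Ω) (hu : ∀ p ∈ Ω, p.1 ≠ 0) {A₁ A₂ E₁ E₂ B₁ B₂ F₁ F₂ : Poly2}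
    (hA : A₁.SmoothOn Ω ∧ A₂.SmoothOn Ω) (hE : E₁.SmoothOn Ω ∧ E₂.SmoothOn Ω)
    (hB : B₁.SmoothOn Ω ∧ B₂.SmoothOn Ω) (hF : F₁.SmoothOn Ω ∧ F₂.SmoothOn Ω)
    {p : ℝ × ℝ} (hp : p ∈ Ω) (X : InvJet) (L M : SpeedJet) :
    Z1 c (A₁.add B₁) (A₂.add B₂) (E₁.add F₁) (E₂.add F₂) p X L M
      = Z1 c A₁ A₂ E₁ E₂ p X L M + Z1 c B₁ B₂ F₁ F₂ p X L M ∧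
    Z2 c (A₁.add B₁) (A₂.add B₂) (E₁.add F₁) (E₂.add F₂) p X L M
      = Z2 c A₁ A₂ E₁ E₂ p X L M + Z2 c B₁ B₂ F₁ F₂ p X L M := by
  simp only [Z1, Z2, Poly2.dotX, Poly2.dotT, Poly2.val_add, hA.1.dot_add hΩ hu hB.1 hp,
    hA.2.dot_add hΩ hu hB.2 hp, hE.1.dot_add hΩ hu hF.1 hp, hE.2.dot_add hΩ hu hF.2 hp]
  constructor <;> ring

lemma riemFlux_eqOn {P₁ P₂ Q₁ Q₂ : Poly2} (h : ∀ p ∈ Ω, P₁.EqAt Q₁ p ∧ P₂.EqAt Q₂ p) :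
    Set.EqOn (riemFlux c P₁ P₂) (riemFlux c Q₁ Q₂) (jetDomain Ω) := by
  intro j hj
  obtain ⟨⟨a1, a2, a3, a4, a5⟩, b1, b2, b3, b4, b5⟩ := h j.1 hj
  simp only [riemFlux, Poly2.riem, Poly2.val, a1, a2, a3, a4, a5, b1, b2, b3, b4, b5]

/-- Normal forms are integrable. -/
lemma isIntegrable_normal (hc₁ : c ≠ -3 / 4) (hc₂ : c ≠ -1 / 2) (hc₃ : c ≠ -1)
    (hΩ : IsOpen Ω) (hu : ∀ p ∈ Ω, p.1 ≠ 0) {φ₁ φ₂ g : ℝ × ℝ → ℝ}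
    (hφ : IsParameterPair c Ω φ₁ φ₂) (hg : Set.EqOn g (normalParam c φ₁ φ₂) Ω) :
    IsIntegrable c Ω (normal₁ c g) (normal₂ c g) := by
  have hgs : ContDiffOn ℝ ∞ g Ω := hφ.contDiffOn_normalParam.congr hg
  have s1 := normal₁_smoothOn hc₁ hc₂ hc₃ hΩ hu hgs
  have s2 := normal₂_smoothOn hc₁ hc₂ hc₃ hΩ hu hgs
  have hl : IsSpeedPair c Ω (lam₁ c) (lam₂ c) := isSpeedPair_primary hu
  obtain ⟨b11, b12, b21, b22⟩ := normalβ_smoothOn (c := c) hΩ hu hφ.smooth₁ hφ.smooth₂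
  refine isIntegrable_of_obstruction hΩ s1 s2 fun f hf => ?_
  obtain ⟨μ₁, μ₂, hd⟩ := hf.exists_isDiagonal hΩ hu
  have hm := hd.isSpeedPair hΩ hu
  have cl := canon_smoothOn hΩ hu hφ.smooth₁ hφ.smooth₂ hl
  have cm := canon_smoothOn hΩ hu hφ.smooth₁ hφ.smooth₂ hm
  have gl := gauge_smoothOn hΩ hu b11 b12 b21 b22 hl
  have gm := gauge_smoothOn hΩ hu b11 b12 b21 b22 hm
  -- The symmetry is extended by the formula of the deformation itself, with the same φ and β but
  -- with μ₁, μ₂ as speeds.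
  refine ⟨_, _, unframe₁_smoothOn (c := c) hu (cm.1.add gm.1) (cm.2.add gm.2),
    unframe₂_smoothOn (c := c) (cm.1.add gm.1) (cm.2.add gm.2), fun q hq y hy => ?_⟩
  rw [obstruction_congr hΩ ((riemFlux_frame (c := c) hu _ _).trans (riemFlux_eqOn fun p hp =>
      frame_normal hc₁ hc₂ hc₃ hΩ hu hφ hg hp)) (fun _ _ => congrFun (flux2_unframe _ _) _) hq hy,
    obstruction_riemFlux hΩ hu hd (cl.1.add gl.1) (cl.2.add gl.2) (cm.1.add gm.1)
      (cm.2.add gm.2) hq hy, hm.speedJet_eq hΩ hu hq hy, hl.speedJet_eq hΩ hu hq hy,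
    (Z_add hΩ hu cl cm gl gm hy _ _ _).1, (Z_add hΩ hu cl cm gl gm hy _ _ _).2]
  have z := canon_obstruction hΩ hu hφ hl hm hy (invJet c q y)
  have z' := gauge_obstruction hΩ hu b11 b12 b21 b22 hl hm hy (invJet c q y)
  rw [z.1, z.2, z'.1, z'.2]
  simp

lemma isIntegrable_normal_a23 (hc₁ : c ≠ -3 / 4) (hc₂ : c ≠ -1 / 2) (hc₃ : c ≠ -1)
    (hΩ : IsOpen Ω) (hu : ∀ p ∈ Ω, p.1 ≠ 0) {F₁ F₂ : ℝ → ℝ} (hF : AdmissiblePair c Ω F₁ F₂) :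
    IsIntegrable c Ω (normal₁ c (a23 c F₁ F₂)) (normal₂ c (a23 c F₁ F₂)) :=
  isIntegrable_normal hc₁ hc₂ hc₃ hΩ hu (hF.isParameterPair hΩ hu _ _)
    fun p _ => a23_eq_normalParam hc₂ hc₃ F₁ F₂ p

end Sufficiency

/-! ### The cubic symmetry and its coefficient equations -/

/-- A cubic symmetry of the primary flow. -/
def cubicFlux (c : ℝ) (p : ℝ × ℝ) : ℝ × ℝ :=
  (p.1 * p.2 - (4 * c + 3) / 3 * p.1 ^ 3, p.2 ^ 2 / 2 - (c + 1) * (2 * c + 1) / 2 * p.1 ^ 4)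

/-- First characteristic speed of the cubic symmetry. -/
def nu₁ (c : ℝ) (p : ℝ × ℝ) : ℝ := p.2 - 2 * (c + 1) * p.1 ^ 2

/-- Second characteristic speed of the cubic symmetry. -/
def nu₂ (c : ℝ) (p : ℝ × ℝ) : ℝ := p.2 - (2 * c + 1) * p.1 ^ 2

section

variable {c : ℝ} {Ω : Set (ℝ × ℝ)}

lemma hasD_sq {p : ℝ × ℝ} (hp : p.1 ≠ 0) : HasD c (fun x => x.1 ^ 2) p (-2) 2 := by
  refine ((hasD_fst (c := c) hp).mul (hasD_fst hp)).congr_fun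
    (Eventually.of_forall fun x => ?_) |>.congr ?_ ?_
  · ring
  · field_simp; ring
  · field_simp; ring

/-- Because u² = 2(r₂ − r₁), both speeds of the cubic symmetry are affine in the invariants. Their
second derivatives vanish, which keeps the expansion of the obstruction short. -/
lemma hasD_nu₁ {p : ℝ × ℝ} (hp : p.1 ≠ 0) : HasD c (nu₁ c) p (2 * c + 3) (-(2 * (c + 1))) :=
  (hasD_snd.sub ((hasD_sq hp).const_mul _)).congr (by ring) (by ring)

lemma hasD_nu₂ {p : ℝ × ℝ} (hp : p.1 ≠ 0) : HasD c (nu₂ c) p (2 * c + 1) (-(2 * c)) :=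
  (hasD_snd.sub ((hasD_sq hp).const_mul _)).congr (by ring) (by ring)

lemma contDiff_cubicFlux : ContDiff ℝ ∞ (cubicFlux c) := by
  unfold cubicFlux; fun_prop

lemma isDiagonal_cubicFlux (hu : ∀ p ∈ Ω, p.1 ≠ 0) :
    IsDiagonal c Ω (cubicFlux c) (nu₁ c) (nu₂ c) where
  smooth := contDiff_cubicFlux.contDiffOn
  smooth₁ := by unfold nu₁; fun_prop
  smooth₂ := by unfold nu₂; fun_prop
  fst p hp := by
    have h := hu p hp
    refine (((hasD_fst (c := c) h).mul hasD_snd).sub (((hasD_fst (c := c) h).mul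
      (hasD_sq h)).const_mul ((4 * c + 3) / 3))).congr_fun (Eventually.of_forall fun x => ?_)
      |>.congr ?_ ?_
    · simp only [cubicFlux]; ring
    · simp only [nu₁]; field_simp; ring
    · simp only [nu₂]; field_simp; ring
  snd p hp := by
    have h := hu p hp
    refine (((hasD_snd (c := c)).mul hasD_snd).const_mul (1 / 2) |>.sub
      (((hasD_sq (c := c) h).mul (hasD_sq h)).const_mul
      ((c + 1) * (2 * c + 1) / 2))).congr_fun (Eventually.of_forall fun x => ?_)
      |>.congr ?_ ?_
    · simp only [cubicFlux]; ring
    · simp only [nu₁]; ring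
    · simp only [nu₂]; ring

lemma isDispersionlessSymmetry_cubicFlux (hΩ : IsOpen Ω) (hu : ∀ p ∈ Ω, p.1 ≠ 0) :
    IsDispersionlessSymmetry c Ω (cubicFlux c) := by
  refine (isDispersionlessSymmetry_iff c hΩ _).2 ⟨contDiff_cubicFlux.contDiffOn, fun p hp X => ?_⟩
  have h := hu p hp
  simp only [(isDiagonal_primaryFlux (c := c) hu).fderiv_apply hp,
    (isDiagonal_cubicFlux (c := c) hu).fderiv_apply hp, L1_apply, L2_apply]
  ext
  · simp only; field_simp; ring
  · simp only; field_simp; ring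

/-- Every jet of the Riemann invariants is attained by a configuration. -/
lemma exists_invJet_eq {p : ℝ × ℝ} (hp : p.1 ≠ 0) (X : InvJet) :
    ∃ q : Curve, ContDiff ℝ ∞ q ∧ q 0 = p ∧ invJet c q 0 = X := by
  obtain ⟨x₁, x₂, n₁, n₂, z₁, z₂⟩ := X
  set u := p.1 with hpu
  -- `a`, `b`, `d` are u_x, u_xx, u_xxx, obtained by differentiating r₂ − r₁ = u²/2 three times. The
  -- derivatives of v in `A`, `B`, `C` then come from v = r₁ + (c+1)u².
  set a := (x₂ - x₁) / u with ha
  set b := (n₂ - n₁) / u - a ^ 2 / u with hb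
  set d := (z₂ - z₁) / u - 3 * a * b / u with hd
  set A : ℝ × ℝ := (a, x₁ + 2 * (c + 1) * u * a) with hA
  set B : ℝ × ℝ := (b, n₁ + 2 * (c + 1) * (u * b + a ^ 2)) with hB
  set C : ℝ × ℝ := (d, z₁ + 2 * (c + 1) * (u * d + 3 * a * b)) with hC
  set q : Curve := fun x => p + x • A + (x ^ 2 / 2) • B + (x ^ 3 / 6) • C with hq
  have d0 : ∀ x, HasDerivAt q (A + x • B + (x ^ 2 / 2) • C) x := by
    intro x
    have h2 := (((hasDerivAt_id x).pow 2).div_const 2).smul_const B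
    have h3 := (((hasDerivAt_id x).pow 3).div_const 6).smul_const C
    refine (((((hasDerivAt_id x).smul_const A).const_add p).add h2).add h3).congr_deriv ?_
    simp only [id]
    norm_num
    module
  have e1 : deriv q = fun x => A + x • B + (x ^ 2 / 2) • C := funext fun x => (d0 x).deriv
  have d1 : ∀ x, HasDerivAt (deriv q) (B + x • C) x := by
    intro x
    rw [e1]
    have h3 := (((hasDerivAt_id x).pow 2).div_const 2).smul_const C
    refine ((((hasDerivAt_id x).smul_const B).const_add A).add h3).congr_deriv ?_
    simp only [id]
    norm_num
  have e2 : deriv (deriv q) = fun x => B + x • C := funext fun x => (d1 x).deriv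
  have d2 : ∀ x, HasDerivAt (deriv (deriv q)) C x := by
    intro x
    rw [e2]
    exact (((hasDerivAt_id x).smul_const C).const_add B).congr_deriv (one_smul _ _)
  have v0 : q 0 = p := by simp [hq]
  have v1 : deriv q 0 = A := by simp [e1]
  have v2 : deriv (deriv q) 0 = B := by simp [e2]
  have v3 : deriv (deriv (deriv q)) 0 = C := (d2 0).deriv
  refine ⟨q, by rw [hq]; fun_prop, v0, ?_⟩
  simp only [invJet, xi1, xi2, eta1, eta2, deta1, deta2, jet, v0, v1, v2, v3, InvJet.mk.injEq,
    ← hpu, hA, hB, hC]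
  refine ⟨?_, ?_, ?_, ?_, ?_, ?_⟩
  · ring
  · rw [ha]; field_simp; ring
  · ring
  · rw [hb, ha]; field_simp; ring
  · ring
  · rw [hd, hb, ha]; field_simp; ring

/-- The flux `A` commutes with the extension `E` of the cubic symmetry to second order. -/
def CommutesCubic (c : ℝ) (Ω : Set (ℝ × ℝ)) (A₁ A₂ E₁ E₂ : Poly2) : Prop :=
  ∀ p ∈ Ω, ∀ X : InvJet,
    Z1 c A₁ A₂ E₁ E₂ p X (speedNum c (lam₁ c) (lam₂ c) p X) (speedNum c (nu₁ c) (nu₂ c) p X) = 0 ∧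
    Z2 c A₁ A₂ E₁ E₂ p X (speedNum c (lam₁ c) (lam₂ c) p X) (speedNum c (nu₁ c) (nu₂ c) p X) = 0

/-- Since every jet of the invariants is attained by a curve, the obstruction along curves becomes
an identity in independent jet variables. -/
lemma IsIntegrable.exists_commutesCubic (hΩ : IsOpen Ω) (hu : ∀ p ∈ Ω, p.1 ≠ 0) {a₁ a₂ : Poly2}
    (h₁ : a₁.SmoothOn Ω) (h₂ : a₂.SmoothOn Ω) (h : IsIntegrable c Ω a₁ a₂) :
    ∃ E₁ E₂ : Poly2, E₁.SmoothOn Ω ∧ E₂.SmoothOn Ω ∧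
      CommutesCubic c Ω (frame₁ c a₁ a₂) (frame₂ c a₁ a₂) E₁ E₂ := by
  obtain ⟨d₁, d₂, hd₁, hd₂, H⟩ := h.exists_obstruction_eq_zero hΩ h₁ h₂
    (isDispersionlessSymmetry_cubicFlux hΩ hu)
  refine ⟨_, _, frame₁_smoothOn (c := c) hu hd₁ hd₂, frame₂_smoothOn (c := c) hu hd₁ hd₂,
    fun p hp X => ?_⟩
  obtain ⟨q, hq, q0, qX⟩ := exists_invJet_eq (c := c) (hu p hp) X
  have hD := isDiagonal_cubicFlux (c := c) hu
  have hq0 : q 0 ∈ Ω := q0 ▸ hp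
  have := H q hq hq0
  rw [obstruction_congr hΩ (riemFlux_frame (c := c) hu _ _) (riemFlux_frame (c := c) hu _ _) hq hq0,
    obstruction_riemFlux hΩ hu hD (frame₁_smoothOn hu h₁ h₂) (frame₂_smoothOn hu h₁ h₂)
      (frame₁_smoothOn hu hd₁ hd₂) (frame₂_smoothOn hu hd₁ hd₂) hq hq0,
    (hD.isSpeedPair hΩ hu).speedJet_eq hΩ hu hq hq0,
    (isSpeedPair_primary hu).speedJet_eq hΩ hu hq hq0, q0, qX] at this
  exact this

/-- Coefficients of the degree three polynomials occurring as obstructions. -/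
lemma coeff_eq_zero {a₁ a₂ b₁₁ b₁₂ b₂₁ b₂₂ k₁ k₂ k₃ k₄ : ℝ}
    (h : ∀ X : InvJet, a₁ * X.z₁ + a₂ * X.z₂ + b₁₁ * (X.n₁ * X.x₁) + b₁₂ * (X.n₁ * X.x₂)
      + b₂₁ * (X.n₂ * X.x₁) + b₂₂ * (X.n₂ * X.x₂) + k₁ * X.x₁ ^ 3 + k₂ * (X.x₁ ^ 2 * X.x₂)
      + k₃ * (X.x₁ * X.x₂ ^ 2) + k₄ * X.x₂ ^ 3 = 0) :
    a₁ = 0 ∧ a₂ = 0 ∧ b₁₁ = 0 ∧ b₁₂ = 0 ∧ b₂₁ = 0 ∧ b₂₂ = 0 ∧ k₁ = 0 ∧ k₂ = 0 ∧ k₃ = 0 ∧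
      k₄ = 0 := by
  -- Unit jets isolate the coefficients; the mixed cubic ones also need (x₁, x₂) = (1, 1) and (−1,
  -- 1).
  have z1 := h ⟨0, 0, 0, 0, 1, 0⟩
  have z2 := h ⟨0, 0, 0, 0, 0, 1⟩
  have x1 := h ⟨1, 0, 0, 0, 0, 0⟩
  have x2 := h ⟨0, 1, 0, 0, 0, 0⟩
  have xa := h ⟨1, 1, 0, 0, 0, 0⟩
  have xb := h ⟨-1, 1, 0, 0, 0, 0⟩
  have n11 := h ⟨1, 0, 1, 0, 0, 0⟩
  have n12 := h ⟨0, 1, 1, 0, 0, 0⟩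
  have n21 := h ⟨1, 0, 0, 1, 0, 0⟩
  have n22 := h ⟨0, 1, 0, 1, 0, 0⟩
  simp only at *
  refine ⟨?_, ?_, ?_, ?_, ?_, ?_, ?_, ?_, ?_, ?_⟩ <;> linarith

end

section

variable {c : ℝ} {Ω : Set (ℝ × ℝ)}

lemma hasD_inv_fst {p : ℝ × ℝ} (hp : p.1 ≠ 0) :
    HasD c (fun x => x.1⁻¹) p (1 / p.1 ^ 3) (-1 / p.1 ^ 3) := by
  refine ((HasD.comp (g := fun x => x.1) (hasDerivAt_inv hp) (hasD_fst hp)).congr ?_ ?_)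
  · field_simp
  · field_simp

lemma D1_lam₁ {p : ℝ × ℝ} (hp : p.1 ≠ 0) : D1 c (lam₁ c) p = 2 * (c + 1) * p.1⁻¹ := by
  rw [(((hasD_fst hp).const_mul (2 * (c + 1))).neg).d1 hp]
  ring

lemma D2_lam₂ {p : ℝ × ℝ} (hp : p.1 ≠ 0) : D2 c (lam₂ c) p = -(2 * c + 1) * p.1⁻¹ := by
  rw [(((hasD_fst hp).const_mul (2 * c + 1)).neg).d2 hp]
  ring

lemma eventually_fst_ne {p : ℝ × ℝ} (hp : p.1 ≠ 0) : ∀ᶠ x : ℝ × ℝ in 𝓝 p, x.1 ≠ 0 :=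
  continuousAt_fst.eventually_ne hp

/-- Speeds of the primary flow along a configuration. -/
lemma speedNum_lam {p : ℝ × ℝ} (hp : p.1 ≠ 0) (X : InvJet) :
    speedNum c (lam₁ c) (lam₂ c) p X =
      ⟨-(2 * (c + 1) * p.1), 2 * (c + 1) / p.1 * X.x₁ - 2 * (c + 1) / p.1 * X.x₂,
        2 * (c + 1) / p.1 ^ 3 * X.x₁ ^ 2 - 4 * (c + 1) / p.1 ^ 3 * (X.x₁ * X.x₂)
          + 2 * (c + 1) / p.1 ^ 3 * X.x₂ ^ 2 + 2 * (c + 1) / p.1 * X.n₁ - 2 * (c + 1) / p.1 * X.n₂,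
        -((2 * c + 1) * p.1), (2 * c + 1) / p.1 * X.x₁ - (2 * c + 1) / p.1 * X.x₂,
        (2 * c + 1) / p.1 ^ 3 * X.x₁ ^ 2 - 2 * (2 * c + 1) / p.1 ^ 3 * (X.x₁ * X.x₂)
          + (2 * c + 1) / p.1 ^ 3 * X.x₂ ^ 2 + (2 * c + 1) / p.1 * X.n₁
          - (2 * c + 1) / p.1 * X.n₂⟩ := by
  have e1 := D1_lam₁ (c := c) hp
  have e2 := D2_lam₂ (c := c) hp
  have e11 : D1 c (D1 c (lam₁ c)) p = _ := (((hasD_inv_fst hp).const_mul _).congr_fun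
    ((eventually_fst_ne hp).mono fun x hx => D1_lam₁ hx)).d1 hp
  have e22 : D2 c (D2 c (lam₂ c)) p = _ := (((hasD_inv_fst hp).const_mul _).congr_fun
    ((eventually_fst_ne hp).mono fun x hx => D2_lam₂ hx)).d2 hp
  simp only [speedNum, gap1, gap2, gap, e1, e2, e11, e22, rho, SpeedJet.mk.injEq]
  refine ⟨trivial, ?_, ?_, trivial, ?_, ?_⟩ <;> (field_simp; ring)

/-- Speeds of the cubic symmetry along a configuration. -/
lemma speedNum_nu {p : ℝ × ℝ} (hp : p.1 ≠ 0) (X : InvJet) :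
    speedNum c (nu₁ c) (nu₂ c) p X =
      ⟨p.2 - 2 * (c + 1) * p.1 ^ 2, (2 * c + 3) * X.x₁ - 2 * (c + 1) * X.x₂,
        (2 * c + 3) * X.n₁ - 2 * (c + 1) * X.n₂,
        p.2 - (2 * c + 1) * p.1 ^ 2, (2 * c + 1) * X.x₁ - 2 * c * X.x₂,
        (2 * c + 1) * X.n₁ - 2 * c * X.n₂⟩ := by
  have e1 := (hasD_nu₁ (c := c) hp).d1 hp
  have e2 := (hasD_nu₂ (c := c) hp).d2 hp
  have e11 : D1 c (D1 c (nu₁ c)) p = 0 := ((hasD_const (2 * c + 3)).congr_fun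
    ((eventually_fst_ne hp).mono fun x hx => (hasD_nu₁ hx).d1 hx)).d1 hp
  have e22 : D2 c (D2 c (nu₂ c)) p = 0 := ((hasD_const (-(2 * c))).congr_fun
    ((eventually_fst_ne hp).mono fun x hx => (hasD_nu₂ hx).d2 hx)).d2 hp
  simp only [speedNum, gap1, gap2, gap, e1, e2, e11, e22, rho, nu₁, nu₂, SpeedJet.mk.injEq]
  refine ⟨trivial, ?_, ?_, trivial, ?_, ?_⟩ <;> (field_simp; ring)

variable {A₁ A₂ E₁ E₂ : Poly2}

/-- `Z1` is a form of weight three in the jets that vanishes identically, so its coefficients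
vanish. That of x₁x₂² is not needed later and is dropped. -/
lemma CommutesCubic.fst (h : CommutesCubic c Ω A₁ A₂ E₁ E₂) (hu : ∀ p ∈ Ω, p.1 ≠ 0)
    {p : ℝ × ℝ} (hp : p ∈ Ω) {u : ℝ} (hpu : p.1 = u) :
    -(u * E₁.vxx p) + u ^ 2 * A₁.vxx p = 0 ∧
    -(6 * (c + 1) / u) * E₁.uxx p + 3 * (2 * c + 3) * A₁.uxx p = 0 ∧
    -(u * D2 c E₁.uxx p) + 6 * (c + 1) / u * E₁.uxx p - (2 * c + 1) / u * E₁.vxx p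
      - 2 * (c + 1) / u * E₂.uxx p
      + (u ^ 2 * D2 c A₁.uxx p - 6 * (c + 1) * A₁.uxx p + (2 * c + 1) * A₁.vxx p
        + 2 * (c + 1) * A₂.uxx p) = 0 ∧
    2 * (c + 1) / u * E₁.uxx p - 2 * (2 * c + 1) / u * E₁.vxx p - u * E₁.uxvx p
      - (2 * (c + 1) * A₁.uxx p - 2 * (2 * c + 1) * A₁.vxx p - u ^ 2 * A₁.uxvx p) = 0 ∧
    -(u * D2 c E₁.vxx p) + 3 * (2 * c + 1) / u * E₁.vxx p - 2 * u * E₁.vxvx p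
      - 2 * (c + 1) / u * (E₂.vxx p - E₁.vxx p)
      + (u ^ 2 * D2 c A₁.vxx p - 6 * c * A₁.vxx p + 2 * u ^ 2 * A₁.vxvx p
        + 2 * (c + 1) * (A₂.vxx p - A₁.vxx p)) = 0 ∧
    -(2 * (c + 1) / u ^ 3) * E₁.uxx p - 4 * (c + 1) / u * E₁.uxux p
      + 2 * (2 * c + 3) * A₁.uxux p = 0 ∧
    -(u * D2 c E₁.uxux p) + 4 * (c + 1) / u ^ 3 * E₁.uxx p - (2 * c + 1) / u ^ 3 * E₁.vxx p
      + 4 * (c + 1) / u * E₁.uxux p - (4 * c + 3) / u * E₁.uxvx p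
      - 2 * (c + 1) / u * (E₂.uxux p - E₁.uxux p)
      + (u ^ 2 * D2 c A₁.uxux p - 4 * (c + 1) * A₁.uxux p + (4 * c + 4) * A₁.uxvx p
        + 2 * (c + 1) * (A₂.uxux p - A₁.uxux p)) = 0 ∧
    -(u * D2 c E₁.vxvx p) - (2 * c + 1) / u ^ 3 * E₁.vxx p + 2 * (2 * c + 1) / u * E₁.vxvx p
      - 2 * (c + 1) / u * (E₂.vxvx p - E₁.vxvx p)
      + (u ^ 2 * D2 c A₁.vxvx p - 4 * c * A₁.vxvx p
        + 2 * (c + 1) * (A₂.vxvx p - A₁.vxvx p)) = 0 := by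
  have hp1 := hu p hp
  have H := coeff_eq_zero (a₁ := 0) (a₂ := -(u * E₁.vxx p) + u ^ 2 * A₁.vxx p)
    (b₁₁ := -(6 * (c + 1) / u) * E₁.uxx p + 3 * (2 * c + 3) * A₁.uxx p)
    (b₁₂ := -(u * D2 c E₁.uxx p) + 6 * (c + 1) / u * E₁.uxx p - (2 * c + 1) / u * E₁.vxx p
      - 2 * (c + 1) / u * E₂.uxx p
      + (u ^ 2 * D2 c A₁.uxx p - 6 * (c + 1) * A₁.uxx p + (2 * c + 1) * A₁.vxx p
        + 2 * (c + 1) * A₂.uxx p))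
    (b₂₁ := 2 * (c + 1) / u * E₁.uxx p - 2 * (2 * c + 1) / u * E₁.vxx p - u * E₁.uxvx p
      - (2 * (c + 1) * A₁.uxx p - 2 * (2 * c + 1) * A₁.vxx p - u ^ 2 * A₁.uxvx p))
    (b₂₂ := -(u * D2 c E₁.vxx p) + 3 * (2 * c + 1) / u * E₁.vxx p - 2 * u * E₁.vxvx p
      - 2 * (c + 1) / u * (E₂.vxx p - E₁.vxx p)
      + (u ^ 2 * D2 c A₁.vxx p - 6 * c * A₁.vxx p + 2 * u ^ 2 * A₁.vxvx p
        + 2 * (c + 1) * (A₂.vxx p - A₁.vxx p)))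
    (k₁ := -(2 * (c + 1) / u ^ 3) * E₁.uxx p - 4 * (c + 1) / u * E₁.uxux p
      + 2 * (2 * c + 3) * A₁.uxux p)
    (k₂ := -(u * D2 c E₁.uxux p) + 4 * (c + 1) / u ^ 3 * E₁.uxx p - (2 * c + 1) / u ^ 3 * E₁.vxx p
      + 4 * (c + 1) / u * E₁.uxux p - (4 * c + 3) / u * E₁.uxvx p
      - 2 * (c + 1) / u * (E₂.uxux p - E₁.uxux p)
      + (u ^ 2 * D2 c A₁.uxux p - 4 * (c + 1) * A₁.uxux p + (4 * c + 4) * A₁.uxvx p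
        + 2 * (c + 1) * (A₂.uxux p - A₁.uxux p)))
    (k₃ := -(u * D2 c E₁.uxvx p) - 2 * (c + 1) / u ^ 3 * E₁.uxx p
      + 2 * (2 * c + 1) / u ^ 3 * E₁.vxx p - 2 * (2 * c + 1) / u * E₁.vxvx p
      + (4 * c + 3) / u * E₁.uxvx p - 2 * (c + 1) / u * (E₂.uxvx p - E₁.uxvx p)
      + (u ^ 2 * D2 c A₁.uxvx p + 2 * (2 * c + 1) * A₁.vxvx p - (4 * c + 2) * A₁.uxvx p
        + 2 * (c + 1) * (A₂.uxvx p - A₁.uxvx p)))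
    (k₄ := -(u * D2 c E₁.vxvx p) - (2 * c + 1) / u ^ 3 * E₁.vxx p
      + 2 * (2 * c + 1) / u * E₁.vxvx p - 2 * (c + 1) / u * (E₂.vxvx p - E₁.vxvx p)
      + (u ^ 2 * D2 c A₁.vxvx p - 4 * c * A₁.vxvx p
        + 2 * (c + 1) * (A₂.vxvx p - A₁.vxvx p))) ?_
  · obtain ⟨-, h1, h2, h3, h4, h5, h6, h7, -, h8⟩ := H
    exact ⟨h1, h2, h3, h4, h5, h6, h7, h8⟩
  · intro X
    refine Eq.trans ?_ (h p hp X).1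
    rw [speedNum_lam hp1, speedNum_nu hp1]
    simp only [Z1, Poly2.dotX, Poly2.dotT, Poly2.dot, Poly2.val, rho]
    rw [hpu] at hp1 ⊢
    field_simp
    ring

/-- The counterpart for `Z2`; here the coefficient of x₁²x₂ is the one dropped. -/
lemma CommutesCubic.snd (h : CommutesCubic c Ω A₁ A₂ E₁ E₂) (hu : ∀ p ∈ Ω, p.1 ≠ 0)
    {p : ℝ × ℝ} (hp : p ∈ Ω) {u : ℝ} (hpu : p.1 = u) :
    u * E₂.uxx p - u ^ 2 * A₂.uxx p = 0 ∧
    u * D1 c E₂.uxx p - 6 * (c + 1) / u * E₂.uxx p + 2 * u * E₂.uxux p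
      - (2 * c + 1) / u * (E₂.uxx p - E₁.uxx p)
      - (u ^ 2 * D1 c A₂.uxx p - 3 * (2 * c + 3) * A₂.uxx p + 2 * u ^ 2 * A₂.uxux p
        - (2 * c + 1) * (A₂.uxx p - A₁.uxx p)) = 0 ∧
    4 * (c + 1) / u * E₂.uxx p - (2 * c + 1) / u * E₂.vxx p + u * E₂.uxvx p
      - (4 * (c + 1) * A₂.uxx p - (2 * c + 1) * A₂.vxx p + u ^ 2 * A₂.uxvx p) = 0 ∧
    u * D1 c E₂.vxx p + 2 * (c + 1) / u * E₂.uxx p - 2 * (2 * c + 1) / u * E₂.vxx p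
      - (2 * c + 1) / u * (E₂.vxx p - E₁.vxx p)
      - (u ^ 2 * D1 c A₂.vxx p + 2 * (c + 1) * A₂.uxx p - 2 * (2 * c + 1) * A₂.vxx p
        - (2 * c + 1) * (A₂.vxx p - A₁.vxx p)) = 0 ∧
    3 * (2 * c + 1) / u * E₂.vxx p - 6 * c * A₂.vxx p = 0 ∧
    u * D1 c E₂.uxux p - 2 * (c + 1) / u ^ 3 * E₂.uxx p - 4 * (c + 1) / u * E₂.uxux p
      - (2 * c + 1) / u * (E₂.uxux p - E₁.uxux p)
      - (u ^ 2 * D1 c A₂.uxux p - 2 * (2 * c + 3) * A₂.uxux p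
        - (2 * c + 1) * (A₂.uxux p - A₁.uxux p)) = 0 ∧
    u * D1 c E₂.vxvx p - 2 * (c + 1) / u ^ 3 * E₂.uxx p + 2 * (2 * c + 1) / u ^ 3 * E₂.vxx p
      - 2 * (2 * c + 1) / u * E₂.vxvx p + (4 * c + 3) / u * E₂.uxvx p
      - (2 * c + 1) / u * (E₂.vxvx p - E₁.vxvx p)
      - (u ^ 2 * D1 c A₂.vxvx p - 2 * (2 * c + 1) * A₂.vxvx p + (4 * c + 2) * A₂.uxvx p
        - (2 * c + 1) * (A₂.vxvx p - A₁.vxvx p)) = 0 ∧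
    -((2 * c + 1) / u ^ 3) * E₂.vxx p + 2 * (2 * c + 1) / u * E₂.vxvx p - 4 * c * A₂.vxvx p = 0 := by
  have hp1 := hu p hp
  have H := coeff_eq_zero (a₁ := u * E₂.uxx p - u ^ 2 * A₂.uxx p) (a₂ := 0)
    (b₁₁ := u * D1 c E₂.uxx p - 6 * (c + 1) / u * E₂.uxx p + 2 * u * E₂.uxux p
      - (2 * c + 1) / u * (E₂.uxx p - E₁.uxx p)
      - (u ^ 2 * D1 c A₂.uxx p - 3 * (2 * c + 3) * A₂.uxx p + 2 * u ^ 2 * A₂.uxux p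
        - (2 * c + 1) * (A₂.uxx p - A₁.uxx p)))
    (b₁₂ := 4 * (c + 1) / u * E₂.uxx p - (2 * c + 1) / u * E₂.vxx p + u * E₂.uxvx p
      - (4 * (c + 1) * A₂.uxx p - (2 * c + 1) * A₂.vxx p + u ^ 2 * A₂.uxvx p))
    (b₂₁ := u * D1 c E₂.vxx p + 2 * (c + 1) / u * E₂.uxx p - 2 * (2 * c + 1) / u * E₂.vxx p
      - (2 * c + 1) / u * (E₂.vxx p - E₁.vxx p)
      - (u ^ 2 * D1 c A₂.vxx p + 2 * (c + 1) * A₂.uxx p - 2 * (2 * c + 1) * A₂.vxx p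
        - (2 * c + 1) * (A₂.vxx p - A₁.vxx p)))
    (b₂₂ := 3 * (2 * c + 1) / u * E₂.vxx p - 6 * c * A₂.vxx p)
    (k₁ := u * D1 c E₂.uxux p - 2 * (c + 1) / u ^ 3 * E₂.uxx p - 4 * (c + 1) / u * E₂.uxux p
      - (2 * c + 1) / u * (E₂.uxux p - E₁.uxux p)
      - (u ^ 2 * D1 c A₂.uxux p - 2 * (2 * c + 3) * A₂.uxux p
        - (2 * c + 1) * (A₂.uxux p - A₁.uxux p)))
    (k₂ := u * D1 c E₂.uxvx p + 4 * (c + 1) / u ^ 3 * E₂.uxx p - (2 * c + 1) / u ^ 3 * E₂.vxx p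
      + 4 * (c + 1) / u * E₂.uxux p - (4 * c + 3) / u * E₂.uxvx p
      - (2 * c + 1) / u * (E₂.uxvx p - E₁.uxvx p)
      - (u ^ 2 * D1 c A₂.uxvx p + 4 * (c + 1) * A₂.uxux p - (4 * c + 4) * A₂.uxvx p
        - (2 * c + 1) * (A₂.uxvx p - A₁.uxvx p)))
    (k₃ := u * D1 c E₂.vxvx p - 2 * (c + 1) / u ^ 3 * E₂.uxx p + 2 * (2 * c + 1) / u ^ 3 * E₂.vxx p
      - 2 * (2 * c + 1) / u * E₂.vxvx p + (4 * c + 3) / u * E₂.uxvx p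
      - (2 * c + 1) / u * (E₂.vxvx p - E₁.vxvx p)
      - (u ^ 2 * D1 c A₂.vxvx p - 2 * (2 * c + 1) * A₂.vxvx p + (4 * c + 2) * A₂.uxvx p
        - (2 * c + 1) * (A₂.vxvx p - A₁.vxvx p)))
    (k₄ := -((2 * c + 1) / u ^ 3) * E₂.vxx p + 2 * (2 * c + 1) / u * E₂.vxvx p - 4 * c * A₂.vxvx p) ?_
  · obtain ⟨h1, -, h2, h3, h4, h5, h6, -, h7, h8⟩ := H
    exact ⟨h1, h2, h3, h4, h5, h6, h7, h8⟩
  · intro X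
    refine Eq.trans ?_ (h p hp X).2
    rw [speedNum_lam hp1, speedNum_nu hp1]
    simp only [Z2, Poly2.dotX, Poly2.dotT, Poly2.dot, Poly2.val, rho]
    rw [hpu] at hp1 ⊢
    field_simp
    ring

end

/-! ### Necessity: the structure of integrable deformations -/

section

variable {c : ℝ} {Ω : Set (ℝ × ℝ)} {A₁ A₂ E₁ E₂ : Poly2}

lemma D1_congr {g h : ℝ × ℝ → ℝ} {p : ℝ × ℝ} (hΩ : IsOpen Ω) (e : ∀ p ∈ Ω, g p = h p)
    (hp : p ∈ Ω) : D1 c g p = D1 c h p := by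
  have e' : g =ᶠ[𝓝 p] h := eventually_of_mem (hΩ.mem_nhds hp) e
  simp only [D1, e'.fderiv_eq]

lemma D2_congr {g h : ℝ × ℝ → ℝ} {p : ℝ × ℝ} (hΩ : IsOpen Ω) (e : ∀ p ∈ Ω, g p = h p)
    (hp : p ∈ Ω) : D2 c g p = D2 c h p := by
  have e' : g =ᶠ[𝓝 p] h := eventually_of_mem (hΩ.mem_nhds hp) e
  simp only [D2, e'.fderiv_eq]

/-- The diagonal second-order coefficients give a parameter pair. -/
lemma CommutesCubic.isParameterPair (h : CommutesCubic c Ω A₁ A₂ E₁ E₂) (hΩ : IsOpen Ω)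
    (hu : ∀ p ∈ Ω, p.1 ≠ 0) (hc₂ : c ≠ -1 / 2) (hc₃ : c ≠ -1)
    (hA₁ : A₁.SmoothOn Ω) (hA₂ : A₂.SmoothOn Ω) (h12 : ∀ p ∈ Ω, A₁.vxx p = 0)
    (h21 : ∀ p ∈ Ω, A₂.uxx p = 0) :
    IsParameterPair c Ω (fun p => 1 / (4 * (c + 1)) * (p.1 * A₁.uxx p))
      (fun p => -1 / (2 * (2 * c + 1)) * (p.1 * A₂.vxx p)) := by
  have n1 : c + 1 ≠ 0 := fun h => hc₃ (by linarith)
  have n2 : 2 * c + 1 ≠ 0 := fun h => hc₂ (by linarith)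
  have n2' : c * 2 + 1 ≠ 0 := mul_comm c 2 ▸ n2
  have e12 : ∀ p ∈ Ω, E₁.vxx p = 0 := fun p hp => by
    have := (h.fst hu hp rfl).1
    rw [h12 p hp, mul_zero, add_zero, neg_eq_zero] at this
    exact (mul_eq_zero.1 this).resolve_left (hu p hp)
  have e21 : ∀ p ∈ Ω, E₂.uxx p = 0 := fun p hp => by
    have := (h.snd hu hp rfl).1
    rw [h21 p hp, mul_zero, sub_zero] at this
    exact (mul_eq_zero.1 this).resolve_left (hu p hp)
  have e11 : ∀ p ∈ Ω, E₁.uxx p = (2 * c + 3) / (2 * (c + 1)) * (p.1 * A₁.uxx p) := fun p hp => by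
    have := (h.fst hu hp rfl).2.1
    have hp1 := hu p hp
    field_simp at this ⊢
    linarith
  have e22 : ∀ p ∈ Ω, E₂.vxx p = 2 * c / (2 * c + 1) * (p.1 * A₂.vxx p) := fun p hp => by
    have := (h.snd hu hp rfl).2.2.2.2.1
    have hp1 := hu p hp
    field_simp at this ⊢
    linarith
  refine ⟨by have := hA₁.1; fun_prop, by have := hA₂.2.1; fun_prop, fun p hp => ?_, fun p hp => ?_⟩
  · have hp1 := hu p hp
    have k := (hasD_fst (c := c) hp1).mul (hasD_of_contDiffOn (c := c) hΩ hu hA₁.1 hp)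
    -- The coefficient of n₁x₂. Once `e11` is inserted and the off-diagonal terms are gone, it is a
    -- linear first-order equation in r₂ for u A₁.uxx.
    have key := (h.fst hu hp rfl).2.2.1
    rw [D2_congr hΩ e11 hp, (k.const_mul _).d2 hp1, e11 p hp, e12 p hp, e21 p hp, h12 p hp,
      h21 p hp] at key
    rw [(k.const_mul _).d2 hp1]
    simp only [rho]
    generalize D2 c A₁.uxx p = d at *
    field_simp at key ⊢
    refine mul_left_cancel₀ hp1 ?_
    linear_combination -key
  · have hp1 := hu p hp
    have k := (hasD_fst (c := c) hp1).mul (hasD_of_contDiffOn (c := c) hΩ hu hA₂.2.1 hp)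
    have key := (h.snd hu hp rfl).2.2.2.1
    rw [D1_congr hΩ e22 hp, (k.const_mul _).d1 hp1, e22 p hp, e12 p hp, e21 p hp, h12 p hp,
      h21 p hp] at key
    rw [(k.const_mul _).d1 hp1]
    simp only [rho]
    generalize D1 c A₂.vxx p = d at *
    field_simp at key ⊢
    refine mul_left_cancel₀ hp1 ?_
    linear_combination key

/-- A deformation which is trivial to leading order vanishes. -/
lemma CommutesCubic.eq_zero (h : CommutesCubic c Ω A₁ A₂ E₁ E₂) (hΩ : IsOpen Ω)
    (hu : ∀ p ∈ Ω, p.1 ≠ 0) (hc₂ : c ≠ -1 / 2) (hc₃ : c ≠ -1)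
    (hA₁ : A₁.SmoothOn Ω) (hA₂ : A₂.SmoothOn Ω)
    (h11 : ∀ p ∈ Ω, A₁.uxx p = 0) (h12 : ∀ p ∈ Ω, A₁.vxx p = 0)
    (h21 : ∀ p ∈ Ω, A₂.uxx p = 0) (h22 : ∀ p ∈ Ω, A₂.vxx p = 0)
    (hQ : ∀ p ∈ Ω, A₁.uxux p = 0) (hP : ∀ p ∈ Ω, A₂.vxvx p = 0) {p : ℝ × ℝ} (hp : p ∈ Ω) :
    (A₁.vxvx p = 0 ∧ A₁.uxvx p = 0) ∧ (A₂.uxux p = 0 ∧ A₂.uxvx p = 0) := by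
  have n1 : c + 1 ≠ 0 := fun h => hc₃ (by linarith)
  have n2 : 2 * c + 1 ≠ 0 := fun h => hc₂ (by linarith)
  have n2' : c * 2 + 1 ≠ 0 := mul_comm c 2 ▸ n2
  have e12 : ∀ p ∈ Ω, E₁.vxx p = 0 := fun p hp => by
    have := (h.fst hu hp rfl).1
    rw [h12 p hp, mul_zero, add_zero, neg_eq_zero] at this
    exact (mul_eq_zero.1 this).resolve_left (hu p hp)
  have e21 : ∀ p ∈ Ω, E₂.uxx p = 0 := fun p hp => by
    have := (h.snd hu hp rfl).1
    rw [h21 p hp, mul_zero, sub_zero] at this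
    exact (mul_eq_zero.1 this).resolve_left (hu p hp)
  have e11 : ∀ p ∈ Ω, E₁.uxx p = 0 := fun p hp => by
    have := (h.fst hu hp rfl).2.1
    have hp1 := hu p hp
    rw [h11 p hp] at this
    field_simp at this
    simpa [n1] using this
  have e22 : ∀ p ∈ Ω, E₂.vxx p = 0 := fun p hp => by
    have := (h.snd hu hp rfl).2.2.2.2.1
    have hp1 := hu p hp
    rw [h22 p hp] at this
    field_simp at this
    simpa [n2] using this
  have z : ∀ {g : ℝ × ℝ → ℝ}, (∀ p ∈ Ω, g p = 0) → ∀ p ∈ Ω, D1 c g p = 0 ∧ D2 c g p = 0 :=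
    fun hg p hp => ⟨(D1_congr hΩ hg hp).trans ((hasD_const 0).d1 (hu p hp)),
      (D2_congr hΩ hg hp).trans ((hasD_const 0).d2 (hu p hp))⟩
  have s11 : ∀ p ∈ Ω, E₁.uxux p = 0 := fun p hp => by
    have := (h.fst hu hp rfl).2.2.2.2.2.1
    have hp1 := hu p hp
    rw [hQ p hp, e11 p hp] at this
    field_simp at this
    simpa [n1, hp1] using this
  have t22 : ∀ p ∈ Ω, E₂.vxvx p = 0 := fun p hp => by
    have := (h.snd hu hp rfl).2.2.2.2.2.2.2
    have hp1 := hu p hp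
    rw [hP p hp, e22 p hp] at this
    field_simp at this
    simpa [n2, hp1] using this
  have s12 : ∀ p ∈ Ω, E₁.uxvx p = p.1 * A₁.uxvx p := fun p hp => by
    have := (h.fst hu hp rfl).2.2.2.1
    have hp1 := hu p hp
    rw [h11 p hp, e11 p hp, h12 p hp, e12 p hp] at this
    have : p.1 * (E₁.uxvx p - p.1 * A₁.uxvx p) = 0 := by linarith
    linarith [(mul_eq_zero.1 this).resolve_left hp1]
  have t12 : ∀ p ∈ Ω, E₂.uxvx p = p.1 * A₂.uxvx p := fun p hp => by
    have := (h.snd hu hp rfl).2.2.1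
    have hp1 := hu p hp
    rw [h21 p hp, e21 p hp, h22 p hp, e22 p hp] at this
    have : p.1 * (E₂.uxvx p - p.1 * A₂.uxvx p) = 0 := by linarith
    linarith [(mul_eq_zero.1 this).resolve_left hp1]
  have s22 : ∀ p ∈ Ω, E₁.vxvx p = p.1 * A₁.vxvx p := fun p hp => by
    have := (h.fst hu hp rfl).2.2.2.2.1
    have hp1 := hu p hp
    rw [h12 p hp, e12 p hp, h22 p hp, e22 p hp, (z e12 p hp).2, (z h12 p hp).2] at this
    have : p.1 * (E₁.vxvx p - p.1 * A₁.vxvx p) = 0 := by linarith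
    linarith [(mul_eq_zero.1 this).resolve_left hp1]
  have t11 : ∀ p ∈ Ω, E₂.uxux p = p.1 * A₂.uxux p := fun p hp => by
    have := (h.snd hu hp rfl).2.1
    have hp1 := hu p hp
    rw [h11 p hp, e11 p hp, h21 p hp, e21 p hp, (z e21 p hp).1, (z h21 p hp).1] at this
    have : p.1 * (E₂.uxux p - p.1 * A₂.uxux p) = 0 := by linarith
    linarith [(mul_eq_zero.1 this).resolve_left hp1]
  have hp1 := hu p hp
  have k1 := (hasD_fst (c := c) hp1).mul (hasD_of_contDiffOn (c := c) hΩ hu hA₂.2.2.1 hp)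
  have k2 := (hasD_fst (c := c) hp1).mul (hasD_of_contDiffOn (c := c) hΩ hu hA₁.2.2.2.1 hp)
  -- Substituting E₁.vxvx = u A₁.vxvx cancels the derivative terms, and the remaining multiples of
  -- A₁.vxvx add up to exactly one for every c. The same count settles the other three coefficients.
  have a22 : A₁.vxvx p = 0 := by
    have := (h.fst hu hp rfl).2.2.2.2.2.2.2
    rw [D2_congr hΩ s22 hp, k2.d2 hp1, e12 p hp, s22 p hp, t22 p hp, hP p hp] at this
    field_simp at this
    refine mul_left_cancel₀ (pow_ne_zero 3 hp1) ?_
    linear_combination this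
  have a11 : A₂.uxux p = 0 := by
    have := (h.snd hu hp rfl).2.2.2.2.2.1
    rw [D1_congr hΩ t11 hp, k1.d1 hp1, e21 p hp, t11 p hp, s11 p hp, hQ p hp] at this
    field_simp at this
    refine mul_left_cancel₀ (pow_ne_zero 3 hp1) ?_
    linear_combination this
  refine ⟨⟨a22, ?_⟩, a11, ?_⟩
  · have := (h.fst hu hp rfl).2.2.2.2.2.2.1
    rw [(z s11 p hp).2, (z hQ p hp).2, e11 p hp, e12 p hp, s11 p hp, s12 p hp, t11 p hp, hQ p hp,
      a11] at this
    field_simp at this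
    refine mul_left_cancel₀ (pow_ne_zero 3 hp1) ?_
    linear_combination this
  · have := (h.snd hu hp rfl).2.2.2.2.2.2.1
    rw [(z t22 p hp).1, (z hP p hp).1, e21 p hp, e22 p hp, t22 p hp, t12 p hp, s22 p hp, hP p hp,
      a22] at this
    field_simp at this
    refine mul_left_cancel₀ (pow_ne_zero 3 hp1) ?_
    linear_combination this

/-- Difference of polynomials. -/
def Poly2.sub (P Q : Poly2) : Poly2 := .comb (fun _ => 1) (fun _ => -1) P Q

lemma Poly2.SmoothOn.sub {P Q : Poly2} (hP : P.SmoothOn Ω) (hQ : Q.SmoothOn Ω) :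
    (P.sub Q).SmoothOn Ω :=
  Poly2.comb_smoothOn contDiffOn_const contDiffOn_const hP hQ

lemma Poly2.add_sub_cancel (P Q : Poly2) : Q.add (P.sub Q) = P := by
  simp [Poly2.add, Poly2.sub, Poly2.comb]

lemma CommutesCubic.sub {B₁ B₂ F₁ F₂ : Poly2} (hΩ : IsOpen Ω) (hu : ∀ p ∈ Ω, p.1 ≠ 0)
    (hA : A₁.SmoothOn Ω ∧ A₂.SmoothOn Ω) (hE : E₁.SmoothOn Ω ∧ E₂.SmoothOn Ω)
    (hB : B₁.SmoothOn Ω ∧ B₂.SmoothOn Ω) (hF : F₁.SmoothOn Ω ∧ F₂.SmoothOn Ω)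
    (h : CommutesCubic c Ω A₁ A₂ E₁ E₂) (h' : CommutesCubic c Ω B₁ B₂ F₁ F₂) :
    CommutesCubic c Ω (A₁.sub B₁) (A₂.sub B₂) (E₁.sub F₁) (E₂.sub F₂) := by
  intro p hp X
  have k := Z_add (c := c) hΩ hu hB hF (B₁ := A₁.sub B₁) (B₂ := A₂.sub B₂) (F₁ := E₁.sub F₁)
    (F₂ := E₂.sub F₂) ⟨hA.1.sub hB.1, hA.2.sub hB.2⟩ ⟨hE.1.sub hF.1, hE.2.sub hF.2⟩ hp X
    (speedNum c (lam₁ c) (lam₂ c) p X) (speedNum c (nu₁ c) (nu₂ c) p X)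
  simp only [Poly2.add_sub_cancel, (h p hp X).1, (h p hp X).2, (h' p hp X).1, (h' p hp X).2,
    zero_add] at k
  exact ⟨k.1.symm, k.2.symm⟩

lemma isSpeedPair_nu (hΩ : IsOpen Ω) (hu : ∀ p ∈ Ω, p.1 ≠ 0) :
    IsSpeedPair c Ω (nu₁ c) (nu₂ c) :=
  (isDiagonal_cubicFlux hu).isSpeedPair hΩ hu

/-- A deformation commuting with an extension of the cubic symmetry is the sum of a canonical one
and of one generated by a Miura transformation. -/
lemma CommutesCubic.exists_eq (h : CommutesCubic c Ω A₁ A₂ E₁ E₂) (hΩ : IsOpen Ω)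
    (hu : ∀ p ∈ Ω, p.1 ≠ 0) (hc₂ : c ≠ -1 / 2) (hc₃ : c ≠ -1)
    (hA : A₁.SmoothOn Ω ∧ A₂.SmoothOn Ω) (hE : E₁.SmoothOn Ω ∧ E₂.SmoothOn Ω) :
    ∃ φ₁ φ₂ β₁₁ β₁₂ β₂₁ β₂₂ : ℝ × ℝ → ℝ, IsParameterPair c Ω φ₁ φ₂ ∧ ContDiffOn ℝ ∞ β₁₁ Ω ∧
      ContDiffOn ℝ ∞ β₁₂ Ω ∧ ContDiffOn ℝ ∞ β₂₁ Ω ∧ ContDiffOn ℝ ∞ β₂₂ Ω ∧ ∀ p ∈ Ω,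
      A₁.EqAt ((canon₁ c φ₁ φ₂ (lam₁ c) (lam₂ c)).add
        (gauge₁ c β₁₁ β₁₂ β₂₁ β₂₂ (lam₁ c) (lam₂ c))) p ∧
      A₂.EqAt ((canon₂ c φ₁ φ₂ (lam₁ c) (lam₂ c)).add
        (gauge₂ c β₁₁ β₁₂ β₂₁ β₂₂ (lam₁ c) (lam₂ c))) p := by
  have n1 : c + 1 ≠ 0 := fun h => hc₃ (by linarith)
  have n2 : 2 * c + 1 ≠ 0 := fun h => hc₂ (by linarith)
  have n2' : c * 2 + 1 ≠ 0 := mul_comm c 2 ▸ n2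
  have hl : IsSpeedPair c Ω (lam₁ c) (lam₂ c) := isSpeedPair_primary hu
  have hm := isSpeedPair_nu (c := c) hΩ hu
  have dv : ∀ {g : ℝ × ℝ → ℝ}, ContDiffOn ℝ ∞ g Ω → ContDiffOn ℝ ∞ (fun p => g p / p.1) Ω :=
    fun hg => hg.div contDiffOn_fst hu
  have hz : ContDiffOn ℝ ∞ (fun _ : ℝ × ℝ => (0 : ℝ)) Ω := contDiffOn_const
  have step : ∀ {φ₁ φ₂ β₁₁ β₁₂ β₂₁ β₂₂ : ℝ × ℝ → ℝ}, IsParameterPair c Ω φ₁ φ₂ →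
      ContDiffOn ℝ ∞ β₁₁ Ω → ContDiffOn ℝ ∞ β₁₂ Ω → ContDiffOn ℝ ∞ β₂₁ Ω →
      ContDiffOn ℝ ∞ β₂₂ Ω → ∃ S₁ S₂, CommutesCubic c Ω
        (A₁.sub ((canon₁ c φ₁ φ₂ (lam₁ c) (lam₂ c)).add
          (gauge₁ c β₁₁ β₁₂ β₂₁ β₂₂ (lam₁ c) (lam₂ c))))
        (A₂.sub ((canon₂ c φ₁ φ₂ (lam₁ c) (lam₂ c)).add
          (gauge₂ c β₁₁ β₁₂ β₂₁ β₂₂ (lam₁ c) (lam₂ c)))) S₁ S₂ ∧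
        (A₁.sub ((canon₁ c φ₁ φ₂ (lam₁ c) (lam₂ c)).add
          (gauge₁ c β₁₁ β₁₂ β₂₁ β₂₂ (lam₁ c) (lam₂ c)))).SmoothOn Ω ∧
        (A₂.sub ((canon₂ c φ₁ φ₂ (lam₁ c) (lam₂ c)).add
          (gauge₂ c β₁₁ β₁₂ β₂₁ β₂₂ (lam₁ c) (lam₂ c)))).SmoothOn Ω := by
    intro φ₁ φ₂ β₁₁ β₁₂ β₂₁ β₂₂ hφ b11 b12 b21 b22
    have cl := canon_smoothOn hΩ hu hφ.smooth₁ hφ.smooth₂ hl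
    have cm := canon_smoothOn hΩ hu hφ.smooth₁ hφ.smooth₂ hm
    have gl := gauge_smoothOn hΩ hu b11 b12 b21 b22 hl
    have gm := gauge_smoothOn hΩ hu b11 b12 b21 b22 hm
    refine ⟨_, _, h.sub hΩ hu hA hE ⟨cl.1.add gl.1, cl.2.add gl.2⟩
      ⟨cm.1.add gm.1, cm.2.add gm.2⟩ fun p hp X => ?_, hA.1.sub (cl.1.add gl.1),
      hA.2.sub (cl.2.add gl.2)⟩
    rw [(Z_add hΩ hu cl cm gl gm hp _ _ _).1, (Z_add hΩ hu cl cm gl gm hp _ _ _).2]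
    have z := canon_obstruction hΩ hu hφ hl hm hp X
    have z' := gauge_obstruction hΩ hu b11 b12 b21 b22 hl hm hp X
    rw [z.1, z.2, z'.1, z'.2]
    simp
  -- In a first pass φ = 0, and β₁₂, β₂₁ remove the off-diagonal second-order terms; here λ₁ − λ₂ =
  -- −u. Miura-generated terms do not touch the diagonal, which therefore yields the parameter pair.
  obtain ⟨S₁, S₂, hS, s1, s2⟩ := step (φ₁ := fun _ => 0) (φ₂ := fun _ => 0) (β₁₁ := fun _ => 0)
    (β₁₂ := fun p => A₁.vxx p / p.1) (β₂₁ := fun p => -(A₂.uxx p / p.1)) (β₂₂ := fun _ => 0)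
    ⟨hz, hz, fun p hp => by rw [(hasD_const 0).d2 (hu p hp)]; ring,
      fun p hp => by rw [(hasD_const 0).d1 (hu p hp)]; ring⟩ hz (dv hA.1.2.1) (dv hA.2.1).neg hz
  have hφ := hS.isParameterPair hΩ hu hc₂ hc₃ s1 s2
    (fun p hp => by
      have := hu p hp
      simp only [Poly2.sub, Poly2.add, Poly2.comb, canon₁, gauge₁]
      field_simp
      ring)
    (fun p hp => by
      have := hu p hp
      simp only [Poly2.sub, Poly2.add, Poly2.comb, canon₂, gauge₂]
      field_simp
      ring)
  set φ₁ : ℝ × ℝ → ℝ := fun p => 1 / (4 * (c + 1)) * (p.1 * _) with hφ₁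
  set φ₂ : ℝ × ℝ → ℝ := fun p => -1 / (2 * (2 * c + 1)) * (p.1 * _) with hφ₂
  have f1 : ∀ p, φ₁ p = 1 / (4 * (c + 1)) * (p.1 * A₁.uxx p) := fun p => by
    rw [hφ₁]
    simp only [Poly2.sub, Poly2.add, Poly2.comb, canon₁, gauge₁]
    ring
  have f2 : ∀ p, φ₂ p = -1 / (2 * (2 * c + 1)) * (p.1 * A₂.vxx p) := fun p => by
    rw [hφ₂]
    simp only [Poly2.sub, Poly2.add, Poly2.comb, canon₂, gauge₂]
    ring
  clear_value φ₁ φ₂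
  have cl := canon_smoothOn hΩ hu hφ.smooth₁ hφ.smooth₂ hl
  -- The second pass starts again from A, with φ known. Each β is solved from a coefficient that
  -- contains it without derivatives: β₁₂ and β₂₁ from the off-diagonal second-order terms, β₁₁ and
  -- β₂₂ from x₁² in the first and x₂² in the second component.
  set β₁₁ : ℝ × ℝ → ℝ := fun p =>
    p.1 * (1 / (2 * (c + 1)) * (A₁.uxux p - (canon₁ c φ₁ φ₂ (lam₁ c) (lam₂ c)).uxux p)) with hb11
  set β₁₂ : ℝ × ℝ → ℝ := fun p =>
    (A₁.vxx p - (canon₁ c φ₁ φ₂ (lam₁ c) (lam₂ c)).vxx p) / p.1 with hb12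
  set β₂₁ : ℝ × ℝ → ℝ := fun p =>
    -((A₂.uxx p - (canon₂ c φ₁ φ₂ (lam₁ c) (lam₂ c)).uxx p) / p.1) with hb21
  set β₂₂ : ℝ × ℝ → ℝ := fun p =>
    p.1 * (-1 / (2 * c + 1) * (A₂.vxvx p - (canon₂ c φ₁ φ₂ (lam₁ c) (lam₂ c)).vxvx p)) with hb22
  have b11 : ContDiffOn ℝ ∞ β₁₁ Ω :=
    contDiffOn_fst.mul (contDiffOn_const.mul (hA.1.2.2.1.sub cl.1.2.2.1))
  have b12 : ContDiffOn ℝ ∞ β₁₂ Ω := dv (hA.1.2.1.sub cl.1.2.1)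
  have b21 : ContDiffOn ℝ ∞ β₂₁ Ω := (dv (hA.2.1.sub cl.2.1)).neg
  have b22 : ContDiffOn ℝ ∞ β₂₂ Ω :=
    contDiffOn_fst.mul (contDiffOn_const.mul (hA.2.2.2.2.1.sub cl.2.2.2.2.1))
  obtain ⟨T₁, T₂, hT, t1, t2⟩ := step hφ b11 b12 b21 b22
  have v11 : ∀ p ∈ Ω, A₁.uxx p = ((canon₁ c φ₁ φ₂ (lam₁ c) (lam₂ c)).add
      (gauge₁ c β₁₁ β₁₂ β₂₁ β₂₂ (lam₁ c) (lam₂ c))).uxx p := fun p hp => by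
    have := hu p hp
    simp only [Poly2.add, Poly2.comb, canon₁, gauge₁, D1_lam₁ (c := c) (hu p hp), f1]
    field_simp
    ring
  have v12 : ∀ p ∈ Ω, A₁.vxx p = ((canon₁ c φ₁ φ₂ (lam₁ c) (lam₂ c)).add
      (gauge₁ c β₁₁ β₁₂ β₂₁ β₂₂ (lam₁ c) (lam₂ c))).vxx p := fun p hp => by
    have := hu p hp
    simp only [Poly2.add, Poly2.comb, gauge₁, hb12]
    field_simp
    ring
  have v21 : ∀ p ∈ Ω, A₂.uxx p = ((canon₂ c φ₁ φ₂ (lam₁ c) (lam₂ c)).add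
      (gauge₂ c β₁₁ β₁₂ β₂₁ β₂₂ (lam₁ c) (lam₂ c))).uxx p := fun p hp => by
    have := hu p hp
    simp only [Poly2.add, Poly2.comb, gauge₂, hb21]
    field_simp
    ring
  have v22 : ∀ p ∈ Ω, A₂.vxx p = ((canon₂ c φ₁ φ₂ (lam₁ c) (lam₂ c)).add
      (gauge₂ c β₁₁ β₁₂ β₂₁ β₂₂ (lam₁ c) (lam₂ c))).vxx p := fun p hp => by
    have := hu p hp
    simp only [Poly2.add, Poly2.comb, canon₂, gauge₂, D2_lam₂ (c := c) (hu p hp), f2]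
    field_simp
    ring
  have w11 : ∀ p ∈ Ω, A₁.uxux p = ((canon₁ c φ₁ φ₂ (lam₁ c) (lam₂ c)).add
      (gauge₁ c β₁₁ β₁₂ β₂₁ β₂₂ (lam₁ c) (lam₂ c))).uxux p := fun p hp => by
    have := hu p hp
    simp only [Poly2.add, Poly2.comb, gauge₁, hb11, D1_lam₁ (c := c) (hu p hp)]
    field_simp
    ring
  have w22 : ∀ p ∈ Ω, A₂.vxvx p = ((canon₂ c φ₁ φ₂ (lam₁ c) (lam₂ c)).add
      (gauge₂ c β₁₁ β₁₂ β₂₁ β₂₂ (lam₁ c) (lam₂ c))).vxvx p := fun p hp => by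
    have := hu p hp
    simp only [Poly2.add, Poly2.comb, gauge₂, hb22, D2_lam₂ (c := c) (hu p hp)]
    field_simp
    ring
  have sb : ∀ {a b : ℝ}, a = b → 1 * a + -1 * b = 0 := fun hab => by rw [hab]; ring
  have bs : ∀ {a b : ℝ}, 1 * a + -1 * b = 0 → a = b := fun hab => by linarith
  refine ⟨φ₁, φ₂, β₁₁, β₁₂, β₂₁, β₂₂, hφ, b11, b12, b21, b22, fun p hp => ?_⟩
  obtain ⟨⟨z1, z2⟩, z3, z4⟩ := hT.eq_zero hΩ hu hc₂ hc₃ t1 t2 (fun p hp => sb (v11 p hp))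
    (fun p hp => sb (v12 p hp)) (fun p hp => sb (v21 p hp)) (fun p hp => sb (v22 p hp))
    (fun p hp => sb (w11 p hp)) (fun p hp => sb (w22 p hp)) hp
  exact ⟨⟨v11 p hp, v12 p hp, w11 p hp, bs z1, bs z2⟩,
    ⟨v21 p hp, v22 p hp, bs z3, w22 p hp, bs z4⟩⟩

end

/-! ### Degree one fluxes and the deformations they generate -/

section

variable (c : ℝ) (b₁ b₂ β₁₁ β₁₂ β₂₁ β₂₂ : ℝ × ℝ → ℝ)

/-- A degree one polynomial in the jets of the Riemann invariants, as a function of jets. -/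
def riem1 (j : Jet) : ℝ := b₁ j.1 * xi1 c j + b₂ j.1 * xi2 c j

/-- Variation of `riem1`. -/
def driem1 (j δ : Jet) : ℝ :=
  (D1 c b₁ j.1 * L1 c j.1 δ.1 + D2 c b₁ j.1 * L2 c j.1 δ.1) * xi1 c j + b₁ j.1 * dxi1 c j δ
    + ((D1 c b₂ j.1 * L1 c j.1 δ.1 + D2 c b₂ j.1 * L2 c j.1 δ.1) * xi2 c j + b₂ j.1 * dxi2 c j δ)

/-- The degree one flux with the given components in the Riemann frame. -/
def riemFlux1 (j : Jet) : ℝ × ℝ :=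
  ((riem1 c β₂₁ β₂₂ j - riem1 c β₁₁ β₁₂ j) / j.1.1,
    2 * (c + 1) * riem1 c β₂₁ β₂₂ j - (2 * c + 1) * riem1 c β₁₁ β₁₂ j)

/-- Variation of `riemFlux1`. -/
def driemFlux1 (j δ : Jet) : ℝ × ℝ :=
  ((driem1 c β₂₁ β₂₂ j δ - driem1 c β₁₁ β₁₂ j δ) / j.1.1
      - (riem1 c β₂₁ β₂₂ j - riem1 c β₁₁ β₁₂ j) * δ.1.1 / j.1.1 ^ 2,
    2 * (c + 1) * driem1 c β₂₁ β₂₂ j δ - (2 * c + 1) * driem1 c β₁₁ β₁₂ j δ)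

/-- First original component of a degree one flux given in the Riemann frame. -/
def unframe1₁ : Poly1 where
  ux p := -(2 * (c + 1) * (β₂₁ p - β₁₁ p)) - (2 * c + 1) * (β₂₂ p - β₁₂ p)
  vx p := (β₂₁ p + β₂₂ p - β₁₁ p - β₁₂ p) / p.1

/-- Second original component of a degree one flux given in the Riemann frame. -/
def unframe1₂ : Poly1 where
  ux p := -(2 * (c + 1) * p.1 * (2 * (c + 1) * β₂₁ p - (2 * c + 1) * β₁₁ p))
    - (2 * c + 1) * p.1 * (2 * (c + 1) * β₂₂ p - (2 * c + 1) * β₁₂ p)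
  vx p := 2 * (c + 1) * (β₂₁ p + β₂₂ p) - (2 * c + 1) * (β₁₁ p + β₁₂ p)

end

section

variable {c : ℝ} {Ω : Set (ℝ × ℝ)} {b₁ b₂ β₁₁ β₁₂ β₂₁ β₂₂ : ℝ × ℝ → ℝ}

lemma unframe1_smoothOn (hu : ∀ p ∈ Ω, p.1 ≠ 0) (h₁₁ : ContDiffOn ℝ ∞ β₁₁ Ω)
    (h₁₂ : ContDiffOn ℝ ∞ β₁₂ Ω) (h₂₁ : ContDiffOn ℝ ∞ β₂₁ Ω) (h₂₂ : ContDiffOn ℝ ∞ β₂₂ Ω) :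
    (unframe1₁ c β₁₁ β₁₂ β₂₁ β₂₂).SmoothOn Ω ∧ (unframe1₂ c β₁₁ β₁₂ β₂₁ β₂₂).SmoothOn Ω := by
  refine ⟨⟨?_, ?_⟩, ?_, ?_⟩
  · simp only [unframe1₁]; fun_prop
  · exact (((h₂₁.add h₂₂).sub h₁₁).sub h₁₂).div contDiffOn_fst hu
  · simp only [unframe1₂]; fun_prop
  · simp only [unframe1₂]; fun_prop

lemma flux1_unframe1 (hu : ∀ p ∈ Ω, p.1 ≠ 0) :
    Set.EqOn (flux1 (unframe1₁ c β₁₁ β₁₂ β₂₁ β₂₂) (unframe1₂ c β₁₁ β₁₂ β₂₁ β₂₂))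
      (riemFlux1 c β₁₁ β₁₂ β₂₁ β₂₂) (jetDomain Ω) := by
  intro j hj
  have h : j.1.1 ≠ 0 := hu _ hj
  simp only [flux1, riemFlux1, riem1, Poly1.onJet, unframe1₁, unframe1₂, xi1, xi2]
  ext
  · simp only; field_simp; ring
  · simp only; ring

lemma contDiffOn_riem1 (h₁ : ContDiffOn ℝ ∞ b₁ Ω) (h₂ : ContDiffOn ℝ ∞ b₂ Ω) :
    ContDiffOn ℝ ∞ (riem1 c b₁ b₂) (jetDomain Ω) := by
  have x1 : ContDiff ℝ ∞ (xi1 c) := by unfold xi1; fun_prop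
  have x2 : ContDiff ℝ ∞ (xi2 c) := by unfold xi2; fun_prop
  exact ((contDiffOn_coeff h₁).mul x1.contDiffOn).add ((contDiffOn_coeff h₂).mul x2.contDiffOn)

lemma contDiffOn_riemFlux1 (hu : ∀ p ∈ Ω, p.1 ≠ 0) (h₁₁ : ContDiffOn ℝ ∞ β₁₁ Ω)
    (h₁₂ : ContDiffOn ℝ ∞ β₁₂ Ω) (h₂₁ : ContDiffOn ℝ ∞ β₂₁ Ω) (h₂₂ : ContDiffOn ℝ ∞ β₂₂ Ω) :
    ContDiffOn ℝ ∞ (riemFlux1 c β₁₁ β₁₂ β₂₁ β₂₂) (jetDomain Ω) := by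
  have h₁ := contDiffOn_riem1 (c := c) h₁₁ h₁₂
  have h₂ := contDiffOn_riem1 (c := c) h₂₁ h₂₂
  unfold riemFlux1
  refine ContDiffOn.prodMk ?_ (by fun_prop)
  exact (h₂.sub h₁).div (by fun_prop) fun j hj => hu _ hj

lemma hasDerivAt_riem1 (hΩ : IsOpen Ω) (hu : ∀ p ∈ Ω, p.1 ≠ 0) (h₁ : ContDiffOn ℝ ∞ b₁ Ω)
    (h₂ : ContDiffOn ℝ ∞ b₂ Ω) {γ : ℝ → Jet} {δ : Jet} {s : ℝ} (hγ : HasDerivAt γ δ s)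
    (hs : (γ s).1 ∈ Ω) :
    HasDerivAt (fun t => riem1 c b₁ b₂ (γ t)) (driem1 c b₁ b₂ (γ s) δ) s := by
  have hγ1 : HasDerivAt (fun t => (γ t).1) δ.1 s := hγ.fst
  have k₁ := HasD.comp_hasDerivAt (γ := fun t => (γ t).1)
    (hasD_of_contDiffOn (c := c) hΩ hu h₁ hs) hγ1
  have k₂ := HasD.comp_hasDerivAt (γ := fun t => (γ t).1)
    (hasD_of_contDiffOn (c := c) hΩ hu h₂ hs) hγ1
  exact (k₁.mul (hasDerivAt_xi1 hγ)).add (k₂.mul (hasDerivAt_xi2 hγ))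

lemma hasDerivAt_riemFlux1 (hΩ : IsOpen Ω) (hu : ∀ p ∈ Ω, p.1 ≠ 0) (h₁₁ : ContDiffOn ℝ ∞ β₁₁ Ω)
    (h₁₂ : ContDiffOn ℝ ∞ β₁₂ Ω) (h₂₁ : ContDiffOn ℝ ∞ β₂₁ Ω) (h₂₂ : ContDiffOn ℝ ∞ β₂₂ Ω)
    {γ : ℝ → Jet} {δ : Jet} {s : ℝ} (hγ : HasDerivAt γ δ s) (hs : (γ s).1 ∈ Ω) :
    HasDerivAt (fun t => riemFlux1 c β₁₁ β₁₂ β₂₁ β₂₂ (γ t))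
      (driemFlux1 c β₁₁ β₁₂ β₂₁ β₂₂ (γ s) δ) s := by
  have d1 := hasDerivAt_riem1 (c := c) hΩ hu h₁₁ h₁₂ hγ hs
  have d2 := hasDerivAt_riem1 (c := c) hΩ hu h₂₁ h₂₂ hγ hs
  obtain ⟨-, u, -⟩ := hasDerivAt_components hγ
  have hne := hu _ hs
  refine HasDerivAt.prodMk (((d2.sub d1).div u hne).congr_deriv ?_)
    ((d2.const_mul _).sub (d1.const_mul _))
  simp only [Pi.sub_apply]
  field_simp

lemma fderiv_riemFlux1 (hΩ : IsOpen Ω) (hu : ∀ p ∈ Ω, p.1 ≠ 0) (h₁₁ : ContDiffOn ℝ ∞ β₁₁ Ω)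
    (h₁₂ : ContDiffOn ℝ ∞ β₁₂ Ω) (h₂₁ : ContDiffOn ℝ ∞ β₂₁ Ω) (h₂₂ : ContDiffOn ℝ ∞ β₂₂ Ω)
    {j : Jet} (hj : j.1 ∈ Ω) (δ : Jet) :
    fderiv ℝ (riemFlux1 c β₁₁ β₁₂ β₂₁ β₂₂) j δ = driemFlux1 c β₁₁ β₁₂ β₂₁ β₂₂ j δ := by
  have h := (differentiableAt_flux hΩ (contDiffOn_riemFlux1 (c := c) hu h₁₁ h₁₂ h₂₁ h₂₂)
    hj).hasFDerivAt
  have l : HasDerivAt (fun s : ℝ => j + s • δ) δ 0 := by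
    simpa using ((hasDerivAt_id (0:ℝ)).smul_const δ).const_add j
  have a := hasDerivAt_riemFlux1 (c := c) hΩ hu h₁₁ h₁₂ h₂₁ h₂₂ l (by simpa using hj)
  have h' : HasFDerivAt (riemFlux1 c β₁₁ β₁₂ β₂₁ β₂₂)
      (fderiv ℝ (riemFlux1 c β₁₁ β₁₂ β₂₁ β₂₂) j) (j + (0:ℝ) • δ) := by
    simpa using h
  have b := h'.comp_hasDerivAt (0:ℝ) l
  simpa using b.unique a

/-- The bracket of a degree one flux with a diagonal one. -/
lemma bracket_riemFlux1 (hΩ : IsOpen Ω) (hu : ∀ p ∈ Ω, p.1 ≠ 0) {f : ℝ × ℝ → ℝ × ℝ}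
    {μ₁ μ₂ : ℝ × ℝ → ℝ} (h : IsDiagonal c Ω f μ₁ μ₂) (h₁₁ : ContDiffOn ℝ ∞ β₁₁ Ω)
    (h₁₂ : ContDiffOn ℝ ∞ β₁₂ Ω) (h₂₁ : ContDiffOn ℝ ∞ β₂₁ Ω) (h₂₂ : ContDiffOn ℝ ∞ β₂₂ Ω)
    {q : Curve} (hq : ContDiff ℝ ∞ q) {y : ℝ} (hy : q y ∈ Ω) :
    bracket (riemFlux1 c β₁₁ β₁₂ β₂₁ β₂₂) (pointFlux f) q y
      = riemFlux c (gauge₁ c β₁₁ β₁₂ β₂₁ β₂₂ μ₁ μ₂) (gauge₂ c β₁₁ β₁₂ β₂₁ β₂₂ μ₁ μ₂)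
        (jet q y) := by
  have hne := hu _ hy
  have hl : flow (riemFlux1 c β₁₁ β₁₂ β₂₁ β₂₂) q y
      = driemFlux1 c β₁₁ β₁₂ β₂₁ β₂₂ (jet q y) (jet (deriv q) y) :=
    (hasDerivAt_riemFlux1 hΩ hu h₁₁ h₁₂ h₂₁ h₂₂ (hasDerivAt_jet hq.contDiffAt) hy).deriv
  obtain ⟨⟨c1, a1, -⟩, c2, b1, -⟩ := h.transport_jet hΩ hu hq hy rfl
    ((h.isSpeedPair hΩ hu).speedJet_eq hΩ hu hq hy).symm rfl
  have hs : (flow (pointFlux f) q y).1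
      = (μ₂ (q y) * xi2 c (jet q y) - μ₁ (q y) * xi1 c (jet q y)) / (q y).1 := by
    rw [flow_pointFlux hΩ h.smooth hq hy, h.fderiv_apply hy]
    simp only [L1_apply, L2_apply, xi1, xi2, jet]
  have hs' : (deriv q y).1 = (xi2 c (jet q y) - xi1 c (jet q y)) / (q y).1 := by
    simp only [xi1, xi2, jet]
    field_simp
    ring
  have e1 : L1 c (q y) (deriv q y) = xi1 c (jet q y) := by simp [xi1, jet]
  have e2 : L2 c (q y) (deriv q y) = xi2 c (jet q y) := by simp [xi2, jet]
  have e3 : dxi1 c (jet q y) (jet (deriv q) y) = eta1 c (jet q y) := by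
    simp only [dxi1, eta1, jet]; ring
  have e4 : dxi2 c (jet q y) (jet (deriv q) y) = eta2 c (jet q y) := by
    simp only [dxi2, eta2, jet]; ring
  have j1 : (jet q y).1 = q y := rfl
  have j2 : (jet (deriv q) y).1 = deriv q y := rfl
  have j3 : (jet (flow (pointFlux f) q) y).1 = flow (pointFlux f) q y := rfl
  have g : gap μ₁ μ₂ (q y) = (μ₁ (q y) - μ₂ (q y)) / (q y).1 ^ 2 := by
    simp only [gap, rho]; ring
  unfold bracket
  rw [fderiv_riemFlux1 hΩ hu h₁₁ h₁₂ h₂₁ h₂₂ hy, fderiv_pointFlux hΩ h.smooth hy, j1,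
    h.fderiv_apply hy]
  have j4 : (jet (flow (riemFlux1 c β₁₁ β₁₂ β₂₁ β₂₂) q) y).1
      = driemFlux1 c β₁₁ β₁₂ β₂₁ β₂₂ (jet q y) (jet (deriv q) y) := hl
  rw [j4]
  simp only [j3] at c1 c2
  simp only [driemFlux1, driem1, riemFlux, j1, j2, j3, a1, b1, c1, c2, e1, e2, e3, e4, hs, hs']
  simp only [L1_apply, L2_apply, riem1, j1, Poly2.riem, Poly2.val, gauge₁, gauge₂, speedNum,
    invJet, g]
  generalize xi1 c (jet q y) = x₁
  generalize xi2 c (jet q y) = x₂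
  generalize eta1 c (jet q y) = n₁
  generalize eta2 c (jet q y) = n₂
  generalize (q y).1 = u at hne
  ext
  · simp only [Prod.fst_sub]
    field_simp
    ring
  · simp only [Prod.snd_sub]
    field_simp
    ring

end

/-! ### Derivatives with parameters and quadratic smallness -/

section Calculus

variable {E : Type*} [NormedAddCommGroup E] [NormedSpace ℝ E]

lemma eventually_contDiffAt_section {Γ : ℝ × ℝ → E} {s x : ℝ} (h : ContDiffAt ℝ ∞ Γ (s, x)) :
    ∀ᶠ t in 𝓝 s, ContDiffAt ℝ 1 Γ (t, x) := by
  have h1 : ∀ᶠ z in 𝓝 (s, x), ContDiffAt ℝ 1 Γ z :=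
    (h.of_le (by exact_mod_cast le_top) : ContDiffAt ℝ 1 Γ (s, x)).eventually (by simp)
  have c1 : Tendsto (fun t : ℝ => ((t, x) : ℝ × ℝ)) (𝓝 s) (𝓝 (s, x)) :=
    (Continuous.prodMk continuous_id continuous_const).tendsto' _ _ rfl
  exact c1.eventually h1

lemma differentiableAt_section {Γ : ℝ × ℝ → E} {t x : ℝ} (h : ContDiffAt ℝ 1 Γ (t, x)) :
    DifferentiableAt ℝ (fun y => Γ (t, y)) x :=
  (h.differentiableAt one_ne_zero).comp x
    ((differentiableAt_const t).prodMk differentiableAt_id)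

/-- Partial derivatives depend smoothly on parameters. -/
lemma contDiffAt_deriv_section {Γ : ℝ × ℝ → E} {s x : ℝ} (h : ContDiffAt ℝ ∞ Γ (s, x)) :
    ContDiffAt ℝ ∞ (fun t => deriv (fun y => Γ (t, y)) x) s := by
  have e : (fun t => deriv (fun y => Γ (t, y)) x) =ᶠ[𝓝 s] fun t => fderiv ℝ Γ (t, x) (0, 1) := by
    filter_upwards [eventually_contDiffAt_section h] with t ht
    exact ((ht.differentiableAt one_ne_zero).hasFDerivAt.comp_hasDerivAt x
      ((hasDerivAt_const x t).prodMk (hasDerivAt_id x))).deriv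
  refine ContDiffAt.congr_of_eventuallyEq ?_ e
  have h1 : ContDiffAt ℝ ∞ (fderiv ℝ Γ) (s, x) := h.fderiv_right (by simp)
  exact (ContDiffAt.comp (f := fun t : ℝ => ((t, x) : ℝ × ℝ)) s h1
    (contDiffAt_id.prodMk contDiffAt_const)).clm_apply contDiffAt_const

/-- A function vanishing to first order is quadratically small. -/
lemma isBigO_sq_of_deriv_eq_zero {L : ℝ → E} (h : ContDiffAt ℝ ∞ L 0) (h0 : L 0 = 0)
    (h1 : deriv L 0 = 0) : L =O[𝓝 0] fun t : ℝ => t ^ 2 := by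
  have hd := ((contDiffAt_deriv h).differentiableAt (by simp)).isBigO_sub
  simp only [h1, sub_zero] at hd
  obtain ⟨C, hC⟩ := hd.bound
  obtain ⟨δ, hδ, hb⟩ := Metric.eventually_nhds_iff.1 (hC.and (eventually_contDiffAt h))
  refine IsBigO.of_bound C ?_
  filter_upwards [Metric.ball_mem_nhds (0 : ℝ) hδ] with t ht
  have key := (convex_closedBall (0 : ℝ) |t|).norm_image_sub_le_of_norm_deriv_le (f := L)
    (C := C * |t|) (x := 0) (y := t) (fun y hy => ?_) (fun y hy => ?_)
    (by simp) (by simp)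
  · simpa [h0, pow_two, mul_assoc] using key
  · have hy' : |y| ≤ |t| := by simpa using hy
    have ht' : |t| < δ := by simpa using ht
    exact ((hb (by simpa using hy'.trans_lt ht')).2).differentiableAt one_ne_zero
  · have hy' : |y| ≤ |t| := by simpa using hy
    have ht' : |t| < δ := by simpa using ht
    have k := (hb (y := y) (by simpa using hy'.trans_lt ht')).1
    rw [Real.norm_eq_abs] at k
    refine k.trans ?_
    rcases le_or_gt 0 C with hC0 | hC0
    · gcongr
    -- The constant obtained from the bound might be negative; the estimate then forces y = 0.
    · have hz : |y| = 0 := by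
        by_contra hne
        have : 0 < |y| := lt_of_le_of_ne (abs_nonneg y) (Ne.symm hne)
        nlinarith [norm_nonneg (deriv L y)]
      have k2 := (hb (y := t) (by simpa using ht')).1
      rw [Real.norm_eq_abs] at k2
      rw [hz, mul_zero]
      exact (norm_nonneg _).trans k2

end Calculus

/-! ### The second-order effect of a Miura transformation -/

section Miura

variable {Ω : Set (ℝ × ℝ)} {F G α α' : Jet → ℝ × ℝ} {q h : Curve} {x : ℝ}

/-- `variation` is a `deriv`, so its value alone does not give differentiability. This is needed to
split the variation of `miura` into a sum. -/
lemma hasDerivAt_variation_flow (hΩ : IsOpen Ω) (hG : ContDiffOn ℝ ∞ G (jetDomain Ω))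
    (hq : ContDiffAt ℝ ∞ q x) (hh : ContDiffAt ℝ ∞ h x) (hx : q x ∈ Ω) :
    HasDerivAt (fun s : ℝ => flow G (q + s • h) x)
      (deriv (fun y => fderiv ℝ G (jet q y) (jet h y)) x) 0 := by
  have hGx := eventually_contDiffAt_infty (isOpen_jetDomain hΩ) hG (x := jet q x) hx
  have e1 : ∀ s : ℝ, flow G (q + s • h) x = deriv (fun y => G (jet q y + s • jet h y)) x := by
    intro s
    refine Filter.EventuallyEq.deriv_eq ?_
    filter_upwards [eventually_jet_add_smul hq hh] with y hy
    rw [hy s]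
  have e2 : ContDiffAt ℝ ∞ (fun z : ℝ × ℝ => G (jet q z.2 + z.1 • jet h z.2)) (0, x) := by
    have a : ContDiffAt ℝ ∞ (fun z : ℝ × ℝ => jet q z.2 + z.1 • jet h z.2) (0, x) :=
      ((contDiffAt_jet hq).comp (0, x) contDiffAt_snd).add
        (contDiffAt_fst.smul ((contDiffAt_jet hh).comp (0, x) contDiffAt_snd))
    refine ContDiffAt.comp (0, x) ?_ a
    simpa using hGx
  have d : DifferentiableAt ℝ (fun s : ℝ => flow G (q + s • h) x) 0 := by
    simp_rw [e1]
    exact (contDiffAt_deriv_section e2).differentiableAt (by simp)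
  rw [← variation_flow hΩ hG hq hh hx]
  exact d.hasDerivAt

/-- A deformation and its image under the Miura transformation generated by a flux `G`. -/
lemma transforms_of_bracket (hΩ : IsOpen Ω) (hF : ContDiffOn ℝ ∞ F (jetDomain Ω))
    (hG : ContDiffOn ℝ ∞ G (jetDomain Ω)) (hα : ContDiffOn ℝ ∞ α (jetDomain Ω))
    (hα' : ContDiffOn ℝ ∞ α' (jetDomain Ω))
    (H : ∀ q : Curve, ContDiff ℝ ∞ q → ∀ y, q y ∈ Ω →
      α' (jet q y) = α (jet q y) + bracket G F q y) :
    Transforms Ω (fun _ _ => 0) (flow G) (fun ε => flow fun j => F j + ε ^ 2 • α j)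
      (fun ε => flow fun j => F j + ε ^ 2 • α' j) := by
  intro q hq x hx
  have jO := isOpen_jetDomain hΩ
  have hqx := hq.contDiffAt (x := x)
  have f0 := contDiffAt_flow hΩ hF hqx hx
  have f2 := contDiffAt_flow hΩ hα hqx hx
  have gY := contDiffAt_flow hΩ hG hqx hx
  have sF := eventually_contDiffAt_infty jO hF (x := jet q x) hx
  have sG := eventually_contDiffAt_infty jO hG (x := jet q x) hx
  have sα := eventually_contDiffAt_infty jO hα (x := jet q x) hx
  have sα' := eventually_contDiffAt_infty jO hα' (x := jet q x) hx
  -- Put t = ε². `K₁` is the old flux, t K₂ the contribution of the variation of `G` along the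
  -- deformed flow, and `K₃` the new flux on the transformed curve. The defect to be estimated is ∂ₓ
  -- of K₁ + t K₂ − K₃.
  let K₁ : ℝ × ℝ → ℝ × ℝ := fun z => F (jet q z.2) + z.1 • α (jet q z.2)
  let K₂ : ℝ × ℝ → ℝ × ℝ := fun z =>
    fderiv ℝ G (jet q z.2) (jet (flow F q) z.2 + z.1 • jet (flow α q) z.2)
  let K₃ : ℝ × ℝ → ℝ × ℝ := fun z => F (jet q z.2 + z.1 • jet (flow G q) z.2)
    + z.1 • α' (jet q z.2 + z.1 • jet (flow G q) z.2)
  have c2 : ∀ {g : ℝ → Jet}, ContDiffAt ℝ ∞ g x →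
      ContDiffAt ℝ ∞ (fun z : ℝ × ℝ => g z.2) ((0, x) : ℝ × ℝ) :=
    fun hg => hg.comp ((0, x) : ℝ × ℝ) contDiffAt_snd
  have cw : ContDiffAt ℝ ∞ (fun z : ℝ × ℝ => jet q z.2 + z.1 • jet (flow G q) z.2) (0, x) :=
    (c2 (contDiffAt_jet hqx)).add (contDiffAt_fst.smul (c2 (contDiffAt_jet gY)))
  have k1 : ContDiffAt ℝ ∞ K₁ (0, x) :=
    (ContDiffAt.comp ((0, x) : ℝ × ℝ) sF (c2 (contDiffAt_jet hqx))).add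
      (contDiffAt_fst.smul (ContDiffAt.comp ((0, x) : ℝ × ℝ) sα (c2 (contDiffAt_jet hqx))))
  have k2 : ContDiffAt ℝ ∞ K₂ (0, x) :=
    (ContDiffAt.comp ((0, x) : ℝ × ℝ) (sG.fderiv_right (m := ∞) (by simp))
      (c2 (contDiffAt_jet hqx))).clm_apply
      ((c2 (contDiffAt_jet f0)).add (contDiffAt_fst.smul (c2 (contDiffAt_jet f2))))
  have k3 : ContDiffAt ℝ ∞ K₃ (0, x) :=
    (ContDiffAt.comp ((0, x) : ℝ × ℝ) (by simpa using sF) cw).add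
      (contDiffAt_fst.smul (ContDiffAt.comp ((0, x) : ℝ × ℝ) (by simpa using sα') cw))
  let K : ℝ × ℝ → ℝ × ℝ := fun z => K₁ z + z.1 • K₂ z - K₃ z
  have k : ContDiffAt ℝ ∞ K (0, x) := (k1.add (contDiffAt_fst.smul k2)).sub k3
  have ev := eventually_mem hΩ hqx hx
  have z0 : ∀ y, K (0, y) = 0 := fun y => by simp [K, K₁, K₃]
  -- The t-derivative at 0 is α + {G, F} − α', which is zero by `H`.
  have z1 : (fun y => deriv (fun t => K (t, y)) 0) =ᶠ[𝓝 x] fun _ => 0 := by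
    filter_upwards [ev] with y hy
    have dF := (differentiableAt_flux hΩ hF (j := jet q y) hy).hasFDerivAt
    have dα := differentiableAt_flux hΩ hα' (j := jet q y) hy
    have l : HasDerivAt (fun t : ℝ => jet q y + t • jet (flow G q) y) (jet (flow G q) y) 0 := by
      simpa using ((hasDerivAt_id (0:ℝ)).smul_const (jet (flow G q) y)).const_add (jet q y)
    have dF' : HasFDerivAt F (fderiv ℝ F (jet q y)) (jet q y + (0:ℝ) • jet (flow G q) y) := by
      simpa using dF
    have dα' : HasFDerivAt α' (fderiv ℝ α' (jet q y)) (jet q y + (0:ℝ) • jet (flow G q) y) := by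
      simpa using dα.hasFDerivAt
    have i := hasDerivAt_id (0 : ℝ)
    have h1 : HasDerivAt (fun t => K₁ (t, y)) _ 0 :=
      (i.smul_const (α (jet q y))).const_add (F (jet q y))
    have h2 : HasDerivAt (fun t => K₂ (t, y)) _ 0 :=
      (fderiv ℝ G (jet q y)).hasFDerivAt.comp_hasDerivAt (0 : ℝ)
        ((i.smul_const (jet (flow α q) y)).const_add (jet (flow F q) y))
    have h3 : HasDerivAt (fun t => K₃ (t, y)) _ 0 :=
      (dF'.comp_hasDerivAt (0 : ℝ) l).add (i.smul (dα'.comp_hasDerivAt (0 : ℝ) l))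
    have hK : HasDerivAt (fun t => K (t, y)) _ 0 := (h1.add (i.smul h2)).sub h3
    rw [hK.deriv]
    simp only [K₂, id, zero_smul, one_smul, zero_add, add_zero, H q hq y hy, bracket]
    abel
  let L : ℝ → ℝ × ℝ := fun t => deriv (fun y => K (t, y)) x
  have hL : L =O[𝓝 0] fun t : ℝ => t ^ 2 := by
    refine isBigO_sq_of_deriv_eq_zero (contDiffAt_deriv_section k) ?_ ?_
    · simp only [L, z0, deriv_const]
    · simp only [L]
      rw [deriv_deriv_swap k, z1.deriv_eq, deriv_const]
  have hsq : Tendsto (fun ε : ℝ => ε ^ 2) (𝓝 0) (𝓝 0) :=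
    (continuous_pow 2).tendsto' _ _ (by simp)
  have e : (fun ε : ℝ => variation (miura (fun _ _ => 0) (flow G) ε) q
      (flow (fun j => F j + ε ^ 2 • α j) q) x
      - flow (fun j => F j + ε ^ 2 • α' j) (miura (fun _ _ => 0) (flow G) ε q) x)
      =ᶠ[𝓝 0] fun ε => L (ε ^ 2) := by
    filter_upwards [hsq.eventually (eventually_contDiffAt_section k1),
      hsq.eventually (eventually_contDiffAt_section k2),
      hsq.eventually (eventually_contDiffAt_section k3)] with ε e1 e2 e3
    have d1 := differentiableAt_section e1
    have d2 := differentiableAt_section e2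
    have d3 := differentiableAt_section e3
    have hL' : L (ε ^ 2) = deriv (fun y => K₁ (ε ^ 2, y)) x
        + ε ^ 2 • deriv (fun y => K₂ (ε ^ 2, y)) x - deriv (fun y => K₃ (ε ^ 2, y)) x :=
      ((d1.hasDerivAt.add (d2.hasDerivAt.const_smul (ε ^ 2))).sub d3.hasDerivAt).deriv
    have hh := flow_add_smul hΩ hF hα (ε ^ 2) hq hx
    have hs : ContDiffAt ℝ ∞ (flow (fun j => F j + ε ^ 2 • α j) q) x :=
      ContDiffAt.congr_of_eventuallyEq (f0.add (contDiffAt_const.smul f2)) hh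
    have v := hasDerivAt_variation_flow hΩ hG hqx hs hx
    have v' : variation (miura (fun _ _ => 0) (flow G) ε) q (flow (fun j => F j + ε ^ 2 • α j) q) x
        = flow (fun j => F j + ε ^ 2 • α j) q x
          + ε ^ 2 • deriv (fun y => fderiv ℝ G (jet q y)
            (jet (flow (fun j => F j + ε ^ 2 • α j) q) y)) x := by
      have l : HasDerivAt (fun s : ℝ => q x + s • flow (fun j => F j + ε ^ 2 • α j) q x)
          (flow (fun j => F j + ε ^ 2 • α j) q x) 0 := by
        simpa using ((hasDerivAt_id (0:ℝ)).smul_const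
          (flow (fun j => F j + ε ^ 2 • α j) q x)).const_add (q x)
      refine (HasDerivAt.congr_of_eventuallyEq (l.add (v.const_smul (ε ^ 2)))
        (Eventually.of_forall fun s => ?_)).deriv
      simp [miura]
    have w2 : (fun y => fderiv ℝ G (jet q y) (jet (flow (fun j => F j + ε ^ 2 • α j) q) y))
        =ᶠ[𝓝 x] fun y => K₂ (ε ^ 2, y) := by
      filter_upwards [jet_eventuallyEq hh, eventually_jet_add_smul f0 f2] with y h1 h2
      rw [h1, h2]
    have w3 : (fun y => F (jet (miura (fun _ _ => 0) (flow G) ε q) y)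
        + ε ^ 2 • α' (jet (miura (fun _ _ => 0) (flow G) ε q) y))
        =ᶠ[𝓝 x] fun y => K₃ (ε ^ 2, y) := by
      have : miura (fun _ _ => 0) (flow G) ε q = q + ε ^ 2 • flow G q := by
        funext y
        simp [miura]
      filter_upwards [eventually_jet_add_smul hqx gY] with y h1
      rw [this, h1]
    rw [hL', v', w2.deriv_eq]
    congr 1
    exact w3.deriv_eq
  refine e.trans_isBigO ?_
  -- The defect is O(t²) = O(ε⁴), more than the required O(ε³).
  refine (hL.comp_tendsto hsq).trans ?_
  refine IsBigO.of_bound 1 ?_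
  filter_upwards [Metric.ball_mem_nhds (0 : ℝ) one_pos] with ε hε
  have hε' : |ε| < 1 := by simpa using hε
  simp only [Function.comp, norm_pow, Real.norm_eq_abs, one_mul]
  calc (|ε| ^ 2) ^ 2 = |ε| ^ 3 * |ε| := by ring
    _ ≤ |ε| ^ 3 * 1 := by gcongr
    _ = |ε| ^ 3 := mul_one _

end Miura

/-! ### Reduction of integrable deformations to normal form -/

section

variable {c : ℝ} {Ω : Set (ℝ × ℝ)}

lemma bracket_congr_left (hΩ : IsOpen Ω) {G G' H : Jet → ℝ × ℝ} (hG : Set.EqOn G G' (jetDomain Ω))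
    {q : Curve} (hq : ContDiff ℝ ∞ q) {y : ℝ} (hy : q y ∈ Ω) :
    bracket G H q y = bracket G' H q y := by
  have e1 : fderiv ℝ G (jet q y) = fderiv ℝ G' (jet q y) :=
    (hG.eventuallyEq_of_mem ((isOpen_jetDomain hΩ).mem_nhds hy)).fderiv_eq
  have e2 : jet (flow G q) y = jet (flow G' q) y := by
    refine jet_congr (Filter.EventuallyEq.deriv ?_)
    filter_upwards [eventually_mem hΩ hq.contDiffAt hy] with z hz
    exact hG hz
  simp only [bracket, e1, e2]

/-- The difference of two deformations with the same canonical part. -/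
lemma riemFlux_gauge_sub (hΩ : IsOpen Ω) (hu : ∀ p ∈ Ω, p.1 ≠ 0)
    {β₁₁ β₁₂ β₂₁ β₂₂ γ₁₁ γ₁₂ γ₂₁ γ₂₂ μ₁ μ₂ : ℝ × ℝ → ℝ} (h₁₁ : ContDiffOn ℝ ∞ β₁₁ Ω)
    (h₁₂ : ContDiffOn ℝ ∞ β₁₂ Ω) (h₂₁ : ContDiffOn ℝ ∞ β₂₁ Ω) (h₂₂ : ContDiffOn ℝ ∞ β₂₂ Ω)
    (k₁₁ : ContDiffOn ℝ ∞ γ₁₁ Ω) (k₁₂ : ContDiffOn ℝ ∞ γ₁₂ Ω) (k₂₁ : ContDiffOn ℝ ∞ γ₂₁ Ω)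
    (k₂₂ : ContDiffOn ℝ ∞ γ₂₂ Ω) (C₁ C₂ : Poly2) {j : Jet} (hj : j.1 ∈ Ω) :
    riemFlux c (C₁.add (gauge₁ c γ₁₁ γ₁₂ γ₂₁ γ₂₂ μ₁ μ₂)) (C₂.add (gauge₂ c γ₁₁ γ₁₂ γ₂₁ γ₂₂ μ₁ μ₂)) j
      = riemFlux c (C₁.add (gauge₁ c β₁₁ β₁₂ β₂₁ β₂₂ μ₁ μ₂))
          (C₂.add (gauge₂ c β₁₁ β₁₂ β₂₁ β₂₂ μ₁ μ₂)) j
        + riemFlux c (gauge₁ c (fun p => γ₁₁ p - β₁₁ p) (fun p => γ₁₂ p - β₁₂ p)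
            (fun p => γ₂₁ p - β₂₁ p) (fun p => γ₂₂ p - β₂₂ p) μ₁ μ₂)
          (gauge₂ c (fun p => γ₁₁ p - β₁₁ p) (fun p => γ₁₂ p - β₁₂ p)
            (fun p => γ₂₁ p - β₂₁ p) (fun p => γ₂₂ p - β₂₂ p) μ₁ μ₂) j := by
  have k : ∀ {g h : ℝ × ℝ → ℝ}, ContDiffOn ℝ ∞ g Ω → ContDiffOn ℝ ∞ h Ω →
      HasD c (fun p => g p - h p) j.1 (D1 c g j.1 - D1 c h j.1) (D2 c g j.1 - D2 c h j.1) :=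
    fun hg hh => (hasD_of_contDiffOn hΩ hu hg hj).sub (hasD_of_contDiffOn hΩ hu hh hj)
  have hp := hu _ hj
  simp only [riemFlux, Poly2.riem, Poly2.val_add]
  simp only [Poly2.val, gauge₁, gauge₂, (k k₁₁ h₁₁).d2 hp, (k k₁₂ h₁₂).d2 hp, (k k₂₁ h₂₁).d1 hp,
    (k k₂₂ h₂₂).d1 hp]
  ext
  · simp only [Prod.fst_add]; ring
  · simp only [Prod.snd_add]; ring

/-- Every integrable deformation is equivalent to a normal form. -/
lemma IsIntegrable.exists_transforms (hc₁ : c ≠ -3 / 4) (hc₂ : c ≠ -1 / 2) (hc₃ : c ≠ -1)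
    (hΩ : IsOpen Ω) (hu : ∀ p ∈ Ω, p.1 ≠ 0) {a₁ a₂ : Poly2} (h₁ : a₁.SmoothOn Ω)
    (h₂ : a₂.SmoothOn Ω) (h : IsIntegrable c Ω a₁ a₂) :
    ∃ (β₁ β₂ : Poly1) (φ₁ φ₂ : ℝ × ℝ → ℝ), β₁.SmoothOn Ω ∧ β₂.SmoothOn Ω ∧
      IsParameterPair c Ω φ₁ φ₂ ∧
      Transforms Ω (fun _ _ => 0) (fun q => deriv (op1 β₁ β₂ q)) (deformedPrimary c a₁ a₂)
        (normalFlow c (normalParam c φ₁ φ₂)) := by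
  obtain ⟨E₁, E₂, hE₁, hE₂, hE⟩ := h.exists_commutesCubic hΩ hu h₁ h₂
  obtain ⟨φ₁, φ₂, β₁₁, β₁₂, β₂₁, β₂₂, hφ, b₁₁, b₁₂, b₂₁, b₂₂, hA⟩ := hE.exists_eq hΩ hu hc₂ hc₃
    ⟨frame₁_smoothOn hu h₁ h₂, frame₂_smoothOn hu h₁ h₂⟩ ⟨hE₁, hE₂⟩
  obtain ⟨n₁₁, n₁₂, n₂₁, n₂₂⟩ := normalβ_smoothOn (c := c) hΩ hu hφ.smooth₁ hφ.smooth₂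
  -- The given deformation and the normal form with the same φ have the same canonical part. The
  -- Miura-generated part is linear in β, so the differences of the β generate the transformation.
  have s₁₁ := n₁₁.sub b₁₁
  have s₁₂ := n₁₂.sub b₁₂
  have s₂₁ := n₂₁.sub b₂₁
  have s₂₂ := n₂₂.sub b₂₂
  have hs := unframe1_smoothOn (c := c) hu s₁₁ s₁₂ s₂₁ s₂₂
  have hg := hφ.contDiffOn_normalParam
  refine ⟨_, _, φ₁, φ₂, hs.1, hs.2, hφ, ?_⟩
  have T := transforms_of_bracket hΩ
    (contDiffOn_pointFlux (contDiff_primaryFlux c).contDiffOn) (contDiffOn_flux1 hs.1 hs.2)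
    (contDiffOn_flux2 h₁ h₂) (contDiffOn_flux2 (normal₁_smoothOn hc₁ hc₂ hc₃ hΩ hu hg)
      (normal₂_smoothOn hc₁ hc₂ hc₃ hΩ hu hg)) fun q hq y hy => by
    rw [bracket_congr_left hΩ (flux1_unframe1 hu) hq hy,
      bracket_riemFlux1 hΩ hu (isDiagonal_primaryFlux hu) s₁₁ s₁₂ s₂₁ s₂₂ hq hy,
      riemFlux_frame (c := c) hu (normal₁ c _) _ (show jet q y ∈ jetDomain Ω from hy),
      riemFlux_eqOn (fun p hp => frame_normal hc₁ hc₂ hc₃ hΩ hu hφ (fun _ _ => rfl) hp)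
        (show jet q y ∈ jetDomain Ω from hy),
      riemFlux_frame (c := c) hu a₁ _ (show jet q y ∈ jetDomain Ω from hy),
      riemFlux_eqOn hA (show jet q y ∈ jetDomain Ω from hy)]
    exact riemFlux_gauge_sub hΩ hu b₁₁ b₁₂ b₂₁ b₂₂ n₁₁ n₁₂ n₂₁ n₂₂ _ _ hy
  have e1 : (fun ε : ℝ => flow fun j => pointFlux (primaryFlux c) j + ε ^ 2 • flux2 a₁ a₂ j)
      = deformedPrimary c a₁ a₂ := funext fun ε => (deformedPrimary_eq c a₁ a₂ ε).symm
  have e2 : (fun ε : ℝ => flow fun j => pointFlux (primaryFlux c) j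
      + ε ^ 2 • flux2 (normal₁ c (normalParam c φ₁ φ₂)) (normal₂ c (normalParam c φ₁ φ₂)) j)
      = normalFlow c (normalParam c φ₁ φ₂) := funext fun ε => (deformedPrimary_eq c _ _ ε).symm
  rw [e1, e2] at T
  exact T

end

/-! ### Parabolas and the form of the parameter functions -/

section Level

variable {m : ℝ} {U : Set (ℝ × ℝ)} {k : ℝ × ℝ → ℝ}

lemma contDiff_parabola (m t : ℝ) : ContDiff ℝ ∞ fun u : ℝ => (u, t + m * u ^ 2) := by
  fun_prop

/-- A function whose derivative along the parabolas vanishes is constant on each connected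
piece. -/
lemma eq_of_level_eq (hU : IsOpen U) (hk : ContDiffOn ℝ ∞ k U)
    (h : ∀ p ∈ U, fderiv ℝ k p (1, 2 * m * p.1) = 0)
    (hc : ∀ t, IsPreconnected (U ∩ {p | level m p = t})) {p p' : ℝ × ℝ} (hp : p ∈ U)
    (hp' : p' ∈ U) (e : level m p = level m p') : k p = k p' := by
  let γ : ℝ → ℝ × ℝ := fun u => (u, level m p + m * u ^ 2)
  have key : ∀ r ∈ U, level m r = level m p → γ r.1 = r := fun r _ hr => by
    refine Prod.ext rfl ?_
    change level m p + m * r.1 ^ 2 = r.2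
    rw [← hr, level]
    ring
  have hV : IsOpen (γ ⁻¹' U) := hU.preimage (contDiff_parabola m _).continuous
  have hV' : IsPreconnected (γ ⁻¹' U) := by
    -- A parabola is a graph over the u-axis, so the parameters whose points lie in `U` form the
    -- projection of a level set, connected by `hc`.
    have : γ ⁻¹' U = Prod.fst '' (U ∩ {r | level m r = level m p}) := by
      ext u
      constructor
      · intro hu
        exact ⟨γ u, ⟨hu, by simp [γ, level]⟩, rfl⟩
      · rintro ⟨r, ⟨hr, hr'⟩, rfl⟩
        simpa [key r hr hr'] using hr
    rw [this]
    exact (hc _).image _ continuous_fst.continuousOn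
  have hd : ∀ u ∈ γ ⁻¹' U, HasDerivAt (fun u => k (γ u)) 0 u := by
    intro u hu
    have l : HasDerivAt γ (1, 2 * m * u) u :=
      (hasDerivAt_id u).prodMk
        ((((hasDerivAt_pow 2 u).const_mul m).const_add (level m p)).congr_deriv (by simp; ring))
    have d := ((eventually_contDiffAt_infty hU hk hu).differentiableAt
      (by simp)).hasFDerivAt.comp_hasDerivAt u l
    rwa [h (γ u) hu] at d
  have c := hV.is_const_of_deriv_eq_zero hV'
    (fun u hu => (hd u hu).differentiableAt.differentiableWithinAt) (fun u hu => (hd u hu).deriv)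
    (x := p.1) (y := p'.1) (by simpa [key p hp rfl] using hp)
    (by simpa [key p' hp' e.symm] using hp')
  simpa only [key p hp rfl, key p' hp' e.symm] using c

/-- F is `k` at an arbitrarily chosen point of each level. Since `k` does not depend on the choice,
F is, near the level of p, the restriction of `k` to the vertical line through p, and therefore
smooth. -/
lemma exists_eq_comp_level (hU : IsOpen U) (hk : ContDiffOn ℝ ∞ k U)
    (h : ∀ p ∈ U, fderiv ℝ k p (1, 2 * m * p.1) = 0)
    (hc : ∀ t, IsPreconnected (U ∩ {p | level m p = t})) :
    ∃ F : ℝ → ℝ, ContDiffOn ℝ ∞ F (level m '' U) ∧ ∀ p ∈ U, k p = F (level m p) := by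
  have hF : ∀ p ∈ U, k p = k (Function.invFunOn (level m) U (level m p)) := fun p hp =>
    eq_of_level_eq hU hk h hc hp (Function.invFunOn_mem ⟨p, hp, rfl⟩)
      (Function.invFunOn_eq (f := level m) ⟨p, hp, rfl⟩).symm
  refine ⟨fun t => k (Function.invFunOn (level m) U t), ?_, hF⟩
  rintro _ ⟨p, hp, rfl⟩
  have l : ContDiff ℝ ∞ fun t : ℝ => (p.1, t + m * p.1 ^ 2) := by fun_prop
  have e : (p.1, level m p + m * p.1 ^ 2) = p := Prod.ext rfl (by simp [level])
  have s : ContDiffAt ℝ ∞ (fun t : ℝ => k (p.1, t + m * p.1 ^ 2)) (level m p) :=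
    ContDiffAt.comp (level m p)
      (eventually_contDiffAt_infty hU hk (by rw [e]; exact hp)) l.contDiffAt
  refine (s.congr_of_eventuallyEq ?_).contDiffWithinAt
  filter_upwards [l.continuous.continuousAt.eventually
    (hU.mem_nhds (show (p.1, level m p + m * p.1 ^ 2) ∈ U by rw [e]; exact hp))] with t ht
  have := hF _ ht
  simp only [level, add_sub_cancel_right] at this
  exact this.symm

/-- On a box off the axis u² is monotone in u, so the condition on t + m u² selects an interval of
u. -/
lemma isPreconnected_level_box {a b a' b' : ℝ} (h : 0 < a ∨ b < 0) (m t : ℝ) :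
    IsPreconnected (Set.Ioo a b ×ˢ Set.Ioo a' b' ∩ {p | level m p = t}) := by
  have e : Set.Ioo a b ×ˢ Set.Ioo a' b' ∩ {p | level m p = t}
      = (fun u : ℝ => (u, t + m * u ^ 2)) ''
        {u | u ∈ Set.Ioo a b ∧ t + m * u ^ 2 ∈ Set.Ioo a' b'} := by
    ext ⟨u, v⟩
    simp only [Set.mem_inter_iff, Set.mem_prod, Set.mem_ofPred_eq, Set.mem_image, Prod.mk.injEq,
      level]
    constructor
    · rintro ⟨⟨h1, h2⟩, h3⟩
      have : t + m * u ^ 2 = v := by linarith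
      exact ⟨u, ⟨h1, this ▸ h2⟩, rfl, this⟩
    · rintro ⟨x, ⟨h1, h2⟩, rfl, rfl⟩
      exact ⟨⟨h1, h2⟩, by ring⟩
  rw [e]
  refine IsPreconnected.image ?_ _ (contDiff_parabola m t).continuous.continuousOn
  refine (Set.OrdConnected.isPreconnected ⟨?_⟩)
  rintro x ⟨⟨x1, x2⟩, x3, x4⟩ y ⟨⟨y1, y2⟩, y3, y4⟩ z ⟨z1, z2⟩
  refine ⟨⟨x1.trans_le z1, z2.trans_lt y2⟩, ?_⟩
  rcases h with h | h
  · have p1 : x ^ 2 ≤ z ^ 2 := by nlinarith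
    have p2 : z ^ 2 ≤ y ^ 2 := by nlinarith
    constructor <;> rcases le_or_gt 0 m with hm | hm <;> nlinarith
  · have p1 : z ^ 2 ≤ x ^ 2 := by nlinarith
    have p2 : y ^ 2 ≤ z ^ 2 := by nlinarith
    constructor <;> rcases le_or_gt 0 m with hm | hm <;> nlinarith

/-- Every point off the axis has arbitrarily small neighbourhoods with connected level sets. -/
lemma exists_isOpen_connectedLevels (c : ℝ) {Ω : Set (ℝ × ℝ)} (hΩ : IsOpen Ω) {p : ℝ × ℝ}
    (hp : p ∈ Ω) (hp1 : p.1 ≠ 0) : ∃ U ⊆ Ω, IsOpen U ∧ p ∈ U ∧ ConnectedLevels c U := by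
  obtain ⟨V, hV, W, hW, hVW⟩ := mem_nhds_prod_iff.1 (hΩ.mem_nhds hp)
  obtain ⟨a', b', hw, hw'⟩ := mem_nhds_iff_exists_Ioo_subset.1 hW
  obtain ⟨a, b, hv, hv', hs⟩ : ∃ a b, p.1 ∈ Set.Ioo a b ∧ Set.Ioo a b ⊆ V ∧ (0 < a ∨ b < 0) := by
    obtain ⟨a, b, hv, hv'⟩ := mem_nhds_iff_exists_Ioo_subset.1 hV
    rcases lt_or_gt_of_ne hp1 with h | h
    · refine ⟨a, min b (p.1 / 2), ⟨hv.1, lt_min hv.2 (by linarith)⟩,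
        (Set.Ioo_subset_Ioo_right (min_le_left _ _)).trans hv', Or.inr ?_⟩
      exact (min_le_right _ _).trans_lt (by linarith)
    · refine ⟨max a (p.1 / 2), b, ⟨max_lt hv.1 (by linarith), hv.2⟩,
        (Set.Ioo_subset_Ioo_left (le_max_left _ _)).trans hv', Or.inl ?_⟩
      exact (by linarith : 0 < p.1 / 2).trans_le (le_max_right _ _)
  refine ⟨Set.Ioo a b ×ˢ Set.Ioo a' b', (Set.prod_mono hv' hw').trans hVW,
    isOpen_Ioo.prod isOpen_Ioo, ⟨hv, hw⟩, fun t => ?_⟩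
  rw [invA_eq_level, invB_eq_level]
  exact ⟨isPreconnected_level_box hs _ _, isPreconnected_level_box hs _ _⟩

end Level

section

variable {c : ℝ} {Ω U : Set (ℝ × ℝ)} {φ₁ φ₂ : ℝ × ℝ → ℝ}

lemma IsParameterPair.mono (h : IsParameterPair c Ω φ₁ φ₂) (hU : U ⊆ Ω) :
    IsParameterPair c U φ₁ φ₂ :=
  ⟨h.smooth₁.mono hU, h.smooth₂.mono hU, fun p hp => h.d2 p (hU hp), fun p hp => h.d1 p (hU hp)⟩

/-- On a domain with connected level sets a parameter pair is given by functions of the Riemann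
invariants. -/
lemma IsParameterPair.exists_eq_a23 (h : IsParameterPair c U φ₁ φ₂) (hU : IsOpen U)
    (hu : ∀ p ∈ U, p.1 ≠ 0) (hc : ConnectedLevels c U) :
    ∃ F₁ F₂ : ℝ → ℝ, AdmissiblePair c U F₁ F₂ ∧
      ∀ p ∈ U, normalParam c φ₁ φ₂ p = a23 c F₁ F₂ p := by
  unfold ConnectedLevels at hc
  rw [invA_eq_level, invB_eq_level] at hc
  -- Dividing by the integrating factors makes `k₁` constant along the parabolas of `invA` and `k₂`
  -- along those of `invB`; these are integral curves of multiples of the fields of `D2` and `D1`.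
  let k₁ : ℝ × ℝ → ℝ := fun p => |p.1| ^ (-(4 * c + 4)) * (-(8 * (c + 1) ^ 2) * φ₁ p)
  let k₂ : ℝ × ℝ → ℝ := fun p => |p.1| ^ (-(-4 * c - 2)) * (2 * (2 * c + 1) ^ 2 * φ₂ p)
  have s₁ : ContDiffOn ℝ ∞ k₁ U :=
    (contDiffOn_abs_rpow hu _).mul (contDiffOn_const.mul h.smooth₁)
  have s₂ : ContDiffOn ℝ ∞ k₂ U :=
    (contDiffOn_abs_rpow hu _).mul (contDiffOn_const.mul h.smooth₂)
  obtain ⟨F₁, hF₁, e₁⟩ := exists_eq_comp_level (m := c + 1) hU s₁ (fun p hp => by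
    have hp1 := hu p hp
    have d : D2 c k₁ p = 0 := by
      rw [((hasD_abs_rpow (-(4 * c + 4)) hp1).mul
        ((hasD_of_contDiffOn hU hu h.smooth₁ hp).const_mul _)).d2 hp1, h.d2 p hp]
      ring
    have : ((1, 2 * (c + 1) * p.1) : ℝ × ℝ) = p.1 • ((1 / p.1, 2 * (c + 1)) : ℝ × ℝ) := by
      ext
      · simp [hp1]
      · simp [mul_comm]
    rw [this, map_smul]
    exact (congrArg (p.1 • ·) d).trans (smul_zero _)) fun t => (hc t).1
  obtain ⟨F₂, hF₂, e₂⟩ := exists_eq_comp_level (m := c + 1 / 2) hU s₂ (fun p hp => by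
    have hp1 := hu p hp
    have d : D1 c k₂ p = 0 := by
      rw [((hasD_abs_rpow (-(-4 * c - 2)) hp1).mul
        ((hasD_of_contDiffOn hU hu h.smooth₂ hp).const_mul _)).d1 hp1, h.d1 p hp]
      ring
    have : ((1, 2 * (c + 1 / 2) * p.1) : ℝ × ℝ) = (-p.1) • ((-1 / p.1, -(2 * c + 1)) : ℝ × ℝ) := by
      ext
      · simp only [Prod.smul_fst, smul_eq_mul]; field_simp
      · simp only [Prod.smul_snd, smul_eq_mul]; ring
    rw [this, map_smul]
    exact (congrArg (-p.1 • ·) d).trans (smul_zero _)) fun t => (hc t).2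
  refine ⟨F₁, F₂, ⟨by rwa [invA_eq_level], by rwa [invB_eq_level]⟩, fun p hp => ?_⟩
  have n (a : ℝ) : |p.1| ^ a * |p.1| ^ (-a) = 1 := by
    rw [← Real.rpow_add (abs_pos.2 (hu p hp)), add_neg_cancel, Real.rpow_zero]
  simp only [a23, normalParam, invA_eq_level, invB_eq_level, ← e₁ p hp, ← e₂ p hp, k₁, k₂,
    ← mul_assoc, n]
  ring

end

/-! ### Invariance of the two parameters -/

section

variable {c : ℝ} {Ω : Set (ℝ × ℝ)} {p : ℝ × ℝ}

/-- The action of the leading coefficients of a pair of degree one polynomials. -/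
def lead1 (P₁ P₂ : Poly1) (p X : ℝ × ℝ) : ℝ × ℝ :=
  (P₁.ux p * X.1 + P₁.vx p * X.2, P₂.ux p * X.1 + P₂.vx p * X.2)

/-- The action of the coefficients of the second derivatives in a pair of degree two
polynomials. -/
def lead2 (A₁ A₂ : Poly2) (p X : ℝ × ℝ) : ℝ × ℝ :=
  (A₁.uxx p * X.1 + A₁.vxx p * X.2, A₂.uxx p * X.1 + A₂.vxx p * X.2)

lemma hasDerivAt_mul_of_eq_zero {f g : ℝ → ℝ} {g' : ℝ} (hf : DifferentiableAt ℝ f 0)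
    (hg : HasDerivAt g g' 0) (h : g 0 = 0) : HasDerivAt (fun s => f s * g s) (f 0 * g') 0 :=
  (hf.hasDerivAt.mul hg).congr_deriv (by rw [h]; ring)

lemma Poly1.hasDerivAt_onJet {P : Poly1} (hΩ : IsOpen Ω) (hP : P.SmoothOn Ω) (hp : p ∈ Ω)
    (δ : Jet) : HasDerivAt (fun s : ℝ => P.onJet (p + s • δ.1, s • δ.2))
      (P.ux p * δ.2.1.1 + P.vx p * δ.2.1.2) 0 := by
  have k : ∀ {f : ℝ × ℝ → ℝ}, ContDiffOn ℝ ∞ f Ω → ∀ b : ℝ,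
      HasDerivAt (fun s : ℝ => f (p + s • δ.1) * (s * b)) (f p * b) 0 := fun {f} hf b => by
    have d : DifferentiableAt ℝ f (p + (0 : ℝ) • δ.1) := by
      simpa using (eventually_contDiffAt_infty hΩ hf hp).differentiableAt (by simp)
    simpa using hasDerivAt_mul_of_eq_zero (f := fun s : ℝ => f (p + s • δ.1))
      (g := fun s => s * b) (DifferentiableAt.comp (0 : ℝ) d (by fun_prop))
      (by simpa using (hasDerivAt_id (0 : ℝ)).mul_const b) (by simp)
  exact (k hP.1 _).add (k hP.2 _)

lemma Poly2.hasDerivAt_onJet {P : Poly2} (hΩ : IsOpen Ω) (hP : P.SmoothOn Ω) (hp : p ∈ Ω)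
    (δ : Jet) : HasDerivAt (fun s : ℝ => P.onJet (p + s • δ.1, s • δ.2))
      (P.uxx p * δ.2.2.1 + P.vxx p * δ.2.2.2) 0 := by
  have k : ∀ {f : ℝ × ℝ → ℝ}, ContDiffOn ℝ ∞ f Ω → ∀ {g : ℝ → ℝ} {b : ℝ}, HasDerivAt g b 0 →
      g 0 = 0 → HasDerivAt (fun s : ℝ => f (p + s • δ.1) * g s) (f p * b) 0 :=
    fun {f} hf {g b} hg h => by
    have d : DifferentiableAt ℝ f (p + (0 : ℝ) • δ.1) := by
      simpa using (eventually_contDiffAt_infty hΩ hf hp).differentiableAt (by simp)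
    simpa using hasDerivAt_mul_of_eq_zero (f := fun s : ℝ => f (p + s • δ.1))
      (DifferentiableAt.comp (0 : ℝ) d (by fun_prop)) hg h
  have l : ∀ b : ℝ, HasDerivAt (fun s : ℝ => s * b) b 0 := fun b => by
    simpa using (hasDerivAt_id (0 : ℝ)).mul_const b
  have q : ∀ b d : ℝ, HasDerivAt (fun s : ℝ => (s * b) * (s * d)) 0 0 := fun b d =>
    ((l b).mul (l d)).congr_deriv (by simp)
  have q2 : ∀ b : ℝ, HasDerivAt (fun s : ℝ => (s * b) ^ 2) 0 0 := fun b => by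
    simpa [pow_two] using q b b
  obtain ⟨h1, h2, h3, h4, h5⟩ := hP
  have := ((((k h1 (l δ.2.2.1) (by simp)).add (k h2 (l δ.2.2.2) (by simp))).add
    (k h3 (q2 δ.2.1.1) (by simp))).add (k h4 (q2 δ.2.1.2) (by simp))).add
    (k h5 (q δ.2.1.1 δ.2.1.2) (by simp))
  exact this.congr_deriv (by ring)

lemma fderiv_apply_eq_of_line {G : Jet → ℝ × ℝ} {δ : Jet} {y : ℝ × ℝ}
    (hG : DifferentiableAt ℝ G (p, 0, 0))
    (h : HasDerivAt (fun s : ℝ => G (p + s • δ.1, s • δ.2)) y 0) :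
    fderiv ℝ G (p, 0, 0) δ = y := by
  have l : HasDerivAt (fun s : ℝ => (p, 0, 0) + s • δ) δ 0 := by
    simpa using ((hasDerivAt_id (0:ℝ)).smul_const δ).const_add ((p, 0, 0) : Jet)
  have hG' : HasFDerivAt G (fderiv ℝ G (p, 0, 0)) ((p, 0, 0) + (0 : ℝ) • δ) := by
    simpa using hG.hasFDerivAt
  refine (hG'.comp_hasDerivAt (0 : ℝ) l).unique (h.congr_of_eventuallyEq
    (Eventually.of_forall fun s => ?_))
  simp only [Function.comp]
  congr 1
  refine Prod.ext rfl ?_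
  change (0 : (ℝ × ℝ) × (ℝ × ℝ)) + s • δ.2 = s • δ.2
  rw [zero_add]

/-- Where all derivatives vanish, variations of the coefficients multiply zero and only the highest
derivatives enter linearly. The same holds for `fderiv_flux2`, where products of derivatives have no
linear part. -/
lemma fderiv_flux1 {P₁ P₂ : Poly1} (hΩ : IsOpen Ω) (h₁ : P₁.SmoothOn Ω) (h₂ : P₂.SmoothOn Ω)
    (hp : p ∈ Ω) (δ : Jet) : fderiv ℝ (flux1 P₁ P₂) (p, 0, 0) δ = lead1 P₁ P₂ p δ.2.1 :=
  fderiv_apply_eq_of_line (differentiableAt_flux hΩ (contDiffOn_flux1 h₁ h₂) hp)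
    ((Poly1.hasDerivAt_onJet hΩ h₁ hp δ).prodMk (Poly1.hasDerivAt_onJet hΩ h₂ hp δ))

lemma fderiv_flux2 {A₁ A₂ : Poly2} (hΩ : IsOpen Ω) (h₁ : A₁.SmoothOn Ω) (h₂ : A₂.SmoothOn Ω)
    (hp : p ∈ Ω) (δ : Jet) : fderiv ℝ (flux2 A₁ A₂) (p, 0, 0) δ = lead2 A₁ A₂ p δ.2.2 :=
  fderiv_apply_eq_of_line (differentiableAt_flux hΩ (contDiffOn_flux2 h₁ h₂) hp)
    ((Poly2.hasDerivAt_onJet hΩ h₁ hp δ).prodMk (Poly2.hasDerivAt_onJet hΩ h₂ hp δ))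

/-- A test configuration with vanishing first and second derivatives at the origin. -/
def cubicCurve (p T : ℝ × ℝ) : Curve := fun x => p + x ^ 3 • T

lemma contDiff_cubicCurve (p T : ℝ × ℝ) : ContDiff ℝ ∞ (cubicCurve p T) := by
  unfold cubicCurve; fun_prop

lemma deriv_cubicCurve (p T : ℝ × ℝ) :
    deriv (cubicCurve p T) = (fun x => (3 * x ^ 2) • T) ∧
      deriv (deriv (cubicCurve p T)) = (fun x => (6 * x) • T) ∧
      deriv (deriv (deriv (cubicCurve p T))) = fun _ => (6 : ℝ) • T := by
  have h1 : deriv (cubicCurve p T) = fun x => (3 * x ^ 2) • T := by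
    funext x
    exact ((((hasDerivAt_pow 3 x).smul_const T).const_add p).congr_deriv (by simp)).deriv
  have h2 : deriv (deriv (cubicCurve p T)) = fun x => (6 * x) • T := by
    rw [h1]
    funext x
    refine ((((hasDerivAt_pow 2 x).const_mul 3).smul_const T).congr_deriv ?_).deriv
    congr 1
    simp
    ring
  refine ⟨h1, h2, ?_⟩
  rw [h2]
  funext x
  exact ((((hasDerivAt_id x).const_mul 6).smul_const T).congr_deriv (by simp)).deriv

lemma jet_cubicCurve (p T : ℝ × ℝ) : jet (cubicCurve p T) 0 = (p, 0, 0) := by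
  obtain ⟨h1, h2, -⟩ := deriv_cubicCurve p T
  simp only [jet, h2]
  simp [h1, cubicCurve]

lemma flow_cubicCurve {G : Jet → ℝ × ℝ} {T : ℝ × ℝ} (hG : DifferentiableAt ℝ G (p, 0, 0)) :
    HasDerivAt (fun x => G (jet (cubicCurve p T) x)) (fderiv ℝ G (p, 0, 0) (0, 0, (6 : ℝ) • T))
      0 := by
  have h := hasDerivAt_jet (contDiff_cubicCurve p T).contDiffAt (y := 0)
  have e : jet (deriv (cubicCurve p T)) 0 = (0, 0, (6 : ℝ) • T) := by
    obtain ⟨h1, h2, h3⟩ := deriv_cubicCurve p T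
    simp only [jet, h3]
    simp only [h2]
    simp [h1]
  rw [e] at h
  have hG' : HasFDerivAt G (fderiv ℝ G (p, 0, 0)) (jet (cubicCurve p T) 0) := by
    rw [jet_cubicCurve]
    exact hG.hasFDerivAt
  exact hG'.comp_hasDerivAt (0 : ℝ) h

end

section

variable {c : ℝ} {Ω : Set (ℝ × ℝ)} {p : ℝ × ℝ}

lemma lead1_smul (P₁ P₂ : Poly1) (p X : ℝ × ℝ) (s : ℝ) :
    lead1 P₁ P₂ p (s • X) = s • lead1 P₁ P₂ p X := by
  ext
  · simp only [lead1, Prod.smul_fst, Prod.smul_snd, smul_eq_mul]; ring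
  · simp only [lead1, Prod.smul_fst, Prod.smul_snd, smul_eq_mul]; ring

lemma lead2_add_smul (A₁ A₂ : Poly2) (p X Y : ℝ × ℝ) (s : ℝ) :
    lead2 A₁ A₂ p (X + s • Y) = lead2 A₁ A₂ p X + s • lead2 A₁ A₂ p Y := by
  ext
  · simp only [lead2, Prod.smul_fst, Prod.smul_snd, smul_eq_mul, Prod.fst_add, Prod.snd_add]; ring
  · simp only [lead2, Prod.smul_fst, Prod.smul_snd, smul_eq_mul, Prod.fst_add, Prod.snd_add]; ring

lemma jet_sq_smul {E : ℝ → ℝ × ℝ} {h : Curve} (hE : ContDiffAt ℝ ∞ E 0)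
    (e : h =ᶠ[𝓝 0] fun x => x ^ 2 • E x) : jet h 0 = (0, 0, (2 : ℝ) • E 0) := by
  have e1 : deriv h =ᶠ[𝓝 0] fun x => x ^ 2 • deriv E x + (2 * x) • E x := by
    filter_upwards [e.deriv, eventually_contDiffAt hE] with x hx hEx
    rw [hx]
    exact (((hasDerivAt_pow 2 x).congr_deriv (by simp)).smul
      (hEx.differentiableAt one_ne_zero).hasDerivAt).deriv
  have d0 := (hE.differentiableAt (by simp)).hasDerivAt
  have d1 := ((contDiffAt_deriv hE).differentiableAt (by simp)).hasDerivAt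
  have e2 : HasDerivAt (fun x : ℝ => x ^ 2 • deriv E x + (2 * x) • E x) ((2 : ℝ) • E 0) 0 :=
    (((hasDerivAt_pow 2 (0 : ℝ)).smul d1).add
      (((hasDerivAt_id (0 : ℝ)).const_mul 2).smul d0)).congr_deriv (by simp)
  simp only [jet, e1.deriv_eq, e2.deriv]
  rw [e.eq_of_nhds, e1.eq_of_nhds]
  simp

lemma jet_flow_pointFlux_cubicCurve (hΩ : IsOpen Ω) {f : ℝ × ℝ → ℝ × ℝ}
    (hf : ContDiffOn ℝ ∞ f Ω) (hp : p ∈ Ω) (T : ℝ × ℝ) :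
    jet (flow (pointFlux f) (cubicCurve p T)) 0 = (0, 0, fderiv ℝ f p ((6 : ℝ) • T)) := by
  have hq := contDiff_cubicCurve p T
  have h0 : cubicCurve p T 0 = p := by simp [cubicCurve]
  have hf' : ContDiffAt ℝ ∞ (fderiv ℝ f) (cubicCurve p T 0) :=
    (eventually_contDiffAt_infty hΩ hf (by rwa [h0])).fderiv_right (by simp)
  have hf'' : ContDiffAt ℝ ∞ (fun x => fderiv ℝ f (cubicCurve p T x)) 0 :=
    hf'.comp (0 : ℝ) hq.contDiffAt
  have hE : ContDiffAt ℝ ∞ (fun x => (3 : ℝ) • fderiv ℝ f (cubicCurve p T x) T) 0 :=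
    (hf''.clm_apply contDiffAt_const).const_smul (3 : ℝ)
  rw [jet_sq_smul hE]
  · simp only [h0, smul_smul, map_smul]
    norm_num
  · filter_upwards [eventually_mem hΩ hq.contDiffAt (x := 0) (by rwa [h0])] with x hx
    rw [flow_pointFlux hΩ hf hq hx, (deriv_cubicCurve p T).1, map_smul, smul_smul, mul_comm]

lemma variation_miura {Y₁ Y₂ : Jet → ℝ × ℝ} (hΩ : IsOpen Ω) (h₁ : ContDiffOn ℝ ∞ Y₁ (jetDomain Ω))
    (h₂ : ContDiffOn ℝ ∞ Y₂ (jetDomain Ω)) {q h : Curve} {x : ℝ} (hq : ContDiffAt ℝ ∞ q x)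
    (hh : ContDiffAt ℝ ∞ h x) (hx : q x ∈ Ω) (ε : ℝ) :
    variation (miura (fun q x => Y₁ (jet q x)) (fun q x => Y₂ (jet q x)) ε) q h x
      = h x + ε • fderiv ℝ Y₁ (jet q x) (jet h x) + ε ^ 2 • fderiv ℝ Y₂ (jet q x) (jet h x) := by
  have k : ∀ {Y : Jet → ℝ × ℝ}, ContDiffOn ℝ ∞ Y (jetDomain Ω) →
      HasDerivAt (fun s : ℝ => Y (jet (q + s • h) x)) (fderiv ℝ Y (jet q x) (jet h x)) 0 := by
    intro Y hY
    have l : HasDerivAt (fun s : ℝ => jet q x + s • jet h x) (jet h x) 0 := by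
      simpa using ((hasDerivAt_id (0:ℝ)).smul_const (jet h x)).const_add (jet q x)
    have d : HasFDerivAt Y (fderiv ℝ Y (jet q x)) (jet q x + (0 : ℝ) • jet h x) := by
      simpa using (differentiableAt_flux hΩ hY (j := jet q x) hx).hasFDerivAt
    simp only [jet_add_smul hq hh]
    exact d.comp_hasDerivAt (0 : ℝ) l
  have l : HasDerivAt (fun s : ℝ => q x + s • h x) (h x) 0 := by
    simpa using ((hasDerivAt_id (0:ℝ)).smul_const (h x)).const_add (q x)
  exact ((l.add ((k h₁).const_smul ε)).add ((k h₂).const_smul (ε ^ 2))).deriv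

/-- The leading coefficients of deformations related by a Miura transformation. -/
lemma Transforms.lead2_eq (hΩ : IsOpen Ω) {a₁ a₂ b₁ b₂ Q₁ Q₂ : Poly2} {P₁ P₂ : Poly1}
    (ha₁ : a₁.SmoothOn Ω) (ha₂ : a₂.SmoothOn Ω) (hb₁ : b₁.SmoothOn Ω) (hb₂ : b₂.SmoothOn Ω)
    (hP₁ : P₁.SmoothOn Ω) (hP₂ : P₂.SmoothOn Ω) (hQ₁ : Q₁.SmoothOn Ω) (hQ₂ : Q₂.SmoothOn Ω)
    (h : Transforms Ω (op1 P₁ P₂) (op2 Q₁ Q₂) (deformedPrimary c a₁ a₂) (deformedPrimary c b₁ b₂))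
    (hp : p ∈ Ω) (X : ℝ × ℝ) :
    lead2 a₁ a₂ p X + lead2 Q₁ Q₂ p (fderiv ℝ (primaryFlux c) p X)
      = fderiv ℝ (primaryFlux c) p (lead2 Q₁ Q₂ p X) + lead2 b₁ b₂ p X := by
  -- The third derivative of x³T is 6T.
  obtain ⟨T, rfl⟩ : ∃ T : ℝ × ℝ, X = (6 : ℝ) • T := ⟨(1 / 6 : ℝ) • X, by rw [smul_smul]; norm_num⟩
  let q := cubicCurve p T
  have hq : ContDiff ℝ ∞ q := contDiff_cubicCurve p T
  have q0 : q 0 = p := by simp [q, cubicCurve]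
  have hq0 : q 0 ∈ Ω := by rwa [q0]
  have jq : jet q 0 = (p, 0, 0) := jet_cubicCurve p T
  have sF := contDiffOn_pointFlux (Ω := Ω) (contDiff_primaryFlux c).contDiffOn
  have sa := contDiffOn_flux2 ha₁ ha₂
  have sb := contDiffOn_flux2 hb₁ hb₂
  have sP := contDiffOn_flux1 hP₁ hP₂
  have sQ := contDiffOn_flux2 hQ₁ hQ₂
  have dp : ∀ {G : Jet → ℝ × ℝ}, ContDiffOn ℝ ∞ G (jetDomain Ω) →
      DifferentiableAt ℝ G (p, 0, 0) := fun hG => differentiableAt_flux hΩ hG hp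
  let y₁ : Curve := fun x => flux1 P₁ P₂ (jet q x)
  let y₂ : Curve := fun x => flux2 Q₁ Q₂ (jet q x)
  have s₁ : ContDiffAt ℝ ∞ y₁ 0 := contDiffAt_flux hΩ sP hq.contDiffAt hq0
  have s₂ : ContDiffAt ℝ ∞ y₂ 0 := contDiffAt_flux hΩ sQ hq.contDiffAt hq0
  have v₁ : y₁ 0 = 0 := by simp [y₁, jq, flux1, Poly1.onJet]
  have v₂ : y₂ 0 = 0 := by simp [y₂, jq, flux2, Poly2.onJet]
  have d₁ : HasDerivAt y₁ 0 0 := by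
    have := flow_cubicCurve (T := T) (dp sP)
    rw [fderiv_flux1 hΩ hP₁ hP₂ hp] at this
    exact this.congr_deriv (by simp [lead1])
  have d₂ : HasDerivAt y₂ (lead2 Q₁ Q₂ p ((6 : ℝ) • T)) 0 := by
    have := flow_cubicCurve (T := T) (dp sQ)
    rwa [fderiv_flux2 hΩ hQ₁ hQ₂ hp] at this
  let k := jet (flow (flux2 a₁ a₂) q) 0
  have hk : k.1 = lead2 a₁ a₂ p ((6 : ℝ) • T) := by
    have := flow_cubicCurve (T := T) (dp sa)
    rw [fderiv_flux2 hΩ ha₁ ha₂ hp] at this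
    exact this.deriv
  let Γ : ℝ × ℝ → ℝ × ℝ := fun z =>
    flux2 b₁ b₂ (jet q z.2 + z.1 • jet y₁ z.2 + z.1 ^ 2 • jet y₂ z.2)
  have sΓ : ContDiffAt ℝ ∞ Γ (0, 0) := by
    have cj : ∀ {r : Curve}, ContDiffAt ℝ ∞ r 0 →
        ContDiffAt ℝ ∞ (fun z : ℝ × ℝ => jet r z.2) ((0, 0) : ℝ × ℝ) :=
      fun hr => (contDiffAt_jet hr).comp ((0, 0) : ℝ × ℝ) contDiffAt_snd
    refine ContDiffAt.comp ((0, 0) : ℝ × ℝ) (eventually_contDiffAt_infty (isOpen_jetDomain hΩ) sb ?_)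
      (((cj hq.contDiffAt).add (contDiffAt_fst.smul (cj s₁))).add
        ((contDiffAt_fst.pow 2).smul (cj s₂)))
    simpa using (show jet q 0 ∈ jetDomain Ω from hq0)
  let m : ℝ → ℝ × ℝ := fun ε => deriv (fun x => Γ (ε, x)) 0
  have hm : ContinuousAt m 0 := (contDiffAt_deriv_section sΓ).continuousAt
  have hm0 : m 0 = lead2 b₁ b₂ p ((6 : ℝ) • T) := by
    have := flow_cubicCurve (T := T) (dp sb)
    rw [fderiv_flux2 hΩ hb₁ hb₂ hp] at this
    simpa [m, Γ] using this.deriv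
  -- On this curve nothing of order below ε² survives, because q and the degree one correction have
  -- zero velocity at 0. The degree one part contributes only through an ε³ term and through `m ε`,
  -- so the limit ε → 0 of the bracketed factor contains leading matrices only.
  have key : ∀ ε : ℝ, variation (miura (op1 P₁ P₂) (op2 Q₁ Q₂) ε) q (deformedPrimary c a₁ a₂ ε q) 0
      - deformedPrimary c b₁ b₂ ε (miura (op1 P₁ P₂) (op2 Q₁ Q₂) ε q) 0
      = ε ^ 2 • (lead2 a₁ a₂ p ((6 : ℝ) • T) + ε • lead1 P₁ P₂ p k.2.1
        + lead2 Q₁ Q₂ p (fderiv ℝ (primaryFlux c) p ((6 : ℝ) • T))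
        + ε ^ 2 • lead2 Q₁ Q₂ p k.2.2 - fderiv ℝ (primaryFlux c) p (lead2 Q₁ Q₂ p ((6 : ℝ) • T))
        - m ε) := by
    intro ε
    have f0 := contDiffAt_flow hΩ sF hq.contDiffAt hq0
    have f2 := contDiffAt_flow hΩ sa hq.contDiffAt hq0
    have hh := flow_add_smul hΩ sF sa (ε ^ 2) hq hq0
    have hs : ContDiffAt ℝ ∞ (flow (fun j => pointFlux (primaryFlux c) j + ε ^ 2 • flux2 a₁ a₂ j) q)
        0 := ContDiffAt.congr_of_eventuallyEq (f0.add (contDiffAt_const.smul f2)) hh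
    have jh : jet (flow (fun j => pointFlux (primaryFlux c) j + ε ^ 2 • flux2 a₁ a₂ j) q) 0
        = (0, 0, fderiv ℝ (primaryFlux c) p ((6 : ℝ) • T)) + ε ^ 2 • k := by
      rw [jet_congr hh, jet_add_smul f0 f2,
        jet_flow_pointFlux_cubicCurve hΩ (contDiff_primaryFlux c).contDiffOn hp]
    have jh0 : flow (fun j => pointFlux (primaryFlux c) j + ε ^ 2 • flux2 a₁ a₂ j) q 0
        = ε ^ 2 • lead2 a₁ a₂ p ((6 : ℝ) • T) := by
      refine (congrArg Prod.fst jh).trans ?_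
      rw [Prod.fst_add, Prod.smul_fst, hk, zero_add]
    have V := variation_miura hΩ sP sQ hq.contDiffAt hs hq0 ε
    rw [jq, fderiv_flux1 hΩ hP₁ hP₂ hp, fderiv_flux2 hΩ hQ₁ hQ₂ hp, jh, jh0] at V
    simp only [Prod.snd_add, Prod.fst_add, Prod.smul_snd, Prod.smul_fst, zero_add] at V
    rw [lead1_smul, lead2_add_smul] at V
    let w : Curve := (q + ε • y₁) + ε ^ 2 • y₂
    have sw : ContDiffAt ℝ ∞ (q + ε • y₁) 0 := hq.contDiffAt.add (contDiffAt_const.smul s₁)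
    have sw' : ContDiffAt ℝ ∞ w 0 := sw.add (contDiffAt_const.smul s₂)
    have w0 : w 0 = p := by simp [w, v₁, v₂, q0]
    have dw : HasDerivAt w (ε ^ 2 • lead2 Q₁ Q₂ p ((6 : ℝ) • T)) 0 := by
      have hq' : HasDerivAt q 0 0 := by
        have := congrArg (fun j : Jet => j.2.1) jq
        have h' := (hq.differentiable (by simp) 0).hasDerivAt
        rwa [show deriv q 0 = 0 from this] at h'
      exact ((hq'.add (d₁.const_smul ε)).add (d₂.const_smul (ε ^ 2))).congr_deriv (by simp)
    have dF : HasDerivAt (fun x => primaryFlux c (w x))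
        (ε ^ 2 • fderiv ℝ (primaryFlux c) p (lead2 Q₁ Q₂ p ((6 : ℝ) • T))) 0 := by
      have hF : HasFDerivAt (primaryFlux c) (fderiv ℝ (primaryFlux c) p) (w 0) := by
        rw [w0]
        exact ((contDiff_primaryFlux c).differentiable (by simp) p).hasFDerivAt
      exact (hF.comp_hasDerivAt (0 : ℝ) dw).congr_deriv (map_smul _ _ _)
    have jw : (fun x => flux2 b₁ b₂ (jet w x)) =ᶠ[𝓝 0] fun x => Γ (ε, x) := by
      filter_upwards [eventually_jet_add_smul hq.contDiffAt s₁, eventually_jet_add_smul sw s₂]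
        with x h1 h2
      simp only [Γ, w, h2, h1]
    have db : HasDerivAt (fun x => flux2 b₁ b₂ (jet w x)) (m ε) 0 := by
      have := ((contDiffAt_flux hΩ sb sw' (by rwa [w0])).differentiableAt (by simp)).hasDerivAt
      rwa [jw.deriv_eq] at this
    have W : flow (fun j => pointFlux (primaryFlux c) j + ε ^ 2 • flux2 b₁ b₂ j) w 0
        = ε ^ 2 • fderiv ℝ (primaryFlux c) p (lead2 Q₁ Q₂ p ((6 : ℝ) • T)) + ε ^ 2 • m ε :=
      (dF.add (db.const_smul (ε ^ 2))).deriv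
    rw [deformedPrimary_eq, deformedPrimary_eq]
    refine (congrArg₂ (· - ·) V W).trans ?_
    module
  have O := h q hq 0 hq0
  simp only [key] at O
  have z := eq_zero_of_isBigO_pow (n := 2) (m := 3) (by norm_num) (by fun_prop) O
  simp only [zero_smul, ne_eq, OfNat.ofNat_ne_zero, not_false_eq_true, zero_pow, add_zero, hm0]
    at z
  rw [sub_sub, sub_eq_zero] at z
  exact z

end

section

variable {c : ℝ} {Ω : Set (ℝ × ℝ)} {p : ℝ × ℝ}

/-- Miura transformations preserve the diagonal of the leading coefficients in the frame of the
Riemann invariants. -/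
lemma Transforms.frame_eq (hΩ : IsOpen Ω) (hu : ∀ p ∈ Ω, p.1 ≠ 0) {a₁ a₂ b₁ b₂ Q₁ Q₂ : Poly2}
    {P₁ P₂ : Poly1} (ha₁ : a₁.SmoothOn Ω) (ha₂ : a₂.SmoothOn Ω) (hb₁ : b₁.SmoothOn Ω)
    (hb₂ : b₂.SmoothOn Ω) (hP₁ : P₁.SmoothOn Ω) (hP₂ : P₂.SmoothOn Ω) (hQ₁ : Q₁.SmoothOn Ω)
    (hQ₂ : Q₂.SmoothOn Ω)
    (h : Transforms Ω (op1 P₁ P₂) (op2 Q₁ Q₂) (deformedPrimary c a₁ a₂) (deformedPrimary c b₁ b₂))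
    (hp : p ∈ Ω) :
    (frame₁ c a₁ a₂).uxx p = (frame₁ c b₁ b₂).uxx p ∧
      (frame₂ c a₁ a₂).vxx p = (frame₂ c b₁ b₂).vxx p := by
  have hp1 := hu p hp
  have d := isDiagonal_primaryFlux (c := c) hu
  -- In the eigenbasis of the primary Jacobian a commutator with it has zero diagonal. Testing on
  -- each eigenvector and pairing with its own covector isolates the diagonal entries.
  have e₁ := h.lead2_eq hΩ ha₁ ha₂ hb₁ hb₂ hP₁ hP₂ hQ₁ hQ₂ hp (-1 / p.1, -(2 * c + 1))
  have e₂ := h.lead2_eq hΩ ha₁ ha₂ hb₁ hb₂ hP₁ hP₂ hQ₁ hQ₂ hp (1 / p.1, 2 * (c + 1))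
  have l₁ := congrArg (L1 c p) e₁
  have l₂ := congrArg (L2 c p) e₂
  simp only [d.fderiv_apply hp, lead2, map_add, L1_apply, L2_apply] at l₁ l₂
  simp only [frame₁, frame₂, Poly2.comb, Poly2.toInv]
  constructor
  · rw [← sub_eq_zero] at l₁ ⊢
    rw [← l₁]
    field_simp
    ring
  · rw [← sub_eq_zero] at l₂ ⊢
    rw [← l₂]
    field_simp
    ring

/-- The Miura-generated part has no diagonal second-order coefficients, so these entries are 2φᵢ
∂ᵢλᵢ from the canonical part. -/
lemma frame_normal_a23 (hc₁ : c ≠ -3 / 4) (hc₂ : c ≠ -1 / 2) (hc₃ : c ≠ -1) (hΩ : IsOpen Ω)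
    (hu : ∀ p ∈ Ω, p.1 ≠ 0) {F₁ F₂ : ℝ → ℝ} (hF : AdmissiblePair c Ω F₁ F₂) (hp : p ∈ Ω) :
    (frame₁ c (normal₁ c (a23 c F₁ F₂)) (normal₂ c (a23 c F₁ F₂))).uxx p
      = -(|p.1| ^ (4 * c + 4) / (2 * (c + 1) * p.1)) * F₁ (invA c p) ∧
    (frame₂ c (normal₁ c (a23 c F₁ F₂)) (normal₂ c (a23 c F₁ F₂))).vxx p
      = -(|p.1| ^ (-4 * c - 2) / ((2 * c + 1) * p.1)) * F₂ (invB c p) := by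
  have n1 : c + 1 ≠ 0 := fun h => hc₃ (by linarith)
  have n2 : 2 * c + 1 ≠ 0 := fun h => hc₂ (by linarith)
  have n2' : c * 2 + 1 ≠ 0 := mul_comm c 2 ▸ n2
  have hp1 := hu p hp
  obtain ⟨⟨e₁, -⟩, -, e₂, -⟩ := frame_normal hc₁ hc₂ hc₃ hΩ hu (hF.isParameterPair hΩ hu _ _)
    (fun p _ => a23_eq_normalParam hc₂ hc₃ F₁ F₂ p) hp
  rw [e₁, e₂]
  simp only [Poly2.add, Poly2.comb, canon₁, canon₂, gauge₁, gauge₂, D1_lam₁ hp1, D2_lam₂ hp1]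
  constructor
  · field_simp
    ring
  · field_simp
    ring

/-- The parameters of a normal form are invariants of Miura transformations. -/
lemma Transforms.parameters_eq (hc₁ : c ≠ -3 / 4) (hc₂ : c ≠ -1 / 2) (hc₃ : c ≠ -1)
    (hΩ : IsOpen Ω) (hu : ∀ p ∈ Ω, p.1 ≠ 0) {F₁ F₂ G₁ G₂ : ℝ → ℝ} (hF : AdmissiblePair c Ω F₁ F₂)
    (hG : AdmissiblePair c Ω G₁ G₂) {P₁ P₂ : Poly1} {Q₁ Q₂ : Poly2} (hP₁ : P₁.SmoothOn Ω)
    (hP₂ : P₂.SmoothOn Ω) (hQ₁ : Q₁.SmoothOn Ω) (hQ₂ : Q₂.SmoothOn Ω)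
    (h : Transforms Ω (op1 P₁ P₂) (op2 Q₁ Q₂) (normalFlow c (a23 c F₁ F₂))
      (normalFlow c (a23 c G₁ G₂))) (hp : p ∈ Ω) :
    F₁ (invA c p) = G₁ (invA c p) ∧ F₂ (invB c p) = G₂ (invB c p) := by
  have n1 : c + 1 ≠ 0 := fun h => hc₃ (by linarith)
  have n2 : 2 * c + 1 ≠ 0 := fun h => hc₂ (by linarith)
  have hp1 := hu p hp
  have sm : ∀ {F₁ F₂ : ℝ → ℝ}, AdmissiblePair c Ω F₁ F₂ →
      (normal₁ c (a23 c F₁ F₂)).SmoothOn Ω ∧ (normal₂ c (a23 c F₁ F₂)).SmoothOn Ω := fun hF => by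
    have hg : ContDiffOn ℝ ∞ _ Ω := (hF.isParameterPair hΩ hu _ _).contDiffOn_normalParam.congr
      fun p _ => a23_eq_normalParam hc₂ hc₃ _ _ p
    exact ⟨normal₁_smoothOn hc₁ hc₂ hc₃ hΩ hu hg, normal₂_smoothOn hc₁ hc₂ hc₃ hΩ hu hg⟩
  obtain ⟨e₁, e₂⟩ := Transforms.frame_eq hΩ hu (sm hF).1 (sm hF).2 (sm hG).1 (sm hG).2 hP₁ hP₂
    hQ₁ hQ₂ h hp
  obtain ⟨f₁, f₂⟩ := frame_normal_a23 hc₁ hc₂ hc₃ hΩ hu hF hp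
  obtain ⟨g₁, g₂⟩ := frame_normal_a23 hc₁ hc₂ hc₃ hΩ hu hG hp
  rw [f₁, g₁] at e₁
  rw [f₂, g₂] at e₂
  have r (a : ℝ) : |p.1| ^ a ≠ 0 := (Real.rpow_pos_of_pos (abs_pos.2 hp1) a).ne'
  exact ⟨mul_left_cancel₀ (neg_ne_zero.2 (div_ne_zero (r _)
    (mul_ne_zero (mul_ne_zero two_ne_zero n1) hp1))) e₁,
    mul_left_cancel₀ (neg_ne_zero.2 (div_ne_zero (r _) (mul_ne_zero n2 hp1))) e₂⟩

end

end B2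

end

theorem mainTheorem7 (c : ℝ) (hc₁ : c ≠ -3 / 4) (hc₂ : c ≠ -1 / 2) (hc₃ : c ≠ -1)
    (Ω : Set (ℝ × ℝ)) (hΩ : IsOpen Ω) (hu : ∀ p ∈ Ω, p.1 ≠ 0) :
    -- every integrable second-order deformation is Miura equivalent to a normal form
    (∀ a₁ a₂ : B2.Poly2, a₁.SmoothOn Ω → a₂.SmoothOn Ω → B2.IsIntegrable c Ω a₁ a₂ →
      ∃ (β₁ β₂ : B2.Poly1) (g : ℝ × ℝ → ℝ),
        β₁.SmoothOn Ω ∧ β₂.SmoothOn Ω ∧ ContDiffOn ℝ ∞ g Ω ∧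
        B2.Transforms Ω (fun _ _ => 0) (fun q => deriv (B2.op1 β₁ β₂ q))
          (B2.deformedPrimary c a₁ a₂) (B2.normalFlow c g) ∧
        (∀ p₀ ∈ Ω, ∃ U ⊆ Ω, IsOpen U ∧ p₀ ∈ U ∧
          ∃ F₁ F₂ : ℝ → ℝ, B2.AdmissiblePair c U F₁ F₂ ∧ ∀ p ∈ U, g p = B2.a23 c F₁ F₂ p) ∧
        (B2.ConnectedLevels c Ω →
          ∃ F₁ F₂ : ℝ → ℝ, B2.AdmissiblePair c Ω F₁ F₂ ∧ ∀ p ∈ Ω, g p = B2.a23 c F₁ F₂ p)) ∧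
    -- the two functions are arbitrary
    (∀ F₁ F₂ : ℝ → ℝ, B2.AdmissiblePair c Ω F₁ F₂ →
      B2.IsIntegrable c Ω (B2.normal₁ c (B2.a23 c F₁ F₂)) (B2.normal₂ c (B2.a23 c F₁ F₂))) ∧
    -- and they are genuine parameters: no Miura transformation changes them
    (∀ F₁ F₂ G₁ G₂ : ℝ → ℝ, B2.AdmissiblePair c Ω F₁ F₂ → B2.AdmissiblePair c Ω G₁ G₂ →
      ∀ (P₁ P₂ : B2.Poly1) (Q₁ Q₂ : B2.Poly2),
        P₁.SmoothOn Ω → P₂.SmoothOn Ω → Q₁.SmoothOn Ω → Q₂.SmoothOn Ω →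
        B2.Transforms Ω (B2.op1 P₁ P₂) (B2.op2 Q₁ Q₂)
          (B2.normalFlow c (B2.a23 c F₁ F₂)) (B2.normalFlow c (B2.a23 c G₁ G₂)) →
        ∀ p ∈ Ω, F₁ (B2.invA c p) = G₁ (B2.invA c p) ∧ F₂ (B2.invB c p) = G₂ (B2.invB c p)) := by
  refine ⟨fun a₁ a₂ h₁ h₂ h => ?_, fun F₁ F₂ hF => B2.isIntegrable_normal_a23 hc₁ hc₂ hc₃ hΩ hu hF,
    fun F₁ F₂ G₁ G₂ hF hG P₁ P₂ Q₁ Q₂ hP₁ hP₂ hQ₁ hQ₂ h p hp =>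
      B2.Transforms.parameters_eq hc₁ hc₂ hc₃ hΩ hu hF hG hP₁ hP₂ hQ₁ hQ₂ h hp⟩
  obtain ⟨β₁, β₂, φ₁, φ₂, hβ₁, hβ₂, hφ, hT⟩ := h.exists_transforms hc₁ hc₂ hc₃ hΩ hu h₁ h₂
  refine ⟨β₁, β₂, B2.normalParam c φ₁ φ₂, hβ₁, hβ₂, hφ.contDiffOn_normalParam, hT,
    fun p hp => ?_, hφ.exists_eq_a23 hΩ hu⟩
  -- The local form is the global one on a small box around `p`, whose level sets are connected.
  obtain ⟨U, hUΩ, hU, hpU, hc⟩ := B2.exists_isOpen_connectedLevels c hΩ hp (hu p hp)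
  exact ⟨U, hUΩ, hU, hpU, (hφ.mono hUΩ).exists_eq_a23 hU (fun p hp => hu p (hUΩ hp)) hc⟩
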